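/- Let $(M,\tau)$ be a tracial von Neumann algebra ($\tau$ a faithful normal tracial state), and let $(\widetilde M,\alpha,\beta)$ be an s-malleable deformation of $M$. That is, $M\le\widetilde M$ is a trace-preserving unital inclusion of tracial von Neumann algebras; $\alpha\colon\mathbb R\to\mathrm{Aut}(\widetilde M)$ is an action by trace-preserving $*$-automorphisms with $\|\alpha_t(x)-x\|_2\to0$ as $t\to0$ for every $x\in\widetilde M$, where $\|x\|_2=\tau(x^*x)^{1/2}$; and $\beta$ is a trace-preserving $*$-automorphism of $\widetilde M$ with $\beta|_M=\mathrm{id}$, $\beta^2=\mathrm{id}$ and $\beta\alpha_t=\alpha_{-t}\beta$ for all $t\in\mathbb R$. For a von Neumann subalgebra $P\le pMp$ (with unit $p$), where $p\in M$ is a projection, put $\varepsilon_t(P)=\sup\{\|\alpha_t(x)-x\|_2: x\in P,\ \|x\|\le1\}$, and call $P$ $\alpha$-rigid if $\varepsilon_t(P)\to0$ as $t\to0$. Let $p\in M$ be a projection and let $Q\le pMp$ be $\alpha$-rigid. View $L^2(pMp)$ and $L^2(p\widetilde Mp)\ominus L^2(pMp)$ as $Q$-$Q$ bimodules, and let $\mathcal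 H_s$ be the set of all $\xi\in L^2(pMp)$ such that $T\xi=0$ for every bounded $Q$-$Q$ bimodular map $T\colon L^2(pMp)\to L^2(p\widetilde Mp)\ominus L^2(pMp)$. For $\xi\in L^2(pMp)$ let $L_\xi$ be the closure of the densely defined operator $x\mapsto\xi x$ on $L^2(pMp)$ with domain $pMp$. Let $W^*(\mathcal H_s)$ be the von Neumann algebra on $L^2(pMp)$ generated by the operators $U_\xi$ and $1_E(|L_\xi|)$, for $\xi\in\mathcal H_s$ and $E$ a Borel set, where $L_\xi=U_\xi|L_\xi|$ is the polar decomposition. Then $W^*(\mathcal H_s)$ is contained in $pMp$ (acting on $L^2(pMp)$ by left multiplication), it is $\alpha$-rigid, and \[\varepsilon_{2t}(W^*(\mathcal H_s))\le 24\,\varepsilon_t(Q)\qquad\text{for all } t\in\mathbb R.\] -/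

import Mathlib

open scoped ComplexOrder InnerProductSpace Topology ENNReal

noncomputable section

namespace VonNeumannAlgebra

variable {H : Type*} [NormedAddCommGroup H] [InnerProductSpace ℂ H] [CompleteSpace H]

/-! ### A von Neumann algebra is a C⋆-algebra, ordered as a subset of `B(H)` -/

instance instSMulMemClass : SMulMemClass (VonNeumannAlgebra H) ℂ (H →L[ℂ] H) where
  smul_mem {s} c _ hx := s.toStarSubalgebra.smul_mem hx c

instance instIsClosedCoe (N : VonNeumannAlgebra H) : IsClosed (N : Set (H →L[ℂ] H)) := by
  rw [← N.centralizer_centralizer]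
  exact Set.isClosed_centralizer _

theorem exists_eq_star_mul_self (N : VonNeumannAlgebra H) (x : N)
    (h : (0 : H →L[ℂ] H) ≤ x) : ∃ s : N, x = star s * s := by
  have hsa : IsSelfAdjoint x := Subtype.ext (IsSelfAdjoint.of_nonneg h).star_eq
  have hcl : IsClosed (N.toStarSubalgebra : Set (H →L[ℂ] H)) := N.instIsClosedCoe
  have hspec : spectrum ℂ x = spectrum ℂ (x : H →L[ℂ] H) :=
    StarSubalgebra.spectrum_eq (hS := hcl) (a := (⟨x, x.2⟩ : N.toStarSubalgebra))
  have hr : SpectrumRestricts x ContinuousMap.realToNNReal := by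
    rw [SpectrumRestricts.nnreal_iff]
    intro r hr
    rw [← spectrum.algebraMap_mem_iff ℂ, hspec, spectrum.algebraMap_mem_iff ℂ] at hr
    exact spectrum_nonneg_of_nonneg h hr
  obtain ⟨s, hs, -, hs'⟩ := CFC.exists_sqrt_of_isSelfAdjoint_of_quasispectrumRestricts hsa
    (by simpa using hr)
  exact ⟨s, by rw [hs.star_eq, hs']⟩

instance instStarOrderedRing (N : VonNeumannAlgebra H) : StarOrderedRing N := by
  refine StarOrderedRing.of_nonneg_iff' (fun {x y} h z => ?_) (fun x => ⟨fun h => ?_, ?_⟩)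
  · have h' : (x : H →L[ℂ] H) ≤ y := h
    exact add_le_add_right h' (z : H →L[ℂ] H)
  · exact N.exists_eq_star_mul_self x h
  · rintro ⟨s, rfl⟩
    exact star_mul_self_nonneg (s : H →L[ℂ] H)

/-! ### Von Neumann algebras generated by closed unbounded operators -/

section Unbounded

variable {E : Type*} [NormedAddCommGroup E] [InnerProductSpace ℂ E] [CompleteSpace E]

/-- `T = U A` is the polar decomposition of `T`: `A` is positive and self-adjoint with the domain
of `T`, and `U` is the partial isometry with initial space the closure of the range of `A`.
Thus `A = |T|`. -/
structure IsPolarDecomposition (T : E →ₗ.[ℂ] E) (U : E →L[ℂ] E) (A : E →ₗ.[ℂ] E) : Prop where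
  selfAdjoint : IsSelfAdjoint A
  nonneg : ∀ x : A.domain, 0 ≤ ⟪(x : E), A x⟫_ℂ
  domain_eq : T.domain = A.domain
  apply_eq : ∀ (x : T.domain) (y : A.domain), (x : E) = y → T x = U (A y)
  isometry : ∀ y : A.domain, ‖U (A y)‖ = ‖A y‖
  ker : ∀ z : E, (∀ y : A.domain, ⟪A y, z⟫_ℂ = 0) → U z = 0

/-- A projection-valued measure on the Borel subsets of `ℝ`. -/
structure SpectralResolution (E : Type*) [NormedAddCommGroup E] [InnerProductSpace ℂ E]
    [CompleteSpace E] where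
  proj : Set ℝ → E →L[ℂ] E
  isStarProjection : ∀ S, MeasurableSet S → IsStarProjection (proj S)
  univ : proj Set.univ = 1
  inter : ∀ S S', MeasurableSet S → MeasurableSet S' → proj (S ∩ S') = proj S * proj S'
  iUnion : ∀ S : ℕ → Set ℝ, (∀ n, MeasurableSet (S n)) → Pairwise (Function.onFun Disjoint S) →
    ∀ x : E, HasSum (fun n => proj (S n) x) (proj (⋃ n, S n) x)

namespace SpectralResolution

variable (P : SpectralResolution E)

theorem inner_proj (x : E) {S : Set ℝ} (hS : MeasurableSet S) :
    (⟪x, P.proj S x⟫_ℂ).re = ‖P.proj S x‖ ^ 2 := by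
  have h := P.isStarProjection S hS
  have h1 : P.proj S x = P.proj S (P.proj S x) :=
    (congrArg (fun B : E →L[ℂ] E => B x) h.isIdempotentElem.eq).symm
  rw [h1, ← ContinuousLinearMap.adjoint_inner_left]
  rw [← ContinuousLinearMap.star_eq_adjoint, h.isSelfAdjoint.star_eq, ← h1]
  exact inner_self_eq_norm_sq (𝕜 := ℂ) _

/-- The scalar measure `S ↦ ‖P(S) x‖² = ⟪x, P(S) x⟫`. -/
def measure (x : E) : MeasureTheory.Measure ℝ :=
  MeasureTheory.Measure.ofMeasurable (fun S _ => ENNReal.ofReal (‖P.proj S x‖ ^ 2))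
    (by
      have h := P.iUnion (fun _ => ∅) (fun _ => MeasurableSet.empty) (fun _ _ _ => by simp [Function.onFun]) x
      have h0 : P.proj ∅ x = 0 := by
        have h' := h.summable.tendsto_atTop_zero
        exact tendsto_nhds_unique tendsto_const_nhds h'
      simp [h0])
    (by
      intro S hS hd
      have h := P.iUnion S hS hd x
      have h2 : HasSum (fun n => ‖P.proj (S n) x‖ ^ 2) (‖P.proj (⋃ n, S n) x‖ ^ 2) := by
        have h3 := (Complex.reCLM.hasSum ((innerSL ℂ x).hasSum h))
        rw [← P.inner_proj x (MeasurableSet.iUnion hS)]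
        exact (funext fun n => P.inner_proj x (hS n)) ▸ h3
      rw [← h2.tsum_eq, ENNReal.ofReal_tsum_of_nonneg (fun n => by positivity) h2.summable])

end SpectralResolution

/-- `P` is the spectral resolution of `A`, i.e. `A = ∫ s dP(s)`; then `P(S) = 1_S(A)`. -/
structure IsSpectralResolutionOf (P : SpectralResolution E) (A : E →ₗ.[ℂ] E) : Prop where
  mem_domain_iff : ∀ x : E,
    x ∈ A.domain ↔ MeasureTheory.Integrable (fun s : ℝ => s ^ 2) (P.measure x)
  inner_apply : ∀ x : A.domain, ⟪(x : E), A x⟫_ℂ = ((∫ s, s ∂(P.measure (x : E)) : ℝ) : ℂ)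

/-- The von Neumann algebra `S''` on `E` generated by a set `S` of bounded operators. -/
def generatedBy (S : Set (E →L[ℂ] E)) : VonNeumannAlgebra E where
  toStarSubalgebra := StarSubalgebra.centralizer ℂ
    (StarSubalgebra.centralizer ℂ S : Set (E →L[ℂ] E))
  centralizer_centralizer' := by
    have h : ((StarSubalgebra.centralizer ℂ
        (StarSubalgebra.centralizer ℂ S : Set (E →L[ℂ] E)) : StarSubalgebra ℂ (E →L[ℂ] E)) :
          Set (E →L[ℂ] E)) = Set.centralizer (StarSubalgebra.centralizer ℂ S : Set (E →L[ℂ] E)) := by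
      rw [StarSubalgebra.coe_centralizer, StarMemClass.star_coe_eq, Set.union_self]
    change Set.centralizer (Set.centralizer ((StarSubalgebra.centralizer ℂ
        (StarSubalgebra.centralizer ℂ S : Set (E →L[ℂ] E)) : StarSubalgebra ℂ (E →L[ℂ] E)) :
          Set (E →L[ℂ] E))) = _
    rw [h, Set.centralizer_centralizer_centralizer]
    exact h.symm

/-- The von Neumann algebra generated by a set `𝒯` of closed densely defined operators: it is
generated by the operators `U_T` and `1_S(|T|)`, for `T ∈ 𝒯` with polar decomposition
`T = U_T |T|` and `S` a Borel set. -/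
def generatedByUnbounded (𝒯 : Set (E →ₗ.[ℂ] E)) : VonNeumannAlgebra E :=
  generatedBy {B | ∃ T ∈ 𝒯, ∃ U A, IsPolarDecomposition T U A ∧
    (B = U ∨ ∃ P, IsSpectralResolutionOf P A ∧ ∃ S, MeasurableSet S ∧ B = P.proj S)}

end Unbounded

/-! ### Corners -/

/-- The corner `pMp` of a von Neumann subalgebra `M` of `N`, for a projection `p`. -/
def corner {N : VonNeumannAlgebra H} (M : VonNeumannAlgebra H) (p : N) : Submodule ℂ N where
  carrier := {x | (x : H →L[ℂ] H) ∈ M ∧ p * x = x ∧ x * p = x}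
  add_mem' := by
    rintro x y ⟨hx, hx1, hx2⟩ ⟨hy, hy1, hy2⟩
    exact ⟨add_mem hx hy, by rw [mul_add, hx1, hy1], by rw [add_mul, hx2, hy2]⟩
  zero_mem' := ⟨zero_mem M, mul_zero _, zero_mul _⟩
  smul_mem' := by
    rintro c x ⟨hx, hx1, hx2⟩
    exact ⟨SMulMemClass.smul_mem c hx, by rw [mul_smul_comm, hx1], by rw [smul_mul_assoc, hx2]⟩

theorem mul_mem_corner {N M : VonNeumannAlgebra H} {p x y : N} (hx : x ∈ corner M p)
    (hy : y ∈ corner M p) : x * y ∈ corner M p :=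
  ⟨mul_mem hx.1 hy.1, by rw [← mul_assoc, hx.2.1], by rw [mul_assoc, hy.2.2]⟩

/-! ### Tracial von Neumann algebras and `L²(N, τ)` -/

/-- A faithful normal tracial state on the von Neumann algebra `N`. Normality is continuity for the
ultraweak topology of `B(H)`. -/
structure Trace (N : VonNeumannAlgebra H) where
  toPLM : N →ₚ[ℂ] ℂ
  map_one : toPLM 1 = 1
  mul_comm : ∀ x y : N, toPLM (x * y) = toPLM (y * x)
  faithful : ∀ x : N, toPLM (star x * x) = 0 → x = 0
  normal : ∃ ξ η : ℕ → H, Summable (fun n => ‖ξ n‖ ^ 2) ∧ Summable (fun n => ‖η n‖ ^ 2) ∧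
    ∀ x : N, HasSum (fun n => ⟪ξ n, (x : H →L[ℂ] H) (η n)⟫_ℂ) (toPLM x)

namespace Trace

variable {N : VonNeumannAlgebra H} (τ : Trace N)

/-- The `2`-norm `‖x‖₂ = τ(x⋆x)^{1/2}`. -/
def norm2 (x : N) : ℝ := Real.sqrt (τ.toPLM (star x * x)).re

/-- The Hilbert space `L²(N, τ)`, the completion of `N` for `⟪x, y⟫ = τ(x⋆y)`. -/
abbrev L2 : Type _ := τ.toPLM.GNS

/-- The inclusion `N → L²(N, τ)`, `x ↦ x̂`. -/
def hat : N →ₗ[ℂ] τ.L2 where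
  toFun x := ((τ.toPLM.toPreGNS x : τ.toPLM.PreGNS) : τ.L2)
  map_add' x y := by rw [map_add, UniformSpace.Completion.coe_add]
  map_smul' c x := by rw [map_smul, UniformSpace.Completion.coe_smul]; rfl

theorem norm_hat (x : N) : ‖τ.hat x‖ = τ.norm2 x := by
  simp [hat, norm2, UniformSpace.Completion.norm_coe, PositiveLinearMap.preGNS_norm_def]

theorem hat_injective : Function.Injective τ.hat := by
  rw [← LinearMap.ker_eq_bot, LinearMap.ker_eq_bot']
  intro x hx
  apply τ.faithful
  have h := τ.toPLM.preGNS_norm_sq (τ.toPLM.toPreGNS x)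
  have h0 : ‖τ.toPLM.toPreGNS x‖ = 0 := by
    rw [← UniformSpace.Completion.norm_coe]
    exact norm_eq_zero.mpr hx
  rw [h0] at h
  simpa using h.symm

/-- The left action of `N` on `L²(N, τ)`. -/
def leftMul (a : N) : τ.L2 →L[ℂ] τ.L2 := τ.toPLM.gnsStarAlgHom a

theorem leftMul_hat (a x : N) : τ.leftMul a (τ.hat x) = τ.hat (a * x) := by
  simp [leftMul, hat]

theorem norm2_mul_le (x a : N) : τ.norm2 (x * a) ≤ ‖a‖ * τ.norm2 x := by
  have hstar : ∀ y : N, τ.norm2 (star y) = τ.norm2 y := fun y => by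
    rw [norm2, norm2, star_star, τ.mul_comm]
  rw [← hstar (x * a), ← hstar x, star_mul, ← τ.norm_hat, ← τ.norm_hat, ← τ.leftMul_hat,
    ← norm_star a]
  refine (τ.leftMul (star a)).le_of_opNorm_le ?_ _
  exact NonUnitalStarAlgHom.norm_apply_le (τ.toPLM.gnsStarAlgHom) _

/-- Right multiplication by `a` on the dense subspace `N` of `L²(N, τ)`. -/
def preRightMul (a : N) : τ.toPLM.PreGNS →L[ℂ] τ.toPLM.PreGNS :=
  LinearMap.mkContinuous
    (τ.toPLM.toPreGNS.toLinearMap ∘ₗ LinearMap.mulRight ℂ a ∘ₗ τ.toPLM.ofPreGNS.toLinearMap) ‖a‖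
    (fun x => τ.norm2_mul_le (τ.toPLM.ofPreGNS x) a)

/-- The right action of `N` on `L²(N, τ)`: `rightMul a ξ = ξ a`. -/
def rightMul (a : N) : τ.L2 →L[ℂ] τ.L2 := (τ.preRightMul a).completion

theorem rightMul_hat (a x : N) : τ.rightMul a (τ.hat x) = τ.hat (x * a) := by
  simp [rightMul, hat, preRightMul]

theorem denseRange_hat : DenseRange τ.hat :=
  UniformSpace.Completion.denseRange_coe.comp τ.toPLM.toPreGNS.surjective.denseRange
    (UniformSpace.Completion.continuous_coe _)

theorem rightMul_add (a b : N) : τ.rightMul (a + b) = τ.rightMul a + τ.rightMul b := by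
  refine ContinuousLinearMap.coeFn_injective (τ.denseRange_hat.equalizer
    (τ.rightMul (a + b)).continuous (τ.rightMul a + τ.rightMul b).continuous ?_)
  funext x
  simp [rightMul_hat, mul_add]

theorem rightMul_smul (c : ℂ) (a : N) : τ.rightMul (c • a) = c • τ.rightMul a := by
  refine ContinuousLinearMap.coeFn_injective (τ.denseRange_hat.equalizer
    (τ.rightMul (c • a)).continuous (c • τ.rightMul a).continuous ?_)
  funext x
  simp [rightMul_hat]

/-! ### The `L²`-space of a corner -/

/-- `L²(pMp)`, as the closure of `pMp` in `L²(N, τ)`. -/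
def L2Corner (M : VonNeumannAlgebra H) (p : N) : Submodule ℂ τ.L2 :=
  ((corner M p).map τ.hat).topologicalClosure

instance instCompleteSpaceL2Corner (M : VonNeumannAlgebra H) (p : N) :
    CompleteSpace (τ.L2Corner M p) :=
  (Submodule.isClosed_topologicalClosure _).completeSpace_coe

theorem mapsTo_L2Corner {M : VonNeumannAlgebra H} {p : N} (B : τ.L2 →L[ℂ] τ.L2)
    (hB : ∀ y ∈ corner M p, B (τ.hat y) ∈ τ.L2Corner M p) :
    ∀ ξ ∈ τ.L2Corner M p, B ξ ∈ τ.L2Corner M p := by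
  have hle : τ.L2Corner M p ≤ (τ.L2Corner M p).comap B.toLinearMap := by
    refine Submodule.topologicalClosure_minimal _ ?_
      ((Submodule.isClosed_topologicalClosure _).preimage B.continuous)
    rintro _ ⟨y, hy, rfl⟩
    exact hB y hy
  exact hle

theorem hat_mem_L2Corner {M : VonNeumannAlgebra H} {p x : N} (hx : x ∈ corner M p) :
    τ.hat x ∈ τ.L2Corner M p :=
  Submodule.le_topologicalClosure _ ⟨x, hx, rfl⟩

theorem leftMul_mem_L2Corner {M : VonNeumannAlgebra H} {p x : N} (hx : x ∈ corner M p) :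
    ∀ ξ ∈ τ.L2Corner M p, τ.leftMul x ξ ∈ τ.L2Corner M p :=
  τ.mapsTo_L2Corner _ fun y hy => by
    rw [leftMul_hat]; exact τ.hat_mem_L2Corner (mul_mem_corner hx hy)

theorem rightMul_mem_L2Corner {M : VonNeumannAlgebra H} {p x : N} (hx : x ∈ corner M p) :
    ∀ ξ ∈ τ.L2Corner M p, τ.rightMul x ξ ∈ τ.L2Corner M p :=
  τ.mapsTo_L2Corner _ fun y hy => by
    rw [rightMul_hat]; exact τ.hat_mem_L2Corner (mul_mem_corner hy hx)

/-- The standard representation of `pMp` on `L²(pMp)` by left multiplication. -/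
def leftRep (M : VonNeumannAlgebra H) (p : N) (x : corner M p) :
    τ.L2Corner M p →L[ℂ] τ.L2Corner M p :=
  (τ.leftMul x).restrict (τ.leftMul_mem_L2Corner x.2)

/-- The inclusion `pMp → L²(pMp)`. -/
def cornerHat (M : VonNeumannAlgebra H) (p : N) : corner M p →ₗ[ℂ] τ.L2Corner M p :=
  τ.hat.restrict fun _ hx => τ.hat_mem_L2Corner hx

theorem cornerHat_injective (M : VonNeumannAlgebra H) (p : N) :
    Function.Injective (τ.cornerHat M p) := fun _ _ h =>
  Subtype.ext (τ.hat_injective (congrArg Subtype.val h))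

/-- For `ξ ∈ L²(pMp)`, the map `pMp → L²(pMp)`, `x ↦ ξ x`. -/
def actOn {M : VonNeumannAlgebra H} {p : N} (ξ : τ.L2Corner M p) :
    corner M p →ₗ[ℂ] τ.L2Corner M p where
  toFun x := ⟨τ.rightMul x ξ, τ.rightMul_mem_L2Corner x.2 ξ ξ.2⟩
  map_add' x y := Subtype.ext (by simp [rightMul_add])
  map_smul' c x := Subtype.ext (by simp [rightMul_smul])

/-- For `ξ ∈ L²(pMp)`, the operator `T_ξ` on `L²(pMp)` with domain `pMp`, `T_ξ x = ξ x`. -/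
def preLeftOp {M : VonNeumannAlgebra H} {p : N} (ξ : τ.L2Corner M p) :
    τ.L2Corner M p →ₗ.[ℂ] τ.L2Corner M p where
  domain := LinearMap.range (τ.cornerHat M p)
  toFun := τ.actOn ξ ∘ₗ
    (LinearEquiv.ofInjective (τ.cornerHat M p) (τ.cornerHat_injective M p)).symm.toLinearMap

theorem preLeftOp_apply {M : VonNeumannAlgebra H} {p : N} (ξ : τ.L2Corner M p)
    (x : corner M p) :
    (τ.preLeftOp ξ ⟨τ.cornerHat M p x, LinearMap.mem_range_self _ x⟩ : τ.L2) =
      τ.rightMul x ξ := by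
  have h : (LinearEquiv.ofInjective (τ.cornerHat M p) (τ.cornerHat_injective M p)).symm
      ⟨τ.cornerHat M p x, LinearMap.mem_range_self _ x⟩ = x := by
    rw [LinearEquiv.symm_apply_eq]; rfl
  change ((τ.actOn ξ _ : τ.L2Corner M p) : τ.L2) = _
  erw [h]
  rfl

/-- The closed operator `L_ξ` on `L²(pMp)`: the closure of `T_ξ`. -/
def leftOp {M : VonNeumannAlgebra H} {p : N} (ξ : τ.L2Corner M p) :
    τ.L2Corner M p →ₗ.[ℂ] τ.L2Corner M p :=
  (τ.preLeftOp ξ).closure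

/-! ### Singular vectors -/

/-- The `Q`-`Q` bimodularity of a bounded map between subspaces of `L²(N, τ)` that are invariant
under the left and right actions of `Q`: `T (a ξ b) = a (T ξ) b` for all `a, b ∈ Q`. -/
def IsBimodular (Q : Set N) {K L : Submodule ℂ τ.L2} (T : K →L[ℂ] L) : Prop :=
  ∀ a ∈ Q, ∀ b ∈ Q, ∀ ξ ξ' : K, (ξ' : τ.L2) = τ.leftMul a (τ.rightMul b ξ) →
    (T ξ' : τ.L2) = τ.leftMul a (τ.rightMul b (T ξ))

/-- The `L`-singular vectors of `K`: those killed by every bounded `Q`-`Q` bimodular `K → L`. -/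
def singularVectors (Q : Set N) (K L : Submodule ℂ τ.L2) : Set K :=
  {ξ | ∀ T : K →L[ℂ] L, τ.IsBimodular Q T → T ξ = 0}

/-- `L²(pNp) ⊖ L²(pMp)`. -/
def L2Ortho (M : VonNeumannAlgebra H) (p : N) : Submodule ℂ τ.L2 :=
  τ.L2Corner N p ⊓ (τ.L2Corner M p)ᗮ

/-- `W*(X)` for `X ⊆ L²(pMp)`: the von Neumann algebra on `L²(pMp)` generated by the closed
operators `L_ξ`, `ξ ∈ X`. -/
def affiliatedWStar {M : VonNeumannAlgebra H} {p : N} (X : Set (τ.L2Corner M p)) :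
    VonNeumannAlgebra (τ.L2Corner M p) :=
  generatedByUnbounded (τ.leftOp '' X)

/-- `W*(X)` for `X ⊆ L²(pMp)`, as a subset of `pMp` by means of the standard representation. -/
def WStar {M : VonNeumannAlgebra H} {p : N} (X : Set (τ.L2Corner M p)) : Set N :=
  {x | ∃ hx : x ∈ corner M p, τ.leftRep M p ⟨x, hx⟩ ∈ τ.affiliatedWStar X}

end Trace

/-- `Q ≤ pMp`: the ⋆-subalgebra `Q` of `N` is a von Neumann subalgebra of `pMp` with unit `p`. -/
structure IsCornerSubalgebra {N : VonNeumannAlgebra H} (M : VonNeumannAlgebra H) (p : N)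
    (Q : NonUnitalStarSubalgebra ℂ N) : Prop where
  le_corner : ∀ x ∈ Q, x ∈ corner M p
  unit_mem : p ∈ Q
  bicommutant : ∀ x ∈ corner N p,
    (x : H →L[ℂ] H) ∈ Set.centralizer (Set.centralizer (Subtype.val '' (Q : Set N))) → x ∈ Q

/-! ### s-malleable deformations and rigidity -/

/-- An s-malleable deformation `(α, β)` of `M` inside `(N, τ)`. -/
structure SMalleableDeformation {N : VonNeumannAlgebra H} (τ : Trace N)
    (M : VonNeumannAlgebra H) where
  α : ℝ → N ≃⋆ₐ[ℂ] N
  β : N ≃⋆ₐ[ℂ] N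
  α_add : ∀ s t x, α (s + t) x = α s (α t x)
  α_trace : ∀ t x, τ.toPLM (α t x) = τ.toPLM x
  α_continuous : ∀ x, Filter.Tendsto (fun t => τ.norm2 (α t x - x)) (𝓝 0) (𝓝 0)
  β_trace : ∀ x, τ.toPLM (β x) = τ.toPLM x
  β_eq_self : ∀ x : N, (x : H →L[ℂ] H) ∈ M → β x = x
  β_β : ∀ x, β (β x) = x
  β_α : ∀ t x, β (α t x) = α (-t) (β x)

namespace SMalleableDeformation

variable {N M : VonNeumannAlgebra H} {τ : Trace N} (D : SMalleableDeformation τ M)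

/-- `ε_t(Q) = sup {‖α_t(x) - x‖₂ : x ∈ Q, ‖x‖ ≤ 1}`. -/
def ε (t : ℝ) (Q : Set N) : ℝ≥0∞ :=
  ⨆ x ∈ {x ∈ Q | ‖x‖ ≤ 1}, ENNReal.ofReal (τ.norm2 (D.α t x - x))

/-- `α`-rigidity: `ε_t(Q) → 0` as `t → 0`. -/
def IsRigid (Q : Set N) : Prop := Filter.Tendsto (fun t => D.ε t Q) (𝓝 0) (𝓝 0)

end SMalleableDeformation

end VonNeumannAlgebra
end

/-! ### Bimodule actions, conjugation and automorphisms on L²(N, τ) -/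

noncomputable section

namespace VonNeumannAlgebra

variable {H : Type*} [NormedAddCommGroup H] [InnerProductSpace ℂ H] [CompleteSpace H]

namespace Trace

variable {N M : VonNeumannAlgebra H} (τ : Trace N)

/-! Write N for the ambient algebra M̃, ε for ε_t(Q), and Q′ for the relative commutant of Q in pNp.
Singular vectors do not see the difference between M and N: a bounded Q-Q bimodular map L²(pMp) →
L²(pNp) sends them to singular vectors, which lie in L²(pMp) again (`map_mem_singularSubspace`).
Hence cξc′ is singular for c, c′ ∈ Q′, although c need not be in M, and so is x⋆α_s(ξ)y when x and y
intertwine Q with α_s(Q).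

Averaging α_s(u)u⋆ over the unitaries u of Q gives an intertwiner within ε_s(Q) of p
(`IsCornerSubalgebra.exists_isIntertwiner`). Functional calculus turns it into an intertwiner v and
a cutoff h ∈ Q′ near p such that vv⋆ acts as a unit on α_s(ζ) for every ζ = hξh with ξ singular. Now
v⋆α_s(ζ)v lies in L²(pMp), so β fixes it, while βα_s(ζ) = α_{-s}(ζ). Therefore vβ(v)⋆ carries
α_{-s}(ζ) to α_s(ζ), and applying α_s implements α_{2s} on ζ (`exists_transports_double`). Such
implementations compose with h unchanged, so errors do not accumulate: n + 1 steps of length t/(n +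
1) give W_n implementing α_t on h_n ξ h_n, and h_n → p by rigidity (`exists_transports`).

For self-adjoint ξ the element F = ξ(ξ + i)⁻¹ ∈ pMp is a bounded 2-norm limit of elements F_n with
α_t(F_n) = W_n F_n W_n⋆ and cF_nc′ ∈ pMp for all c, c′ ∈ Q′. These properties pass to products and
adjoints. If x is an intertwiner for α_t near p, then x⋆α_t(F_n)x = (x⋆W_n)F_n(W_n⋆x) is in pMp. The
uncontrolled W_n disappear in the limit, so x⋆α_t(y)x ∈ L²(pMp) for all y in the closed span V of
the resulting algebra. Moreover W*(H_s) ⊆ V + ℂp (`exists_sub_smul_mem`). Since x⋆α_t(y)x is β-fixed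
and close to α_t(y), the latter is close to α_{-t}(y). This costs 16ε for ‖y‖ ≤ 2, and the multiple
of p costs 2ε, so 18ε in total.

For the inclusion in pMp, a bounded self-adjoint operator commuting with L_ξ commutes with its polar
part and spectral projections (`commute_of_mem_generatedByUnbounded`). Right multiplications by
self-adjoint elements are such operators, and whatever commutes with the right action of pMp is a
left multiplication (`exists_leftMul_eq`). The same principle, applied to the projection onto a
subspace invariant under resolvents, shows that W*(H_s) preserves that subspace. -/

theorem inner_hat (x y : N) : ⟪τ.hat x, τ.hat y⟫_ℂ = τ.toPLM (star x * y) := by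
  simp [hat, UniformSpace.Completion.inner_coe, PositiveLinearMap.preGNS_inner_def]

@[elab_as_elim]
theorem hat_induction {P : τ.L2 → Prop} (hP : IsClosed {ξ | P ξ}) (h : ∀ x, P (τ.hat x)) (ξ : τ.L2) :
    P ξ :=
  τ.denseRange_hat.induction_on ξ hP h

@[simp] theorem leftMul_leftMul (a b : N) (ξ : τ.L2) :
    τ.leftMul a (τ.leftMul b ξ) = τ.leftMul (a * b) ξ := by
  simp [leftMul]

theorem leftMul_sub (a b : N) (ξ : τ.L2) : τ.leftMul (a - b) ξ = τ.leftMul a ξ - τ.leftMul b ξ := by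
  simp [leftMul]

theorem leftMul_smul (c : ℂ) (a : N) (ξ : τ.L2) : τ.leftMul (c • a) ξ = c • τ.leftMul a ξ := by
  simp [leftMul]

theorem norm_leftMul_le (a : N) (ξ : τ.L2) : ‖τ.leftMul a ξ‖ ≤ ‖a‖ * ‖ξ‖ :=
  (τ.leftMul a).le_of_opNorm_le (NonUnitalStarAlgHom.norm_apply_le (τ.toPLM.gnsStarAlgHom) _) _

theorem norm_rightMul_le (a : N) (ξ : τ.L2) : ‖τ.rightMul a ξ‖ ≤ ‖a‖ * ‖ξ‖ := by
  refine τ.hat_induction (P := fun ξ => ‖τ.rightMul a ξ‖ ≤ ‖a‖ * ‖ξ‖)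
    (isClosed_le (by fun_prop) (by fun_prop)) (fun x => ?_) ξ
  rw [rightMul_hat, norm_hat, norm_hat]
  exact τ.norm2_mul_le x a

@[simp] theorem rightMul_rightMul (a b : N) (ξ : τ.L2) :
    τ.rightMul a (τ.rightMul b ξ) = τ.rightMul (b * a) ξ := by
  refine τ.hat_induction (isClosed_eq (by fun_prop) (by fun_prop)) (fun x => ?_) ξ
  simp [rightMul_hat, mul_assoc]

theorem rightMul_add_apply (a b : N) (ξ : τ.L2) :
    τ.rightMul (a + b) ξ = τ.rightMul a ξ + τ.rightMul b ξ := by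
  rw [rightMul_add]; rfl

theorem rightMul_smul_apply (c : ℂ) (a : N) (ξ : τ.L2) :
    τ.rightMul (c • a) ξ = c • τ.rightMul a ξ := by
  rw [rightMul_smul]; rfl

theorem rightMul_sub_apply (a b : N) (ξ : τ.L2) :
    τ.rightMul (a - b) ξ = τ.rightMul a ξ - τ.rightMul b ξ := by
  rw [sub_eq_add_neg, ← neg_one_smul ℂ b, rightMul_add_apply, rightMul_smul_apply, neg_one_smul,
    sub_eq_add_neg]

/-- The left and right actions commute; simp moves the left action outside. -/
@[simp] theorem rightMul_leftMul (a b : N) (ξ : τ.L2) :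
    τ.rightMul a (τ.leftMul b ξ) = τ.leftMul b (τ.rightMul a ξ) := by
  refine τ.hat_induction (isClosed_eq (by fun_prop) (by fun_prop)) (fun x => ?_) ξ
  simp [rightMul_hat, leftMul_hat, mul_assoc]

theorem inner_leftMul_left (a : N) (ξ η : τ.L2) :
    ⟪τ.leftMul a ξ, η⟫_ℂ = ⟪ξ, τ.leftMul (star a) η⟫_ℂ := by
  rw [leftMul, leftMul, map_star, ContinuousLinearMap.star_eq_adjoint,
    ContinuousLinearMap.adjoint_inner_right]

theorem inner_rightMul_left (a : N) (ξ η : τ.L2) :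
    ⟪τ.rightMul a ξ, η⟫_ℂ = ⟪ξ, τ.rightMul (star a) η⟫_ℂ := by
  refine τ.hat_induction (isClosed_eq (by fun_prop) (by fun_prop)) (fun y => ?_) η
  refine τ.hat_induction (isClosed_eq (by fun_prop) (by fun_prop)) (fun x => ?_) ξ
  simp only [rightMul_hat, inner_hat, star_mul]
  rw [mul_assoc, τ.mul_comm, mul_assoc]

theorem norm2_star (x : N) : τ.norm2 (star x) = τ.norm2 x := by
  rw [norm2, norm2, star_star, τ.mul_comm]

/-! #### The conjugation -/

/-- `x ↦ hat x⋆` as a conjugate-linear map. -/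
def hatStar : N →ₛₗ[starRingEnd ℂ] τ.L2 where
  toFun x := τ.hat (star x)
  map_add' x y := by simp
  map_smul' c x := by simp

/-- The conjugation `J` of `L²(N, τ)`, `J x̂ = (x⋆)^`. -/
def conj : τ.L2 →SL[starRingEnd ℂ] τ.L2 := τ.hatStar.extendOfNorm τ.hat

@[simp] theorem conj_hat (x : N) : τ.conj (τ.hat x) = τ.hat (star x) :=
  LinearMap.extendOfNorm_eq τ.denseRange_hat
    ⟨1, fun x => by simp [hatStar, norm_hat, norm2_star]⟩ x

@[simp] theorem conj_conj (ξ : τ.L2) : τ.conj (τ.conj ξ) = ξ := by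
  refine τ.hat_induction (isClosed_eq (by fun_prop) (by fun_prop)) (fun x => ?_) ξ
  simp

@[simp] theorem conj_leftMul (a : N) (ξ : τ.L2) :
    τ.conj (τ.leftMul a ξ) = τ.rightMul (star a) (τ.conj ξ) := by
  refine τ.hat_induction (isClosed_eq (by fun_prop) (by fun_prop)) (fun x => ?_) ξ
  simp [leftMul_hat, rightMul_hat]

@[simp] theorem conj_rightMul (a : N) (ξ : τ.L2) :
    τ.conj (τ.rightMul a ξ) = τ.leftMul (star a) (τ.conj ξ) := by
  refine τ.hat_induction (isClosed_eq (by fun_prop) (by fun_prop)) (fun x => ?_) ξ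
  simp [leftMul_hat, rightMul_hat]

theorem inner_conj_conj (ξ η : τ.L2) : ⟪τ.conj ξ, τ.conj η⟫_ℂ = ⟪η, ξ⟫_ℂ := by
  refine τ.hat_induction (isClosed_eq (by fun_prop) (by fun_prop)) (fun y => ?_) η
  refine τ.hat_induction (isClosed_eq (by fun_prop) (by fun_prop)) (fun x => ?_) ξ
  simp only [conj_hat, inner_hat, star_star]
  exact τ.mul_comm _ _

/-- The formal adjoint of `x ↦ ξ x` is `x ↦ (J ξ) x`. -/
theorem inner_rightMul_hat (ξ : τ.L2) (a b : N) :
    ⟪τ.rightMul a ξ, τ.hat b⟫_ℂ = ⟪τ.hat a, τ.rightMul b (τ.conj ξ)⟫_ℂ := by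
  refine τ.hat_induction (isClosed_eq (by fun_prop) (by fun_prop)) (fun x => ?_) ξ
  simp [rightMul_hat, inner_hat, mul_assoc]

/-! #### Trace-preserving automorphisms -/

section Aut

variable {φ : N ≃⋆ₐ[ℂ] N}

theorem norm2_map (hφ : ∀ x, τ.toPLM (φ x) = τ.toPLM x) (x : N) : τ.norm2 (φ x) = τ.norm2 x := by
  rw [norm2, norm2, ← map_star, ← map_mul, hφ]

/-- The operator on `L²(N, τ)` induced by a trace-preserving automorphism. -/
def autL2 (φ : N ≃⋆ₐ[ℂ] N) : τ.L2 →L[ℂ] τ.L2 :=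
  (τ.hat ∘ₗ (φ.toStarAlgHom : N →⋆ₐ[ℂ] N).toAlgHom.toLinearMap).extendOfNorm τ.hat

theorem autL2_hat (hφ : ∀ x, τ.toPLM (φ x) = τ.toPLM x) (x : N) : τ.autL2 φ (τ.hat x) = τ.hat (φ x) :=
  LinearMap.extendOfNorm_eq τ.denseRange_hat
    ⟨1, fun x => by simp [norm_hat, norm2_map τ hφ]⟩ x

theorem autL2_leftMul (hφ : ∀ x, τ.toPLM (φ x) = τ.toPLM x) (a : N) (ξ : τ.L2) :
    τ.autL2 φ (τ.leftMul a ξ) = τ.leftMul (φ a) (τ.autL2 φ ξ) := by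
  refine τ.hat_induction (isClosed_eq (by fun_prop) (by fun_prop)) (fun x => ?_) ξ
  simp [leftMul_hat, autL2_hat τ hφ]

theorem autL2_rightMul (hφ : ∀ x, τ.toPLM (φ x) = τ.toPLM x) (a : N) (ξ : τ.L2) :
    τ.autL2 φ (τ.rightMul a ξ) = τ.rightMul (φ a) (τ.autL2 φ ξ) := by
  refine τ.hat_induction (isClosed_eq (by fun_prop) (by fun_prop)) (fun x => ?_) ξ
  simp [rightMul_hat, autL2_hat τ hφ]

end Aut

/-! #### Strong convergence from `2`-norm convergence on bounded sets -/

/-- On a vector x̂ the action b x̂ is the right multiple of b̂ by x, which is continuous in b̂. The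
uniform norm bound then carries the convergence to all ξ by density. -/
theorem tendsto_leftMul {ι : Type*} {l : Filter ι} {b : ι → N} {b₀ : N} {C : ℝ}
    (hC : ∀ i, ‖b i‖ ≤ C) (hb : Filter.Tendsto (fun i => τ.hat (b i)) l (𝓝 (τ.hat b₀))) (ξ : τ.L2) :
    Filter.Tendsto (fun i => τ.leftMul (b i) ξ) l (𝓝 (τ.leftMul b₀ ξ)) := by
  rw [Metric.tendsto_nhds]
  intro ε hε
  set K := |C| + ‖b₀‖ + 1 with hK
  have hK0 : 0 < K := by positivity
  obtain ⟨x, hx⟩ := Metric.denseRange_iff.1 τ.denseRange_hat ξ (ε / (2 * K)) (by positivity)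
  have h1 : Filter.Tendsto (fun i => τ.leftMul (b i) (τ.hat x)) l (𝓝 (τ.leftMul b₀ (τ.hat x))) := by
    have := ((τ.rightMul x).continuous.tendsto _).comp hb
    simpa [Function.comp_def, rightMul_hat, leftMul_hat] using this
  filter_upwards [Metric.tendsto_nhds.1 h1 (ε / 2) (by positivity)] with i hi
  rw [dist_eq_norm] at hi hx ⊢
  have : τ.leftMul (b i) ξ - τ.leftMul b₀ ξ = τ.leftMul (b i - b₀) (ξ - τ.hat x) +
      (τ.leftMul (b i) (τ.hat x) - τ.leftMul b₀ (τ.hat x)) := by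
    simp only [leftMul_sub, map_sub]; abel
  rw [this]
  have h2 : ‖τ.leftMul (b i - b₀) (ξ - τ.hat x)‖ ≤ K * (ε / (2 * K)) := by
    refine (τ.norm_leftMul_le _ _).trans (mul_le_mul ?_ hx.le (norm_nonneg _) hK0.le)
    refine (norm_sub_le _ _).trans ?_
    have := (hC i).trans (le_abs_self C)
    rw [hK]; linarith
  have h3 : K * (ε / (2 * K)) = ε / 2 := by field_simp
  rw [h3] at h2
  exact (norm_add_le _ _).trans_lt (by linarith)

theorem tendsto_rightMul {ι : Type*} {l : Filter ι} {b : ι → N} {b₀ : N} {C : ℝ}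
    (hC : ∀ i, ‖b i‖ ≤ C) (hb : Filter.Tendsto (fun i => τ.hat (b i)) l (𝓝 (τ.hat b₀))) (ξ : τ.L2) :
    Filter.Tendsto (fun i => τ.rightMul (b i) ξ) l (𝓝 (τ.rightMul b₀ ξ)) := by
  have h1 : Filter.Tendsto (fun i => τ.hat (star (b i))) l (𝓝 (τ.hat (star b₀))) := by
    simpa [Function.comp_def] using (τ.conj.continuous.tendsto _).comp hb
  have h2 := τ.tendsto_leftMul (C := C) (fun i => by rw [norm_star]; exact hC i) h1 (τ.conj ξ)
  simpa [Function.comp_def] using (τ.conj.continuous.tendsto _).comp h2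

end Trace

end VonNeumannAlgebra

end

/-! ### Weak limits and closedness of balls in the 2-norm -/

noncomputable section

namespace VonNeumannAlgebra

variable {H : Type*} [NormedAddCommGroup H] [InnerProductSpace ℂ H] [CompleteSpace H]

/-- Bounded sequences of operators have weak operator limits along ultrafilters. -/
theorem exists_weak_limit (U : Ultrafilter ℕ) {r : ℝ} (x : ℕ → H →L[ℂ] H) (hx : ∀ n, ‖x n‖ ≤ r) :
    ∃ y : H →L[ℂ] H, ‖y‖ ≤ r ∧ ∀ h k, Filter.Tendsto (fun n => ⟪h, x n k⟫_ℂ) U (𝓝 ⟪h, y k⟫_ℂ) := by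
  have hr : 0 ≤ r := (norm_nonneg _).trans (hx 0)
  have hb : ∀ n h k, ‖⟪h, x n k⟫_ℂ‖ ≤ r * ‖h‖ * ‖k‖ := fun n h k => by
    refine (norm_inner_le_norm _ _).trans ?_
    have := (x n).le_of_opNorm_le (hx n) k
    calc ‖h‖ * ‖x n k‖ ≤ ‖h‖ * (r * ‖k‖) := by gcongr
      _ = _ := by ring
  have hex : ∀ h k, ∃ z : ℂ, ‖z‖ ≤ r * ‖h‖ * ‖k‖ ∧
      Filter.Tendsto (fun n => ⟪h, x n k⟫_ℂ) U (𝓝 z) := fun h k => by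
    obtain ⟨z, hz, hz'⟩ := (isCompact_closedBall (0 : ℂ) (r * ‖h‖ * ‖k‖)).ultrafilter_le_nhds
      (U.map fun n => ⟪h, x n k⟫_ℂ) (by
        rw [Filter.le_principal_iff]
        exact Filter.mem_map.2 (Filter.Eventually.of_forall fun n => by simpa using hb n h k))
    exact ⟨z, by simpa using hz, hz'⟩
  choose f hf1 hf using hex
  let B : H →ₛₗ[starRingEnd ℂ] H →ₗ[ℂ] ℂ := LinearMap.mk₂'ₛₗ (starRingEnd ℂ) (RingHom.id ℂ) f
    (fun h h' k => tendsto_nhds_unique (hf _ _) (by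
      simpa only [inner_add_left] using (hf h k).add (hf h' k)))
    (fun c h k => tendsto_nhds_unique (hf _ _) (by
      simpa only [inner_smul_left, smul_eq_mul] using (hf h k).const_mul _))
    (fun h k k' => tendsto_nhds_unique (hf _ _) (by
      simpa only [map_add, inner_add_right] using (hf h k).add (hf h k')))
    (fun c h k => tendsto_nhds_unique (hf _ _) (by
      simpa only [map_smul, inner_smul_right, smul_eq_mul, RingHom.id_apply] using (hf h k).const_mul _))
  let y' := InnerProductSpace.continuousLinearMapOfBilin (B.mkContinuous₂ r hf1)
  have hy : ∀ h k, ⟪h, ContinuousLinearMap.adjoint y' k⟫_ℂ = f h k := fun h k => by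
    rw [ContinuousLinearMap.adjoint_inner_right]
    exact InnerProductSpace.continuousLinearMapOfBilin_apply _ _ _
  refine ⟨ContinuousLinearMap.adjoint y', ContinuousLinearMap.opNorm_le_bound _ hr fun k => ?_,
    fun h k => by rw [hy]; exact hf h k⟩
  -- Taking the first vector to be the image of k itself turns the bound on the form into ‖y k‖² ≤ r
  -- ‖y k‖ ‖k‖.
  have h1 := hf1 (ContinuousLinearMap.adjoint y' k) k
  rw [← hy, inner_self_eq_norm_sq_to_K] at h1
  simp only [norm_pow, Complex.coe_algebraMap, Complex.norm_real, norm_norm] at h1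
  by_cases h0 : ‖ContinuousLinearMap.adjoint y' k‖ = 0
  · rw [h0]; positivity
  · have : 0 < ‖ContinuousLinearMap.adjoint y' k‖ := lt_of_le_of_ne (norm_nonneg _) (Ne.symm h0)
    nlinarith

/-- By the bicommutant theorem, membership means commuting with every z in the commutant, and
multiplication by z on either side is weakly continuous. -/
theorem mem_of_weak_limit (M : VonNeumannAlgebra H) {U : Ultrafilter ℕ} {x : ℕ → H →L[ℂ] H}
    {y : H →L[ℂ] H} (hx : ∀ n, x n ∈ M)
    (h : ∀ h k, Filter.Tendsto (fun n => ⟪h, x n k⟫_ℂ) U (𝓝 ⟪h, y k⟫_ℂ)) : y ∈ M := by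
  rw [← SetLike.mem_coe, ← M.centralizer_centralizer, Set.mem_centralizer_iff]
  intro z hz
  rw [Set.mem_centralizer_iff] at hz
  ext k
  refine ext_inner_left ℂ fun v => ?_
  have h1 := h (ContinuousLinearMap.adjoint z v) k
  have h2 := h v (z k)
  refine tendsto_nhds_unique (f := fun n => ⟪v, (z * x n) k⟫_ℂ) (l := U) ?_ ?_
  · simpa [ContinuousLinearMap.adjoint_inner_left] using h1
  · simpa [fun n => (hz _ (hx n)).symm] using h2

namespace Trace

variable {N M : VonNeumannAlgebra H} (τ : Trace N)

/-- Normality writes τ as an absolutely convergent series of vector functionals, so boundedness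
allows passing to the limit termwise by domination. -/
theorem tendsto_toPLM_of_weak_limit {U : Ultrafilter ℕ} {r : ℝ} {x : ℕ → N} {y : N}
    (hx : ∀ n, ‖x n‖ ≤ r)
    (h : ∀ h k, Filter.Tendsto (fun n => ⟪h, (x n : H →L[ℂ] H) k⟫_ℂ) U
      (𝓝 ⟪h, (y : H →L[ℂ] H) k⟫_ℂ)) :
    Filter.Tendsto (fun n => τ.toPLM (x n)) U (𝓝 (τ.toPLM y)) := by
  obtain ⟨ξ, η, hξ, hη, hτ⟩ := τ.normal
  have hs : Summable fun i => r * (‖ξ i‖ ^ 2 + ‖η i‖ ^ 2) := (hξ.add hη).mul_left r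
  have := tendsto_tsum_of_dominated_convergence (𝓕 := (U : Filter ℕ)) hs (fun i => h (ξ i) (η i))
    (Filter.Eventually.of_forall fun n i => by
      have hr : 0 ≤ r := (norm_nonneg _).trans (hx 0)
      refine (norm_inner_le_norm _ _).trans ?_
      have := (x n : H →L[ℂ] H).le_of_opNorm_le (hx n) (η i)
      calc ‖ξ i‖ * ‖(x n : H →L[ℂ] H) (η i)‖ ≤ ‖ξ i‖ * (r * ‖η i‖) := by gcongr
        _ ≤ _ := by nlinarith [sq_nonneg (‖ξ i‖ - ‖η i‖), sq_nonneg (‖ξ i‖), sq_nonneg ‖η i‖,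
            mul_nonneg (norm_nonneg (ξ i)) (norm_nonneg (η i)),
            mul_nonneg hr (sq_nonneg (‖ξ i‖ - ‖η i‖)), mul_nonneg hr (mul_nonneg (norm_nonneg (ξ i)) (norm_nonneg (η i)))])
  simpa only [(hτ _).tsum_eq] using this

/-- The image in `L²(N, τ)` of the ball of radius `r` of the corner `pMp` is closed. -/
theorem isClosed_hat_ball (p : N) (r : ℝ) :
    IsClosed {ξ : τ.L2 | ∃ x ∈ corner M p, ‖x‖ ≤ r ∧ τ.hat x = ξ} := by
  refine isClosed_of_closure_subset fun ξ hξ => ?_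
  obtain ⟨u, hu, hu'⟩ := mem_closure_iff_seq_limit.1 hξ
  choose x hx hxr hxu using hu
  let U : Ultrafilter ℕ := Filter.hyperfilter ℕ
  have hU : (U : Filter ℕ) ≤ Filter.atTop := Nat.hyperfilter_le_atTop
  obtain ⟨y, hy, hlim⟩ := exists_weak_limit U (fun n => (x n : H →L[ℂ] H)) hxr
  have hyN : y ∈ N := N.mem_of_weak_limit (fun n => (x n).2) hlim
  have hyM : y ∈ M := M.mem_of_weak_limit (fun n => (hx n).1) hlim
  -- Weak limits are compatible with fixed factors on both sides. This gives the corner relations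
  -- for y and, with τ, the inner products that identify ŷ with ξ.
  have hmul : ∀ a b : N, ∀ h k, Filter.Tendsto
      (fun n => ⟪h, ((a * x n * b : N) : H →L[ℂ] H) k⟫_ℂ) U
      (𝓝 ⟪h, ((a * ⟨y, hyN⟩ * b : N) : H →L[ℂ] H) k⟫_ℂ) := fun a b h k => by
    simpa [ContinuousLinearMap.adjoint_inner_left] using
      hlim (ContinuousLinearMap.adjoint (a : H →L[ℂ] H) h) ((b : H →L[ℂ] H) k)
  have huniq : ∀ a b : N, (∀ n, a * x n * b = x n) → a * ⟨y, hyN⟩ * b = (⟨y, hyN⟩ : N) := by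
    intro a b hab
    apply Subtype.ext
    ext k
    refine ext_inner_left ℂ fun v => tendsto_nhds_unique (hmul a b v k) ?_
    simpa only [hab] using hlim v k
  refine ⟨⟨y, hyN⟩, ⟨hyM, ?_, ?_⟩, hy, ?_⟩
  · simpa using huniq p 1 fun n => by simp [(hx n).2.1]
  · simpa using huniq 1 p fun n => by simp [(hx n).2.2]
  · refine τ.denseRange_hat.eq_of_inner_right (𝕜 := ℂ) fun z => ?_
    have h1 := (hmul (star z) 1)
    have h2 := τ.tendsto_toPLM_of_weak_limit (r := ‖star z‖ * r) (fun n => by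
      rw [mul_one]
      refine (norm_mul_le _ _).trans ?_
      gcongr
      exact hxr n) h1
    rw [mul_one, ← inner_hat] at h2
    refine tendsto_nhds_unique h2 ?_
    have h3 : Filter.Tendsto (fun n => ⟪τ.hat z, u n⟫_ℂ) U (𝓝 ⟪τ.hat z, ξ⟫_ℂ) :=
      ((continuous_const.inner continuous_id).tendsto ξ).comp (hu'.mono_left hU)
    refine h3.congr fun n => ?_
    rw [← hxu n, inner_hat, mul_one]

end Trace

end VonNeumannAlgebra

end

/-! ### Operators commuting with the right action of a corner -/

noncomputable section

namespace VonNeumannAlgebra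

variable {H : Type*} [NormedAddCommGroup H] [InnerProductSpace ℂ H] [CompleteSpace H]

/-- The inclusion of von Neumann algebras as a star homomorphism. -/
def inclusion {M N : VonNeumannAlgebra H} (hMN : M ≤ N) : M →⋆ₐ[ℂ] N where
  toFun x := ⟨x, hMN x.2⟩
  map_one' := rfl
  map_mul' _ _ := rfl
  map_zero' := rfl
  map_add' _ _ := rfl
  commutes' _ := rfl
  map_star' _ := rfl

theorem cfc_mem {M N : VonNeumannAlgebra H} (hMN : M ≤ N) {x : N} (hx : (x : H →L[ℂ] H) ∈ M)
    (hsa : IsSelfAdjoint x) (f : ℝ → ℝ) (hf : Continuous f) : ((cfc f x : N) : H →L[ℂ] H) ∈ M := by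
  have hsa' : IsSelfAdjoint (⟨x, hx⟩ : M) := Subtype.ext (congrArg (fun y : N => (y : H →L[ℂ] H)) hsa.star_eq)
  have hcont : Continuous (inclusion hMN) :=
    continuous_subtype_val.subtype_mk _
  have h := StarAlgHomClass.map_cfc (S := ℂ) (inclusion hMN) f (⟨x, hx⟩ : M) hf.continuousOn hcont
    hsa' hsa
  have h2 : (inclusion hMN) ⟨x, hx⟩ = x := rfl
  rw [h2] at h
  rw [← h]
  exact (cfc f (⟨x, hx⟩ : M)).2

theorem star_mem_corner {M N : VonNeumannAlgebra H} {p : N} (hp : IsStarProjection p) {x : N}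
    (hx : x ∈ corner M p) : star x ∈ corner M p :=
  ⟨star_mem hx.1, by rw [← star_inj, star_mul, star_star, hp.isSelfAdjoint.star_eq, hx.2.2],
    by rw [← star_inj, star_mul, star_star, hp.isSelfAdjoint.star_eq, hx.2.1]⟩

theorem self_mem_corner {M N : VonNeumannAlgebra H} {p : N} (hp : IsStarProjection p)
    (hpM : (p : H →L[ℂ] H) ∈ M) : p ∈ corner M p :=
  ⟨hpM, hp.isIdempotentElem.eq, hp.isIdempotentElem.eq⟩

theorem corner_mono {M N : VonNeumannAlgebra H} {p x : N} (hx : x ∈ corner M p) :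
    x ∈ corner N p := ⟨x.2, hx.2⟩

/-- An approximate polar decomposition `a = (a n) m` in a von Neumann subalgebra. -/
theorem exists_approx_polar {M N : VonNeumannAlgebra H} (hMN : M ≤ N) {p : N}
    (hp : IsStarProjection p) {a : N} (ha : a ∈ corner M p) {d : ℝ} (hd : 0 < d) :
    ∃ n m : N, (n : H →L[ℂ] H) ∈ M ∧ (m : H →L[ℂ] H) ∈ M ∧ star n = n ∧ star m = m ∧ n * m = 1 ∧
      p * n = n * p ∧ p * m = m * p ∧ ‖a * n * n‖ ≤ 1 ∧ ‖m * m - n * (star a * a) * n‖ ≤ d := by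
  set c : N := star a * a with hc
  have hcsa : IsSelfAdjoint c := IsSelfAdjoint.star_mul_self a
  have hcM : (c : H →L[ℂ] H) ∈ M := mul_mem (star_mem ha.1) ha.1
  have hpc : Commute c p := by
    have h1 : c * p = c := by rw [hc, mul_assoc, ha.2.2]
    have h2 : p * c = c := by
      rw [hc, ← mul_assoc, (star_mem_corner hp ha).2.1]
    exact h1.trans h2.symm
  -- With c = a⋆a, m is (c + d²)^{1/4} and n is its inverse. Thus a n n = a(c + d²)^{-1/2}
  -- approximates the polar part of a, and m² − n c n = d²(c + d²)^{-1/2} has norm at most d. The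
  -- absolute value only makes the functions continuous on all of ℝ.
  let fm : ℝ → ℝ := fun s => √√(|s| + d ^ 2)
  let fn : ℝ → ℝ := fun s => (√√(|s| + d ^ 2))⁻¹
  have hpos : ∀ s, 0 < √√(|s| + d ^ 2) := fun s => by positivity
  have hfm : Continuous fm := by fun_prop
  have hfn : Continuous fn := hfm.inv₀ fun s => (hpos s).ne'
  have hsq : ∀ s, fm s * fm s = √(|s| + d ^ 2) := fun s => Real.mul_self_sqrt (Real.sqrt_nonneg _)
  have hsq2 : ∀ s : ℝ, √(|s| + d ^ 2) * √(|s| + d ^ 2) = |s| + d ^ 2 := fun s =>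
    Real.mul_self_sqrt (by positivity)
  have hpos2 : ∀ s : ℝ, 0 < √(|s| + d ^ 2) := fun s => by positivity
  have hinv : ∀ s, fn s * fn s = (√(|s| + d ^ 2))⁻¹ := fun s => by
    rw [← hsq s]; exact (mul_inv _ _).symm
  have hid : cfc (fun s : ℝ => s) c = c := cfc_id' ℝ c
  have hncn : cfc fn c * c * cfc fn c = cfc (fun s => fn s * s * fn s) c := by
    rw [cfc_mul (fun s => fn s * s) fn c (hfn.mul continuous_id).continuousOn hfn.continuousOn,
      cfc_mul fn (fun s => s) c hfn.continuousOn continuous_id.continuousOn, hid]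
  have hstn : star (cfc fn c) = cfc fn c := (cfc_predicate fn c).star_eq
  refine ⟨cfc fn c, cfc fm c, cfc_mem hMN hcM hcsa fn hfn, cfc_mem hMN hcM hcsa fm hfm,
    hstn, (cfc_predicate fm c).star_eq, ?_,
    (hcsa.commute_cfc hpc fn).symm, (hcsa.commute_cfc hpc fm).symm, ?_, ?_⟩
  · rw [← cfc_mul fn fm c hfn.continuousOn hfm.continuousOn]
    have : (fun s => fn s * fm s) = fun _ => 1 := funext fun s => inv_mul_cancel₀ (hpos s).ne'
    rw [this, cfc_const_one ℝ c]
  · have h1 : star (a * cfc fn c * cfc fn c) * (a * cfc fn c * cfc fn c) =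
        cfc (fun s => fn s * (fn s * s * fn s) * fn s) c := by
      rw [cfc_mul (fun s => fn s * (fn s * s * fn s)) fn c
        (hfn.mul ((hfn.mul continuous_id).mul hfn)).continuousOn hfn.continuousOn,
        cfc_mul fn (fun s => fn s * s * fn s) c hfn.continuousOn
        ((hfn.mul continuous_id).mul hfn).continuousOn, ← hncn]
      simp only [star_mul, hstn, mul_assoc, c]
    have h2 : ‖a * cfc fn c * cfc fn c‖ * ‖a * cfc fn c * cfc fn c‖ ≤ 1 := by
      rw [← CStarRing.norm_star_mul_self, h1]
      refine norm_cfc_le zero_le_one fun s _ => ?_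
      have : fn s * (fn s * s * fn s) * fn s = s / (|s| + d ^ 2) := by
        have : fn s * (fn s * s * fn s) * fn s = s * ((fn s * fn s) * (fn s * fn s)) := by ring
        rw [this, hinv, ← mul_inv, hsq2, div_eq_mul_inv]
      rw [this, Real.norm_eq_abs, abs_div, abs_of_pos (a := |s| + d ^ 2) (by positivity)]
      exact div_le_one_of_le₀ (by nlinarith) (by positivity)
    nlinarith [norm_nonneg (a * cfc fn c * cfc fn c)]
  · rw [hncn, ← cfc_mul fm fm c hfm.continuousOn hfm.continuousOn,
      ← cfc_sub (fun x => fm x * fm x) (fun s => fn s * s * fn s) c (hfm.mul hfm).continuousOn ((hfn.mul continuous_id).mul hfn).continuousOn]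
    refine norm_cfc_le hd.le fun s hs => ?_
    have hs0 : 0 ≤ s := spectrum_nonneg_of_nonneg (star_mul_self_nonneg a) hs
    have h3 : fn s * s * fn s = s / √(|s| + d ^ 2) := by
      have : fn s * s * fn s = s * (fn s * fn s) := by ring
      rw [this, hinv, div_eq_mul_inv]
    have h4 : fm s * fm s - fn s * s * fn s = d ^ 2 / √(|s| + d ^ 2) := by
      rw [h3, hsq]
      have := hsq2 s
      have := hpos2 s
      rw [abs_of_nonneg hs0] at *
      field_simp
      nlinarith
    rw [h4, Real.norm_eq_abs, abs_of_nonneg (by positivity), div_le_iff₀ (hpos2 s)]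
    have : d ≤ √(|s| + d ^ 2) := Real.le_sqrt_of_sq_le (by linarith [abs_nonneg s])
    nlinarith

namespace Trace

variable {N M : VonNeumannAlgebra H} (τ : Trace N) {p : N}

theorem L2Corner_induction {P : τ.L2 → Prop} (hP : IsClosed {ξ | P ξ})
    (h : ∀ x ∈ corner M p, P (τ.hat x)) {ξ : τ.L2} (hξ : ξ ∈ τ.L2Corner M p) : P ξ := by
  have : closure ((corner M p).map τ.hat : Set τ.L2) ⊆ {ξ | P ξ} :=
    hP.closure_subset_iff.2 (by rintro _ ⟨x, hx, rfl⟩; exact h x hx)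
  exact this hξ

theorem leftMul_of_mem_L2Corner {ξ : τ.L2} (hξ : ξ ∈ τ.L2Corner M p) : τ.leftMul p ξ = ξ :=
  τ.L2Corner_induction (P := fun ξ => τ.leftMul p ξ = ξ) (isClosed_eq (by fun_prop) (by fun_prop))
    (fun x hx => by rw [leftMul_hat, hx.2.1]) hξ

theorem rightMul_of_mem_L2Corner {ξ : τ.L2} (hξ : ξ ∈ τ.L2Corner M p) : τ.rightMul p ξ = ξ :=
  τ.L2Corner_induction (P := fun ξ => τ.rightMul p ξ = ξ) (isClosed_eq (by fun_prop) (by fun_prop))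
    (fun x hx => by rw [rightMul_hat, hx.2.2]) hξ

theorem conj_mem_L2Corner (hp : IsStarProjection p) {ξ : τ.L2} (hξ : ξ ∈ τ.L2Corner M p) :
    τ.conj ξ ∈ τ.L2Corner M p :=
  τ.L2Corner_induction (P := fun ξ => τ.conj ξ ∈ τ.L2Corner M p)
    ((Submodule.isClosed_topologicalClosure _).preimage τ.conj.continuous)
    (fun x hx => by rw [conj_hat]; exact τ.hat_mem_L2Corner (star_mem_corner hp hx)) hξ

theorem re_inner_self (v : τ.L2) : (⟪v, v⟫_ℂ).re = ‖v‖ ^ 2 := inner_self_eq_norm_sq (𝕜 := ℂ) v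

theorem convex_hat_ball (p : N) (r : ℝ) :
    Convex ℝ {ξ : τ.L2 | ∃ x ∈ corner M p, ‖x‖ ≤ r ∧ τ.hat x = ξ} := by
  rintro _ ⟨x, hx, hxr, rfl⟩ _ ⟨y, hy, hyr, rfl⟩ s t hs ht hst
  refine ⟨(s : ℂ) • x + (t : ℂ) • y, add_mem (Submodule.smul_mem _ _ hx)
    (Submodule.smul_mem _ _ hy), ?_, ?_⟩
  · refine (norm_add_le _ _).trans ?_
    rw [norm_smul, norm_smul, Complex.norm_real, Complex.norm_real, Real.norm_of_nonneg hs,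
      Real.norm_of_nonneg ht]
    calc s * ‖x‖ + t * ‖y‖ ≤ s * r + t * r := by gcongr
      _ = r := by rw [← add_mul, hst, one_mul]
  · rw [map_add, map_smul, map_smul]
    rfl

theorem norm_hat_le_of_mem_corner {x : N} {r : ℝ} (hx : x ∈ corner M p) (hr : ‖x‖ ≤ r) :
    ‖τ.hat x‖ ≤ r * ‖τ.hat p‖ := by
  rw [← hx.2.2, ← leftMul_hat]
  refine (τ.norm_leftMul_le x _).trans ?_
  gcongr

/-- A vector of `L²(pMp)` outside a ball of `pMp` is separated from it by an element of `pMp`. -/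
theorem exists_separating {ξ : τ.L2} (hξ : ξ ∈ τ.L2Corner M p) {r : ℝ} (hr : 0 ≤ r)
    (hnot : ¬ ∃ x ∈ corner M p, ‖x‖ ≤ r ∧ τ.hat x = ξ) :
    ∃ a ∈ corner M p, ∃ g > 0, ∀ x ∈ corner M p, ‖x‖ ≤ r →
      (⟪τ.hat a, τ.hat x⟫_ℂ).re + g ≤ (⟪τ.hat a, ξ⟫_ℂ).re := by
  obtain ⟨f, u, hfu, hux⟩ := RCLike.geometric_hahn_banach_closed_point (𝕜 := ℂ)
    (τ.convex_hat_ball p r) (τ.isClosed_hat_ball p r) (x := ξ) hnot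
  have hfu' : ∀ x ∈ corner M p, ‖x‖ ≤ r → (f (τ.hat x)).re < u := fun x hx hxr =>
    hfu _ ⟨x, hx, hxr, rfl⟩
  have hux' : u < (f ξ).re := hux
  set K := τ.L2Corner M p with hK
  -- Only the values of the functional on L²(pMp) matter, so its representing vector may be
  -- projected there and then approximated by an element of pMp, at the cost of half the gap.
  set ζ : τ.L2 := K.starProjection ((InnerProductSpace.toDual ℂ τ.L2).symm f) with hζ
  have hζK : ζ ∈ K := Submodule.starProjection_apply_mem _ _
  have hfζ : ∀ w ∈ K, f w = ⟪ζ, w⟫_ℂ := fun w hw => by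
    rw [hζ, Submodule.inner_starProjection_left_eq_right,
      Submodule.starProjection_eq_self_iff.2 hw, InnerProductSpace.toDual_symm_apply]
  obtain ⟨g, hg⟩ : ∃ g, g = (f ξ).re - u := ⟨_, rfl⟩
  have hg0 : 0 < g := by rw [hg]; exact sub_pos.2 hux'
  obtain ⟨R, hR⟩ : ∃ R, R = r * ‖τ.hat p‖ + ‖ξ‖ := ⟨_, rfl⟩
  have hR0 : 0 ≤ R := by rw [hR]; positivity
  obtain ⟨_, ⟨a, ha, rfl⟩, hyη⟩ :=
    Metric.mem_closure_iff.1 hζK (g / (4 * (R + 1))) (by positivity)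
  rw [dist_eq_norm] at hyη
  have hclose : ∀ w ∈ K, ‖w‖ ≤ R → |(f w).re - (⟪τ.hat a, w⟫_ℂ).re| ≤ g / 4 := by
    intro w hw hwR
    rw [hfζ w hw, ← Complex.sub_re, ← inner_sub_left]
    refine (Complex.abs_re_le_norm _).trans ((norm_inner_le_norm _ _).trans ?_)
    calc ‖ζ - τ.hat a‖ * ‖w‖ ≤ g / (4 * (R + 1)) * (R + 1) := by
          gcongr
          linarith
      _ = g / 4 := by field_simp
  refine ⟨a, ha, g / 2, by positivity, fun x hx hxr => ?_⟩
  have h1 := (abs_le.1 (hclose _ (τ.hat_mem_L2Corner hx) (by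
    rw [hR]; linarith [τ.norm_hat_le_of_mem_corner hx hxr, norm_nonneg ξ]))).1
  have h2 := (abs_le.1 (hclose ξ hξ (by rw [hR]; linarith [mul_nonneg hr (norm_nonneg (τ.hat p))]))).2
  have h3 := hfu' x hx hxr
  linarith

/-- The norm of the functional `⟪a, T ·⟫` is at most `‖T‖ ‖a‖₁`, where `‖a‖₁` is approximated by
`⟪a, x⟫` with `x` in the unit ball of `pMp`. -/
theorem exists_re_inner_le (hMN : M ≤ N) (hp : IsStarProjection p) (hpM : (p : H →L[ℂ] H) ∈ M)
    {T : τ.L2 →L[ℂ] τ.L2} (hTK : ∀ ξ ∈ τ.L2Corner M p, T ξ ∈ τ.L2Corner M p)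
    (hT : ∀ x ∈ corner M p, ∀ ξ ∈ τ.L2Corner M p, T (τ.rightMul x ξ) = τ.rightMul x (T ξ))
    {a : N} (ha : a ∈ corner M p) {d : ℝ} (hd : 0 < d) :
    ∃ x ∈ corner M p, ‖x‖ ≤ 1 ∧ (⟪τ.hat a, T (τ.hat p)⟫_ℂ).re ≤
      ‖T‖ * ((⟪τ.hat a, τ.hat x⟫_ℂ).re + d * ‖τ.hat p‖ ^ 2) := by
  have hpc := self_mem_corner hp hpM
  have hpK := τ.hat_mem_L2Corner hpc
  obtain ⟨n, m, hnM, hmM, hns, hms, hnm, hpn, hpm, han, hdiff⟩ :=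
    exists_approx_polar hMN hp ha hd
  have hanc : a * n * n ∈ corner M p :=
    ⟨mul_mem (mul_mem ha.1 hnM) hnM, by rw [← mul_assoc, ← mul_assoc, ha.2.1],
      by rw [mul_assoc _ n p, ← hpn, ← mul_assoc, mul_assoc a n p, ← hpn, ← mul_assoc a p n, ha.2.2]⟩
  have hmpc : m * p ∈ corner M p :=
    ⟨mul_mem hmM hpM, by rw [← mul_assoc, hpm, mul_assoc, hp.isIdempotentElem.eq],
      by rw [mul_assoc, hp.isIdempotentElem.eq]⟩
  have hpp := hp.isIdempotentElem.eq
  have hps := hp.isSelfAdjoint.star_eq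
  -- Writing a = (a n) m and moving m across T gives ⟪a, T p⟫ = ⟪a n, T(m p)⟫, to which
  -- Cauchy–Schwarz applies.
  have h1 : (⟪τ.hat a, T (τ.hat p)⟫_ℂ).re ≤ ‖τ.hat (a * n)‖ * (‖T‖ * ‖τ.hat (m * p)‖) := by
    have e1 : τ.hat a = τ.rightMul m (τ.hat (a * n)) := by
      rw [rightMul_hat, mul_assoc, hnm, mul_one]
    have e2 : τ.rightMul m (T (τ.hat p)) = T (τ.hat (m * p)) := by
      have := hT (m * p) hmpc _ hpK
      rw [rightMul_hat, hmpc.2.1] at this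
      rw [this, ← hpm, ← rightMul_rightMul, τ.rightMul_of_mem_L2Corner (hTK _ hpK)]
    rw [e1, inner_rightMul_left, hms, e2]
    exact (Complex.re_le_norm _).trans ((norm_inner_le_norm _ _).trans
      (by gcongr; exact T.le_opNorm _))
  have h2 : ‖τ.hat (m * p)‖ ^ 2 ≤ ‖τ.hat (a * n)‖ ^ 2 + d * ‖τ.hat p‖ ^ 2 := by
    have e1 : ⟪τ.hat (m * p), τ.hat (m * p)⟫_ℂ = ⟪τ.hat (a * n), τ.hat (a * n)⟫_ℂ +
        ⟪τ.hat p, τ.leftMul (m * m - n * (star a * a) * n) (τ.hat p)⟫_ℂ := by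
      rw [leftMul_hat, inner_hat, inner_hat, inner_hat, ← map_add]
      congr 1
      have e3 : n * (star a * a) * n * p = n * (star a * a) * n := by
        rw [mul_assoc _ n p, ← hpn, ← mul_assoc, mul_assoc n _ p, mul_assoc _ a p, ha.2.2]
      have e4 : p * (n * (star a * a) * n) = n * (star a * a) * n := by
        rw [← mul_assoc, ← mul_assoc, hpn, mul_assoc n p, ← mul_assoc p,
          (star_mem_corner hp ha).2.1]
      rw [star_mul, star_mul, hms, hns, hps, sub_mul, mul_sub, e3, e4]
      simp only [mul_assoc]
      abel
    have e2 := congrArg Complex.re e1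
    rw [Complex.add_re, re_inner_self, re_inner_self] at e2
    have e5 : (⟪τ.hat p, τ.leftMul (m * m - n * (star a * a) * n) (τ.hat p)⟫_ℂ).re ≤
        d * ‖τ.hat p‖ ^ 2 := by
      refine (Complex.re_le_norm _).trans ((norm_inner_le_norm _ _).trans ?_)
      have := τ.norm_leftMul_le (m * m - n * (star a * a) * n) (τ.hat p)
      calc _ ≤ ‖τ.hat p‖ * (d * ‖τ.hat p‖) := by
            gcongr
            exact this.trans (by gcongr)
        _ = _ := by ring
    linarith
  -- This is why x = a n n is the right contraction: its pairing with a is ‖a n‖₂², and ‖m p‖₂²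
  -- exceeds this by at most the error d‖p‖₂².
  have h3 : (⟪τ.hat a, τ.hat (a * n * n)⟫_ℂ).re = ‖τ.hat (a * n)‖ ^ 2 := by
    rw [← re_inner_self, ← τ.rightMul_hat n (a * n)]
    nth_rewrite 1 [← hns]
    rw [← inner_rightMul_left, rightMul_hat]
  refine ⟨_, hanc, han, h1.trans ?_⟩
  rw [h3]
  have h8 : ‖τ.hat (a * n)‖ * ‖τ.hat (m * p)‖ ≤ ‖τ.hat (a * n)‖ ^ 2 + d * ‖τ.hat p‖ ^ 2 := by
    have : 0 ≤ d * ‖τ.hat p‖ ^ 2 := by positivity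
    nlinarith [sq_nonneg (‖τ.hat (a * n)‖ - ‖τ.hat (m * p)‖)]
  calc _ = ‖T‖ * (‖τ.hat (a * n)‖ * ‖τ.hat (m * p)‖) := by ring
    _ ≤ _ := by gcongr

/-- A bounded operator on `L²(pMp)` that commutes with the right action of `pMp` is left
multiplication by an element of `pMp`. -/
theorem exists_leftMul_eq (hMN : M ≤ N) (hp : IsStarProjection p) (hpM : (p : H →L[ℂ] H) ∈ M)
    (T : τ.L2 →L[ℂ] τ.L2) (hTK : ∀ ξ ∈ τ.L2Corner M p, T ξ ∈ τ.L2Corner M p)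
    (hT : ∀ x ∈ corner M p, ∀ ξ ∈ τ.L2Corner M p, T (τ.rightMul x ξ) = τ.rightMul x (T ξ)) :
    ∃ b ∈ corner M p, ‖b‖ ≤ ‖T‖ ∧ ∀ ξ ∈ τ.L2Corner M p, T ξ = τ.leftMul b ξ := by
  have hpK := τ.hat_mem_L2Corner (self_mem_corner hp hpM)
  suffices hmem : ∃ b ∈ corner M p, ‖b‖ ≤ ‖T‖ ∧ τ.hat b = T (τ.hat p) by
    obtain ⟨b, hb, hbr, hbT⟩ := hmem
    refine ⟨b, hb, hbr, fun ξ hξ => ?_⟩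
    refine τ.L2Corner_induction (P := fun ξ => T ξ = τ.leftMul b ξ)
      (isClosed_eq (by fun_prop) (by fun_prop)) (fun x hx => ?_) hξ
    have h1 : τ.hat x = τ.rightMul x (τ.hat p) := by rw [rightMul_hat, hx.2.1]
    rw [h1, hT x hx _ hpK, ← hbT, rightMul_hat, rightMul_hat, leftMul_hat, hx.2.1]
  by_contra hnot
  obtain ⟨a, ha, g, hg, h⟩ := τ.exists_separating (hTK _ hpK) (norm_nonneg T) hnot
  obtain ⟨P, hP⟩ : ∃ P, P = ‖T‖ * ‖τ.hat p‖ ^ 2 := ⟨_, rfl⟩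
  have hP0 : 0 ≤ P := by rw [hP]; positivity
  -- The tolerance keeps the error ‖T‖ d ‖p‖₂² below g/2, so the estimate contradicts a separation
  -- by g from the ball of radius ‖T‖.
  obtain ⟨x, hx, hx1, hle⟩ := τ.exists_re_inner_le hMN hp hpM hTK hT ha (d := g / (2 * (P + 1)))
    (by positivity)
  have h1 := h (((‖T‖ : ℝ) : ℂ) • x) (Submodule.smul_mem _ _ hx) (by
    rw [norm_smul, Complex.norm_real, norm_norm]
    exact mul_le_of_le_one_right (norm_nonneg _) hx1)
  rw [map_smul, inner_smul_right, Complex.re_ofReal_mul] at h1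
  have h2 : ‖T‖ * (g / (2 * (P + 1)) * ‖τ.hat p‖ ^ 2) ≤ g / 2 := by
    have : ‖T‖ * (g / (2 * (P + 1)) * ‖τ.hat p‖ ^ 2) = g / (2 * (P + 1)) * P := by rw [hP]; ring
    rw [this, div_mul_eq_mul_div, div_le_div_iff₀ (by positivity) (by positivity)]
    nlinarith
  rw [mul_add] at hle
  linarith

/-- A bounded element of `L²(pMp)` is in `pMp`. -/
theorem mem_corner_of_hat_mem (hMN : M ≤ N) (hp : IsStarProjection p) (hpM : (p : H →L[ℂ] H) ∈ M)
    {x : N} (hx : τ.hat x ∈ τ.L2Corner M p) : x ∈ corner M p := by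
  have hpK := τ.hat_mem_L2Corner (self_mem_corner hp hpM)
  obtain ⟨b, hb, -, h⟩ := τ.exists_leftMul_eq hMN hp hpM (τ.leftMul x)
    (τ.mapsTo_L2Corner _ fun y hy => by
      rw [leftMul_hat, ← rightMul_hat]; exact τ.rightMul_mem_L2Corner hy _ hx)
    (fun y _ ξ _ => by simp)
  have h1 := h _ hpK
  rw [leftMul_hat, leftMul_hat, hb.2.2, ← rightMul_hat, τ.rightMul_of_mem_L2Corner hx] at h1
  rwa [τ.hat_injective h1]

end Trace

end VonNeumannAlgebra

end

/-! ### The closed operators L_ξ: graphs, bounded transforms and resolvents -/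

noncomputable section

namespace VonNeumannAlgebra

variable {H : Type*} [NormedAddCommGroup H] [InnerProductSpace ℂ H] [CompleteSpace H]

namespace Trace

variable {N M : VonNeumannAlgebra H} (τ : Trace N) {p : N}

/-- The map `x ↦ (x, ξ x)` from `pMp` to `L² ⊕ L²`. -/
def graphMap (M : VonNeumannAlgebra H) (p : N) (ξ : τ.L2) :
    corner M p →ₗ[ℂ] WithLp 2 (τ.L2 × τ.L2) where
  toFun x := WithLp.toLp 2 (τ.hat x, τ.rightMul x ξ)
  map_add' x y := by
    rw [← WithLp.toLp_add]
    simp [rightMul_add_apply]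
  map_smul' c x := by
    rw [RingHom.id_apply, ← WithLp.toLp_smul]
    simp [rightMul_smul_apply]

/-- The closure of the graph of `x ↦ ξ x`. -/
def graphClosure (M : VonNeumannAlgebra H) (p : N) (ξ : τ.L2) :
    Submodule ℂ (WithLp 2 (τ.L2 × τ.L2)) :=
  (LinearMap.range (τ.graphMap M p ξ)).topologicalClosure

instance instCompleteSpaceGraphClosure (M : VonNeumannAlgebra H) (p : N) (ξ : τ.L2) :
    CompleteSpace (τ.graphClosure M p ξ) :=
  (Submodule.isClosed_topologicalClosure _).completeSpace_coe

theorem mk_mem_graphClosure {ξ : τ.L2} {x : N} (hx : x ∈ corner M p) :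
    WithLp.toLp 2 (τ.hat x, τ.rightMul x ξ) ∈ τ.graphClosure M p ξ :=
  Submodule.le_topologicalClosure _ ⟨⟨x, hx⟩, rfl⟩

theorem graphClosure_induction {ξ : τ.L2} {P : τ.L2 → τ.L2 → Prop}
    (hP : IsClosed {v : τ.L2 × τ.L2 | P v.1 v.2})
    (h : ∀ x ∈ corner M p, P (τ.hat x) (τ.rightMul x ξ)) {v : WithLp 2 (τ.L2 × τ.L2)}
    (hv : v ∈ τ.graphClosure M p ξ) : P v.fst v.snd := by
  have hc : IsClosed {v : WithLp 2 (τ.L2 × τ.L2) | P v.fst v.snd} :=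
    hP.preimage (WithLp.prodContinuousLinearEquiv 2 ℂ τ.L2 τ.L2).continuous
  have : closure (LinearMap.range (τ.graphMap M p ξ) : Set (WithLp 2 (τ.L2 × τ.L2))) ⊆
      {v | P v.fst v.snd} :=
    hc.closure_subset_iff.2 (by rintro _ ⟨⟨x, hx⟩, rfl⟩; exact h x hx)
  exact this hv

theorem rightMul_mem_graphClosure {ξ : τ.L2} {y : N} (hy : y ∈ corner M p)
    {v : WithLp 2 (τ.L2 × τ.L2)} (hv : v ∈ τ.graphClosure M p ξ) :
    WithLp.toLp 2 (τ.rightMul y v.fst, τ.rightMul y v.snd) ∈ τ.graphClosure M p ξ := by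
  refine τ.graphClosure_induction (M := M) (p := p) (ξ := ξ)
    (P := fun u w => WithLp.toLp 2 (τ.rightMul y u, τ.rightMul y w) ∈ τ.graphClosure M p ξ)
    ?_ (fun x hx => ?_) hv
  · refine (Submodule.isClosed_topologicalClosure _).preimage ?_
    exact (WithLp.prodContinuousLinearEquiv 2 ℂ τ.L2 τ.L2).symm.continuous.comp
      (f := fun v : τ.L2 × τ.L2 => (τ.rightMul y v.1, τ.rightMul y v.2)) (by fun_prop)
  · rw [rightMul_hat, rightMul_rightMul]
    exact τ.mk_mem_graphClosure (mul_mem_corner hx hy)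

/-- The formal adjointness of ξ and Jξ is a closed condition on the graph, so the closure of x ↦ ξx
stays inside the adjoint of x ↦ (Jξ)x. -/
theorem inner_snd_of_mem_graphClosure {ξ : τ.L2} {v : WithLp 2 (τ.L2 × τ.L2)}
    (hv : v ∈ τ.graphClosure M p ξ) (b : N) :
    ⟪v.snd, τ.hat b⟫_ℂ = ⟪v.fst, τ.rightMul b (τ.conj ξ)⟫_ℂ := by
  refine τ.graphClosure_induction (M := M) (p := p) (ξ := ξ)
    (P := fun u w => ⟪w, τ.hat b⟫_ℂ = ⟪u, τ.rightMul b (τ.conj ξ)⟫_ℂ)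
    (isClosed_eq (by fun_prop) (by fun_prop)) (fun x _ => ?_) hv
  exact τ.inner_rightMul_hat ξ x b

/-- `v ↦ P (v, 0)` where `P` is the projection onto the closure of the graph. -/
def graphProj (M : VonNeumannAlgebra H) (p : N) (ξ : τ.L2) : τ.L2 →L[ℂ] WithLp 2 (τ.L2 × τ.L2) :=
  (τ.graphClosure M p ξ).starProjection ∘L
    (WithLp.prodContinuousLinearEquiv 2 ℂ τ.L2 τ.L2).symm.toContinuousLinearMap ∘L
      ContinuousLinearMap.inl ℂ τ.L2 τ.L2

theorem graphProj_apply (ξ v : τ.L2) : τ.graphProj M p ξ v =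
    (τ.graphClosure M p ξ).starProjection (WithLp.toLp 2 (v, 0)) := rfl

theorem graphProj_mem (ξ v : τ.L2) : τ.graphProj M p ξ v ∈ τ.graphClosure M p ξ :=
  Submodule.starProjection_apply_mem _ _

theorem inner_graphProj (ξ v : τ.L2) {w : WithLp 2 (τ.L2 × τ.L2)} (hw : w ∈ τ.graphClosure M p ξ) :
    ⟪v - (τ.graphProj M p ξ v).fst, w.fst⟫_ℂ = ⟪(τ.graphProj M p ξ v).snd, w.snd⟫_ℂ := by
  have h := Submodule.starProjection_inner_eq_zero (K := τ.graphClosure M p ξ)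
    (WithLp.toLp 2 (v, 0)) w hw
  rw [← graphProj_apply, WithLp.prod_inner_apply] at h
  have h2 : ⟪v - (τ.graphProj M p ξ v).fst, w.fst⟫_ℂ +
      ⟪0 - (τ.graphProj M p ξ v).snd, w.snd⟫_ℂ = 0 := h
  rw [zero_sub, inner_neg_left] at h2
  exact sub_eq_zero.1 (by rw [sub_eq_add_neg]; exact h2)

theorem norm_graphProj_le (ξ v : τ.L2) : ‖τ.graphProj M p ξ v‖ ≤ ‖v‖ := by
  rw [graphProj_apply]
  refine (Submodule.norm_starProjection_apply_le _ _).trans ?_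
  rw [WithLp.prod_norm_eq_of_L2]
  simp

/-- The closed graph is invariant under the right action of pMp, and so is its orthogonal
complement, because pMp is closed under adjoints. -/
theorem graphProj_rightMul (hp : IsStarProjection p) (ξ v : τ.L2) {y : N} (hy : y ∈ corner M p) :
    τ.graphProj M p ξ (τ.rightMul y v) =
      WithLp.toLp 2 (τ.rightMul y (τ.graphProj M p ξ v).fst,
        τ.rightMul y (τ.graphProj M p ξ v).snd) := by
  rw [graphProj_apply]
  refine Submodule.eq_starProjection_of_mem_of_inner_eq_zero
    (τ.rightMul_mem_graphClosure hy (τ.graphProj_mem ξ v)) fun w hw => ?_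
  have h := τ.inner_graphProj ξ v (τ.rightMul_mem_graphClosure (star_mem_corner hp hy) hw)
  rw [WithLp.prod_inner_apply]
  change ⟪τ.rightMul y v - τ.rightMul y (τ.graphProj M p ξ v).fst, w.fst⟫_ℂ +
    ⟪0 - τ.rightMul y (τ.graphProj M p ξ v).snd, w.snd⟫_ℂ = 0
  rw [← map_sub, inner_rightMul_left, zero_sub, inner_neg_left, inner_rightMul_left]
  exact add_neg_eq_zero.2 h

theorem mem_L2Corner_of_mem_graphClosure {ξ : τ.L2} (hξ : ξ ∈ τ.L2Corner M p)
    {v : WithLp 2 (τ.L2 × τ.L2)} (hv : v ∈ τ.graphClosure M p ξ) :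
    v.fst ∈ τ.L2Corner M p ∧ v.snd ∈ τ.L2Corner M p := by
  have hc : IsClosed (τ.L2Corner M p : Set τ.L2) := Submodule.isClosed_topologicalClosure _
  exact τ.graphClosure_induction (M := M) (p := p) (ξ := ξ)
    (P := fun u w => u ∈ τ.L2Corner M p ∧ w ∈ τ.L2Corner M p)
    ((hc.preimage continuous_fst).inter (hc.preimage continuous_snd))
    (fun x hx => ⟨τ.hat_mem_L2Corner hx, τ.rightMul_mem_L2Corner hx ξ hξ⟩) hv

/-- The bounded elements `B = (1 + ξ⋆ξ)⁻¹` and `C = ξ (1 + ξ⋆ξ)⁻¹` of `pMp`. -/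
theorem exists_bounded_transform (hMN : M ≤ N) (hp : IsStarProjection p)
    (hpM : (p : H →L[ℂ] H) ∈ M) {ξ : τ.L2} (hξ : ξ ∈ τ.L2Corner M p) :
    ∃ B ∈ corner M p, ∃ C ∈ corner M p, ‖B‖ ≤ 1 ∧ ‖C‖ ≤ 1 ∧ τ.hat C = τ.rightMul B ξ ∧
      τ.hat p - τ.hat B = τ.rightMul C (τ.conj ξ) ∧ ‖τ.hat B - τ.hat p‖ ≤ ‖ξ‖ := by
  have hpc := self_mem_corner hp hpM
  have hpK := τ.hat_mem_L2Corner hpc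
  have hmem := fun v => τ.mem_L2Corner_of_mem_graphClosure hξ (τ.graphProj_mem (M := M) (p := p) ξ v)
  -- Projecting (v, 0) onto the closed graph of L_ξ yields ((1 + ξ⋆ξ)⁻¹v, ξ(1 + ξ⋆ξ)⁻¹v). Both
  -- components are contractions commuting with the right action, hence left multiplications by some
  -- B and C.
  let T1 : τ.L2 →L[ℂ] τ.L2 := WithLp.fstL 2 ℂ τ.L2 τ.L2 ∘L τ.graphProj M p ξ
  let T2 : τ.L2 →L[ℂ] τ.L2 := WithLp.sndL 2 ℂ τ.L2 τ.L2 ∘L τ.graphProj M p ξ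
  obtain ⟨B, hB, hBn, hBT⟩ := τ.exists_leftMul_eq hMN hp hpM T1 (fun v _ => (hmem v).1)
    (fun y hy v _ => congrArg WithLp.fst (τ.graphProj_rightMul hp ξ v hy))
  obtain ⟨C, hC, hCn, hCT⟩ := τ.exists_leftMul_eq hMN hp hpM T2 (fun v _ => (hmem v).2)
    (fun y hy v _ => congrArg WithLp.snd (τ.graphProj_rightMul hp ξ v hy))
  have hB' : (τ.graphProj M p ξ (τ.hat p)).fst = τ.hat B := by
    refine (hBT _ hpK).trans ?_
    rw [leftMul_hat, hB.2.2]
  have hC' : (τ.graphProj M p ξ (τ.hat p)).snd = τ.hat C := by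
    refine (hCT _ hpK).trans ?_
    rw [leftMul_hat, hC.2.2]
  have hT1 : ‖T1‖ ≤ 1 := by
    refine ContinuousLinearMap.opNorm_le_bound _ zero_le_one fun v => ?_
    rw [one_mul]
    refine le_trans ?_ (τ.norm_graphProj_le (M := M) (p := p) ξ v)
    exact WithLp.norm_fst_le _ (τ.graphProj M p ξ v)
  have hT2 : ‖T2‖ ≤ 1 := by
    refine ContinuousLinearMap.opNorm_le_bound _ zero_le_one fun v => ?_
    rw [one_mul]
    refine le_trans ?_ (τ.norm_graphProj_le (M := M) (p := p) ξ v)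
    exact WithLp.norm_snd_le _ (τ.graphProj M p ξ v)
  refine ⟨B, hB, C, hC, hBn.trans hT1, hCn.trans hT2, ?_, ?_, ?_⟩
  · refine τ.denseRange_hat.eq_of_inner_left (𝕜 := ℂ) fun b => ?_
    rw [← hC', τ.inner_snd_of_mem_graphClosure (τ.graphProj_mem ξ _), hB', inner_rightMul_hat]
  · have hK : τ.hat p - τ.hat B - τ.rightMul C (τ.conj ξ) ∈ τ.L2Corner M p :=
      sub_mem (sub_mem hpK (τ.hat_mem_L2Corner hB))
        (τ.rightMul_mem_L2Corner hC _ (τ.conj_mem_L2Corner hp hξ))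
    rw [← sub_eq_zero, ← inner_self_eq_zero (𝕜 := ℂ)]
    refine τ.L2Corner_induction (M := M) (p := p)
      (P := fun w => ⟪τ.hat p - τ.hat B - τ.rightMul C (τ.conj ξ), w⟫_ℂ = 0)
      (isClosed_eq (by fun_prop) (by fun_prop)) (fun x hx => ?_) hK
    have h := τ.inner_graphProj ξ (τ.hat p) (τ.mk_mem_graphClosure (ξ := ξ) hx)
    rw [hB', hC'] at h
    have h2 : ⟪τ.hat p - τ.hat B, τ.hat x⟫_ℂ = ⟪τ.hat C, τ.rightMul x ξ⟫_ℂ := h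
    rw [inner_sub_left, h2, inner_rightMul_hat, conj_conj, sub_self]
  -- Since (p, ξ) lies on the graph, (p, ξ) − P(p, 0) = P(0, ξ), whose first component p − B has
  -- norm at most ‖ξ‖.
  · have h2 : (τ.graphClosure M p ξ).starProjection (WithLp.toLp 2 (τ.hat p, ξ)) =
        WithLp.toLp 2 (τ.hat p, ξ) := by
      rw [Submodule.starProjection_eq_self_iff]
      have := τ.mk_mem_graphClosure (ξ := ξ) hpc
      rwa [τ.rightMul_of_mem_L2Corner hξ] at this
    have h3 : WithLp.toLp 2 (τ.hat p, ξ) - τ.graphProj M p ξ (τ.hat p) =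
        (τ.graphClosure M p ξ).starProjection (WithLp.toLp 2 (0, ξ)) := by
      rw [graphProj_apply]
      nth_rewrite 1 [← h2]
      rw [← map_sub, ← WithLp.toLp_sub]
      simp
    have h4 : τ.hat p - τ.hat B =
        ((τ.graphClosure M p ξ).starProjection (WithLp.toLp 2 (0, ξ))).fst := by
      rw [← h3, ← hB']; rfl
    rw [norm_sub_rev, h4]
    refine (WithLp.norm_fst_le _ _).trans ((Submodule.norm_starProjection_apply_le _ _).trans ?_)
    rw [WithLp.prod_norm_eq_of_L2]
    simp

/-- Every vector of `L²(pMp)` is bounded after cutting down on the right by contractions of `pMp`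
close to `p`. -/
theorem exists_bounded_cut (hMN : M ≤ N) (hp : IsStarProjection p)
    (hpM : (p : H →L[ℂ] H) ∈ M) {ξ : τ.L2} (hξ : ξ ∈ τ.L2Corner M p) :
    ∃ e d : ℕ → N, (∀ n, e n ∈ corner M p) ∧ (∀ n, d n ∈ corner M p) ∧ (∀ n, ‖e n‖ ≤ 1) ∧
      (∀ n, τ.hat (d n) = τ.rightMul (e n) ξ) ∧
      Filter.Tendsto (fun n => τ.hat (e n)) Filter.atTop (𝓝 (τ.hat p)) := by
  have h : ∀ n : ℕ, ∃ B ∈ corner M p, ∃ C ∈ corner M p, ‖B‖ ≤ 1 ∧ τ.hat C = τ.rightMul B ξ ∧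
      ‖τ.hat B - τ.hat p‖ ≤ 1 / ((n : ℝ) + 1) * ‖ξ‖ := fun n => by
    have hn : (0 : ℝ) < (n : ℝ) + 1 := by positivity
    -- The transform of ξ/(n + 1) has B within ‖ξ‖/(n + 1) of p; rescaling C undoes the division.
    obtain ⟨B, hB, C, hC, hB1, -, hBC, -, hle⟩ := τ.exists_bounded_transform hMN hp hpM
      (Submodule.smul_mem _ (((1 / ((n : ℝ) + 1) : ℝ) : ℂ)) hξ)
    refine ⟨B, hB, ((((n : ℝ) + 1 : ℝ)) : ℂ) • C, Submodule.smul_mem _ _ hC, hB1, ?_, ?_⟩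
    · rw [map_smul, hBC, map_smul, smul_smul, ← Complex.ofReal_mul, mul_one_div_cancel hn.ne',
        Complex.ofReal_one, one_smul]
    · rwa [norm_smul, Complex.norm_real, Real.norm_of_nonneg (by positivity)] at hle
  choose e he d hd h1 h2 h3 using h
  refine ⟨e, d, he, hd, h1, h2, ?_⟩
  rw [tendsto_iff_norm_sub_tendsto_zero]
  refine squeeze_zero (fun _ => norm_nonneg _) h3 ?_
  simpa using tendsto_one_div_add_atTop_nhds_zero_nat.mul_const ‖ξ‖

/-- The closure of `x ↦ ξ x` is the adjoint of `x ↦ (J ξ) x`. -/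
theorem mem_graphClosure_of_inner (hMN : M ≤ N) (hp : IsStarProjection p)
    (hpM : (p : H →L[ℂ] H) ∈ M) {ξ ζ κ : τ.L2} (hξ : ξ ∈ τ.L2Corner M p)
    (hζ : ζ ∈ τ.L2Corner M p) (hκ : κ ∈ τ.L2Corner M p)
    (h : ∀ b ∈ corner M p, ⟪κ, τ.hat b⟫_ℂ = ⟪ζ, τ.rightMul b (τ.conj ξ)⟫_ℂ) :
    WithLp.toLp 2 (ζ, κ) ∈ τ.graphClosure M p ξ := by
  obtain ⟨e, d, he, hd, he1, hde, hlim⟩ := τ.exists_bounded_cut hMN hp hpM hζ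
  -- After the cut, ζ eₙ is an element dₙ of pMp, so the weak relation forces κ eₙ = ξ dₙ. Thus (ζ,
  -- κ)eₙ lies on the graph, and it tends to (ζ, κ).
  have hkey : ∀ n, τ.rightMul (e n) κ = τ.rightMul (d n) ξ := fun n => by
    have hK : τ.rightMul (e n) κ - τ.rightMul (d n) ξ ∈ τ.L2Corner M p :=
      sub_mem (τ.rightMul_mem_L2Corner (he n) _ hκ) (τ.rightMul_mem_L2Corner (hd n) _ hξ)
    rw [← sub_eq_zero, ← inner_self_eq_zero (𝕜 := ℂ)]
    refine τ.L2Corner_induction (M := M) (p := p)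
      (P := fun w => ⟪τ.rightMul (e n) κ - τ.rightMul (d n) ξ, w⟫_ℂ = 0)
      (isClosed_eq (by fun_prop) (by fun_prop)) (fun x hx => ?_) hK
    have := h (x * star (e n)) (mul_mem_corner hx (star_mem_corner hp (he n)))
    rw [inner_sub_left, inner_rightMul_left, rightMul_hat, this, inner_rightMul_hat, hde,
      inner_rightMul_left, rightMul_rightMul, sub_self]
  have h1 := τ.tendsto_rightMul he1 hlim ζ
  have h2 := τ.tendsto_rightMul he1 hlim κ
  rw [τ.rightMul_of_mem_L2Corner hζ] at h1
  rw [τ.rightMul_of_mem_L2Corner hκ] at h2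
  have h3 : Filter.Tendsto (fun n => WithLp.toLp 2 (τ.rightMul (e n) ζ, τ.rightMul (e n) κ))
      Filter.atTop (𝓝 (WithLp.toLp 2 (ζ, κ))) :=
    ((WithLp.prodContinuousLinearEquiv 2 ℂ τ.L2 τ.L2).symm.continuous.tendsto _).comp
      (h1.prodMk_nhds h2)
  refine (Submodule.isClosed_topologicalClosure _).mem_of_tendsto h3
    (Filter.Eventually.of_forall fun n => ?_)
  change WithLp.toLp 2 (τ.rightMul (e n) ζ, τ.rightMul (e n) κ) ∈ τ.graphClosure M p ξ
  rw [hkey, ← hde]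
  exact τ.mk_mem_graphClosure (hd n)

/-- `R = (ξ + i)⁻¹`, for a self-adjoint vector `ξ ∈ L²(pMp)`. -/
structure IsResolvent (p : N) (ξ : τ.L2) (R : N) : Prop where
  mul_right : τ.rightMul R ξ + Complex.I • τ.hat R = τ.hat p
  mul_left : τ.leftMul R ξ + Complex.I • τ.hat R = τ.hat p
  star_mul_left : τ.leftMul (star R) ξ - Complex.I • τ.hat (star R) = τ.hat p
  norm_le : ‖R‖ ≤ 2

/-- For self-adjoint ξ, (ξ + i)⁻¹ = (ξ − i)(1 + ξ²)⁻¹, which is C − iB for the bounded transform. -/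
theorem exists_isResolvent (hMN : M ≤ N) (hp : IsStarProjection p)
    (hpM : (p : H →L[ℂ] H) ∈ M) {ξ : τ.L2} (hξ : ξ ∈ τ.L2Corner M p) (hsa : τ.conj ξ = ξ) :
    ∃ R ∈ corner M p, τ.IsResolvent p ξ R := by
  obtain ⟨B, hB, C, hC, hB1, hC1, hCB, hBC, -⟩ := τ.exists_bounded_transform hMN hp hpM hξ
  rw [hsa] at hBC
  have h1 : τ.rightMul (C - Complex.I • B) ξ + Complex.I • τ.hat (C - Complex.I • B) = τ.hat p := by
    rw [rightMul_sub_apply, rightMul_smul_apply, ← hBC, ← hCB, map_sub, map_smul, smul_sub,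
      smul_smul, Complex.I_mul_I, neg_one_smul]
    abel
  have h2 : τ.rightMul (C + Complex.I • B) ξ - Complex.I • τ.hat (C + Complex.I • B) = τ.hat p := by
    rw [rightMul_add_apply, rightMul_smul_apply, ← hBC, ← hCB, map_add, map_smul, smul_add,
      smul_smul, Complex.I_mul_I, neg_one_smul]
    abel
  have hR : C + Complex.I • B ∈ corner M p := add_mem hC (Submodule.smul_mem _ _ hB)
  have hR' : C - Complex.I • B ∈ corner M p := sub_mem hC (Submodule.smul_mem _ _ hB)
  have hnorm : ‖C - Complex.I • B‖ ≤ 2 := by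
    refine (norm_sub_le _ _).trans ?_
    rw [norm_smul, Complex.norm_I, one_mul]
    linarith
  generalize C + Complex.I • B = S at h2 hR
  generalize C - Complex.I • B = R at h1 hR' hnorm
  have hps := hp.isSelfAdjoint.star_eq
  have h3 : τ.leftMul (star R) ξ - Complex.I • τ.hat (star R) = τ.hat p := by
    have := congrArg τ.conj h1
    simp only [map_add, conj_rightMul, hsa, ContinuousLinearMap.map_smulₛₗ, Complex.conj_I,
      conj_hat, hps, neg_smul] at this
    rw [sub_eq_add_neg, this]
  -- R⋆ is a left inverse and S a right inverse of ξ − i, so they agree. The conjugation J then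
  -- turns the right inverse relation for S into the left one for R.
  have h4 : star R = S := by
    have e1 := congrArg (τ.leftMul (star R)) h2
    have e2 := congrArg (τ.rightMul S) h3
    rw [map_sub, map_smul, leftMul_hat, leftMul_hat, (star_mem_corner hp hR').2.2] at e1
    rw [map_sub, map_smul, rightMul_hat, rightMul_hat, rightMul_leftMul, hR.2.1] at e2
    exact τ.hat_injective (e1.symm.trans e2)
  refine ⟨R, hR', h1, ?_, h3, hnorm⟩
  have := congrArg τ.conj h2
  rw [← h4] at this
  simp only [map_sub, conj_rightMul, hsa, ContinuousLinearMap.map_smulₛₗ, Complex.conj_I,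
    conj_hat, hps, neg_smul, star_star] at this
  rw [← this, sub_neg_eq_add]

end Trace

end VonNeumannAlgebra

end

/-! ### Bounded operators commuting with a polar decomposition -/

noncomputable section

namespace VonNeumannAlgebra

section Unbounded

variable {E : Type*} [NormedAddCommGroup E] [InnerProductSpace ℂ E] [CompleteSpace E]

/-- The graph of a positive self-adjoint operator. -/
structure IsPosSelfAdjointGraph (g : Submodule ℂ (E × E)) : Prop where
  symm : ∀ x y x' y', (x, y) ∈ g → (x', y') ∈ g → ⟪y, x'⟫_ℂ = ⟪x, y'⟫_ℂ
  maximal : ∀ x y, (∀ x' y', (x', y') ∈ g → ⟪y, x'⟫_ℂ = ⟪x, y'⟫_ℂ) → (x, y) ∈ g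
  nonneg : ∀ x y, (x, y) ∈ g → 0 ≤ ⟪x, y⟫_ℂ
  eq_zero : ∀ y, ((0 : E), y) ∈ g → y = 0

theorem isPosSelfAdjointGraph {A : E →ₗ.[ℂ] E} (hA : IsSelfAdjoint A)
    (hpos : ∀ x : A.domain, 0 ≤ ⟪(x : E), A x⟫_ℂ) : IsPosSelfAdjointGraph A.graph := by
  have hd := hA.dense_domain
  have hg : A.graph = A.graph.adjoint := by
    nth_rewrite 1 [← LinearPMap.isSelfAdjoint_def.1 hA]
    exact LinearPMap.adjoint_graph_eq_graph_adjoint hd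
  have key : ∀ x y, (x, y) ∈ A.graph ↔ ∀ x' y', (x', y') ∈ A.graph → ⟪y', x⟫_ℂ = ⟪x', y⟫_ℂ := by
    intro x y
    rw [hg, Submodule.mem_adjoint_iff, ← hg]
    exact ⟨fun h x' y' h' => sub_eq_zero.1 (h x' y' h'), fun h x' y' h' => sub_eq_zero.2 (h x' y' h')⟩
  refine ⟨fun x y x' y' h h' => (key _ _).1 h' _ _ h, fun x y h => (key x y).2 fun x' y' h' => ?_,
    fun x y h => ?_, fun y h => ?_⟩
  · rw [← inner_conj_symm, ← h x' y' h', inner_conj_symm]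
  · obtain ⟨z, hz1, hz2⟩ := (LinearPMap.mem_graph_iff _).1 h
    dsimp at hz1 hz2
    rw [← hz1, ← hz2]
    exact hpos z
  · exact LinearPMap.graph_fst_eq_zero_snd _ h rfl

namespace IsPosSelfAdjointGraph

variable {g : Submodule ℂ (E × E)} (hg : IsPosSelfAdjointGraph g)
include hg

theorem isClosed : IsClosed (g : Set (E × E)) := by
  have : (g : Set (E × E)) = ⋂ v : g, {w | ⟪w.2, v.1.1⟫_ℂ = ⟪w.1, v.1.2⟫_ℂ} := by
    ext ⟨x, y⟩
    simp only [SetLike.mem_coe, Set.mem_iInter]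
    exact ⟨fun h v => hg.symm _ _ _ _ h v.2, fun h => hg.maximal _ _ fun x' y' h' => h ⟨(x', y'), h'⟩⟩
  rw [this]
  exact isClosed_iInter fun v => isClosed_eq (by fun_prop) (by fun_prop)

/-- The operators `B = (1 + A²)⁻¹` and `C = A (1 + A²)⁻¹`. -/
theorem exists_transform : ∃ B C : E →L[ℂ] E, (∀ h, (B h, C h) ∈ g) ∧ (∀ h, (C h, h - B h) ∈ g) ∧
    (∀ h u v, (u, v) ∈ g → (∀ x y, (x, y) ∈ g → ⟪x, h - u⟫_ℂ = ⟪y, v⟫_ℂ) → B h = u ∧ C h = v) := by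
  let K : Submodule ℂ (WithLp 2 (E × E)) :=
    g.comap (WithLp.linearEquiv 2 ℂ (E × E)).toLinearMap
  have hKc : IsClosed (K : Set (WithLp 2 (E × E))) :=
    hg.isClosed.preimage (WithLp.prodContinuousLinearEquiv 2 ℂ E E).continuous
  have : CompleteSpace K := hKc.completeSpace_coe
  let P : E →L[ℂ] WithLp 2 (E × E) := K.starProjection ∘L
    (WithLp.prodContinuousLinearEquiv 2 ℂ E E).symm.toContinuousLinearMap ∘L
      ContinuousLinearMap.inl ℂ E E
  have hP : ∀ h, P h = K.starProjection (WithLp.toLp 2 (h, 0)) := fun h => rfl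
  have hmem : ∀ h, ((P h).fst, (P h).snd) ∈ g := fun h =>
    Submodule.starProjection_apply_mem K (WithLp.toLp 2 (h, 0))
  refine ⟨WithLp.fstL 2 ℂ E E ∘L P, WithLp.sndL 2 ℂ E E ∘L P, hmem, fun h => ?_, fun h u v huv hx => ?_⟩
  · refine hg.maximal _ _ fun x y hxy => ?_
    have h1 := Submodule.starProjection_inner_eq_zero (K := K) (WithLp.toLp 2 (h, 0))
      (WithLp.toLp 2 (x, y)) hxy
    rw [← hP, WithLp.prod_inner_apply] at h1
    have h2 : ⟪h - (P h).fst, x⟫_ℂ + ⟪0 - (P h).snd, y⟫_ℂ = 0 := h1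
    rw [zero_sub, inner_neg_left] at h2
    exact sub_eq_zero.1 (by rw [sub_eq_add_neg]; exact h2)
  · have h1 : P h = WithLp.toLp 2 (u, v) := by
      rw [hP]
      refine Submodule.eq_starProjection_of_mem_of_inner_eq_zero (K := K) huv fun w hw => ?_
      rw [WithLp.prod_inner_apply]
      change ⟪h - u, w.fst⟫_ℂ + ⟪0 - v, w.snd⟫_ℂ = 0
      have := congrArg (starRingEnd ℂ) (hx w.fst w.snd hw)
      rw [inner_conj_symm, inner_conj_symm] at this
      rw [this, zero_sub, inner_neg_left, add_neg_cancel]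
    exact ⟨congrArg WithLp.fst h1, congrArg WithLp.snd h1⟩

/-- A bounded self-adjoint operator that commutes with `U |T|` commutes with `|T|`. -/
theorem map_mem {G U : E →L[ℂ] E} (hG : ∀ x y, ⟪G x, y⟫_ℂ = ⟪x, G y⟫_ℂ)
    (hU : ∀ x y, (x, y) ∈ g → ‖U y‖ = ‖y‖)
    (hGU : ∀ x y, (x, y) ∈ g → ∃ y', (G x, y') ∈ g ∧ U y' = G (U y)) :
    ∀ x y, (x, y) ∈ g → (G x, G y) ∈ g := by
  have hinner : ∀ x y x' y', (x, y) ∈ g → (x', y') ∈ g → ⟪U y, U y'⟫_ℂ = ⟪y, y'⟫_ℂ := by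
    intro x y x' y' h h'
    let f : (g.map (LinearMap.snd ℂ E E)) →ₗᵢ[ℂ] E :=
      { toLinearMap := U.toLinearMap.domRestrict _
        norm_map' := by
          rintro ⟨_, ⟨⟨a, b⟩, hab, rfl⟩⟩
          exact hU a b hab }
    exact f.inner_map_map ⟨y, ⟨(x, y), h, rfl⟩⟩ ⟨y', ⟨(x', y'), h', rfl⟩⟩
  obtain ⟨B, C, hBC, hCB, huniq⟩ := hg.exists_transform
  -- The defining property of B = (1 + A²)⁻¹ involves A only through ⟪Ax, Ax′⟫ = ⟪UAx, UAx′⟫, so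
  -- commuting with UA is enough to commute with B.
  have hGB : ∀ h, B (G h) = G (B h) := fun h => by
    obtain ⟨y', hy', hUy'⟩ := hGU _ _ (hBC h)
    refine (huniq (G h) (G (B h)) y' hy' fun x y hxy => ?_).1
    obtain ⟨y'', hy'', hUy''⟩ := hGU _ _ hxy
    rw [← map_sub, ← hG, ← hg.symm _ _ _ _ hy'' (hCB h), ← hinner _ _ _ _ hy'' (hBC h), hUy'', hG,
      ← hUy', hinner _ _ _ _ hxy hy']
  -- C = A(1 + A²)⁻¹ is positive with C² = B − B², so it is the square root of an operator commuting
  -- with G.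
  have hCC : C * C = B - B * B := by
    ext h
    refine (huniq (C h) (C (B h)) (B h - B (B h)) (hCB (B h)) fun x y hxy => ?_).2
    have h1 : (B h - B (B h), C h - C (B h)) ∈ g := by
      have := g.sub_mem (hBC h) (hBC (B h))
      exact this
    exact (hg.symm _ _ _ _ hxy h1).symm
  have hCsymm : ∀ h k, ⟪C h, k⟫_ℂ = ⟪h, C k⟫_ℂ := fun h k => by
    have h1 := hg.symm _ _ _ _ (hBC h) (hBC k)
    have h2 := hg.symm _ _ _ _ (hCB h) (hCB k)
    rw [inner_sub_left, inner_sub_right, h1] at h2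
    linear_combination -h2
  have hCpos : (0 : E →L[ℂ] E) ≤ C := by
    rw [ContinuousLinearMap.nonneg_iff_isPositive]
    refine ⟨hCsymm, fun h => ?_⟩
    have h1 := hg.nonneg _ _ (hBC h)
    have h2 := hg.nonneg _ _ (hCB h)
    have h3 : ⟪C h, h⟫_ℂ = ⟪B h, C h⟫_ℂ + ⟪C h, h - B h⟫_ℂ := by
      rw [inner_sub_right, hg.symm _ _ _ _ (hBC h) (hBC h)]; ring
    have h4 : 0 ≤ ⟪C h, h⟫_ℂ := by rw [h3]; exact add_nonneg h1 h2
    exact (Complex.nonneg_iff.1 h4).1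
  have hsqrt : C = CFC.sqrt (B - B * B) := (CFC.sqrt_unique hCC hCpos).symm
  have hGC : ∀ h, C (G h) = G (C h) := fun h => by
    have hcomm : Commute (B - B * B) G := by
      have : Commute B G := ContinuousLinearMap.ext hGB
      exact this.sub_left (this.mul_left this)
    have hsa : IsSelfAdjoint (B - B * B) := by
      rw [← hCC]
      have : IsSelfAdjoint C := IsSelfAdjoint.of_nonneg hCpos
      exact this.commute_iff this |>.1 (Commute.refl C)
    have h2 : Commute C G := by
      have hnn : 0 ≤ B - B * B := by
        rw [← hCC]
        have : IsSelfAdjoint C := IsSelfAdjoint.of_nonneg hCpos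
        nth_rewrite 1 [← this.star_eq]
        exact star_mul_self_nonneg C
      rw [hsqrt, CFC.sqrt_eq_real_sqrt _ hnn, cfcₙ_eq_cfc]
      exact hsa.commute_cfc hcomm _
    exact congrArg (fun T : E →L[ℂ] E => T h) h2.eq
  -- The range of B is dense, so G(Ax) = A(Gx) may be tested against vectors Bk, where A can be
  -- moved over to give Ck.
  have hdense : ∀ w, (∀ k, ⟪B k, w⟫_ℂ = 0) → w = 0 := fun w hw => by
    have h1 := hg.symm _ _ _ _ (hCB w) (hBC w)
    have h2 := hw w
    rw [inner_sub_left, ← inner_conj_symm, h2, map_zero, zero_sub, inner_self_eq_norm_sq_to_K,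
      inner_self_eq_norm_sq_to_K] at h1
    have h3 : -(‖B w‖ ^ 2) = ‖C w‖ ^ 2 := by exact_mod_cast h1
    have h4 : C w = 0 := norm_eq_zero.1 (by nlinarith [norm_nonneg (C w), sq_nonneg ‖B w‖, sq_nonneg ‖C w‖])
    have h5 : B w = 0 := norm_eq_zero.1 (by nlinarith [norm_nonneg (B w), sq_nonneg ‖B w‖, sq_nonneg ‖C w‖])
    have h6 := hCB w
    rw [h4, h5, sub_zero] at h6
    exact hg.eq_zero _ h6
  intro x y hxy
  obtain ⟨y', hy', -⟩ := hGU _ _ hxy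
  suffices h : G y - y' = 0 by rwa [sub_eq_zero.1 h]
  refine hdense _ fun k => ?_
  rw [inner_sub_right, ← hG, ← hGB, ← hg.symm _ _ _ _ (hBC (G k)) hxy, hGC, hG,
    hg.symm _ _ _ _ (hBC k) hy', sub_self]

/-- A bounded self-adjoint operator that commutes with `U |T|` commutes with `U`. -/
theorem polar_commute {G U : E →L[ℂ] E} (hG : ∀ x y, ⟪G x, y⟫_ℂ = ⟪x, G y⟫_ℂ)
    (hU : ∀ x y, (x, y) ∈ g → ‖U y‖ = ‖y‖)
    (hGU : ∀ x y, (x, y) ∈ g → ∃ y', (G x, y') ∈ g ∧ U y' = G (U y))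
    (hker : ∀ z, (∀ x y, (x, y) ∈ g → ⟪y, z⟫_ℂ = 0) → U z = 0) (z : E) : U (G z) = G (U z) := by
  have hmap := hg.map_mem hG hU hGU
  let R := (g.map (LinearMap.snd ℂ E E)).topologicalClosure
  have : CompleteSpace R := (Submodule.isClosed_topologicalClosure _).completeSpace_coe
  -- R is the initial space of U. There the commutation follows from that of G with A and UA; on the
  -- complement, which G preserves, U vanishes.
  have h1 : ∀ a ∈ R, U (G a) = G (U a) := by
    have hc : IsClosed {a | U (G a) = G (U a)} := isClosed_eq (by fun_prop) (by fun_prop)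
    refine hc.closure_subset_iff.2 ?_
    rintro _ ⟨⟨x, y⟩, hxy, rfl⟩
    obtain ⟨y', hy', hUy'⟩ := hGU _ _ hxy
    have h2 : y' - G y = 0 := hg.eq_zero _ (by
      have := g.sub_mem hy' (hmap _ _ hxy)
      rwa [Prod.mk_sub_mk, sub_self] at this)
    change U (G y) = G (U y)
    rw [← hUy', sub_eq_zero.1 h2]
  have h2 : ∀ b ∈ Rᗮ, U (G b) = G (U b) := fun b hb => by
    have h3 : ∀ x y, (x, y) ∈ g → ⟪y, b⟫_ℂ = 0 := fun x y hxy =>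
      (Submodule.mem_orthogonal _ _).1 hb y (Submodule.le_topologicalClosure _ ⟨(x, y), hxy, rfl⟩)
    rw [hker b h3, map_zero]
    refine hker _ fun x y hxy => ?_
    rw [← hG]
    exact h3 _ _ (hmap _ _ hxy)
  rw [← R.starProjection_add_starProjection_orthogonal z]
  simp only [map_add]
  rw [h1 _ (Submodule.starProjection_apply_mem _ _), h2 _ (Submodule.starProjection_apply_mem _ _)]

end IsPosSelfAdjointGraph

end Unbounded

end VonNeumannAlgebra

end

/-! ### Bounded operators commuting with spectral projections -/

noncomputable section

namespace VonNeumannAlgebra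

section Unbounded

variable {E : Type*} [NormedAddCommGroup E] [InnerProductSpace ℂ E] [CompleteSpace E]

open MeasureTheory

namespace SpectralResolution

variable (P : SpectralResolution E)

theorem proj_proj (x : E) {S S' : Set ℝ} (hS : MeasurableSet S) (hS' : MeasurableSet S') :
    P.proj S (P.proj S' x) = P.proj (S ∩ S') x := by
  rw [P.inter S S' hS hS']; rfl

theorem inner_proj_left (x y : E) {S : Set ℝ} (hS : MeasurableSet S) :
    ⟪P.proj S x, y⟫_ℂ = ⟪x, P.proj S y⟫_ℂ := by
  have h := (P.isStarProjection S hS).isSelfAdjoint.star_eq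
  nth_rewrite 1 [← h]
  rw [ContinuousLinearMap.star_eq_adjoint, ContinuousLinearMap.adjoint_inner_left]

theorem proj_proj_self (x : E) {S : Set ℝ} (hS : MeasurableSet S) :
    P.proj S (P.proj S x) = P.proj S x := by
  rw [P.proj_proj x hS hS, Set.inter_self]

theorem norm_proj_le (x : E) {S : Set ℝ} (hS : MeasurableSet S) : ‖P.proj S x‖ ≤ ‖x‖ := by
  have h := P.inner_proj x hS
  have h2 := (Complex.re_le_norm _).trans (norm_inner_le_norm (𝕜 := ℂ) x (P.proj S x))
  rw [h] at h2
  nlinarith [norm_nonneg x, norm_nonneg (P.proj S x)]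

theorem measure_apply (x : E) {S : Set ℝ} (hS : MeasurableSet S) :
    P.measure x S = ENNReal.ofReal (‖P.proj S x‖ ^ 2) :=
  Measure.ofMeasurable_apply S hS

theorem measure_univ (x : E) : P.measure x Set.univ = ENNReal.ofReal (‖x‖ ^ 2) := by
  rw [P.measure_apply x MeasurableSet.univ, P.univ]; rfl

instance (x : E) : IsFiniteMeasure (P.measure x) :=
  ⟨by rw [P.measure_univ]; exact ENNReal.ofReal_lt_top⟩

theorem measure_eq_zero_iff (x : E) {S : Set ℝ} (hS : MeasurableSet S) :
    P.measure x S = 0 ↔ P.proj S x = 0 := by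
  rw [P.measure_apply x hS, ENNReal.ofReal_eq_zero]
  constructor
  · intro h
    exact norm_eq_zero.1 (pow_eq_zero_iff two_ne_zero |>.1 (le_antisymm h (sq_nonneg _)))
  · intro h
    simp [h]

theorem proj_empty (x : E) : P.proj ∅ x = 0 := by
  rw [← P.measure_eq_zero_iff x MeasurableSet.empty]; simp

theorem measure_proj (x : E) {S : Set ℝ} (hS : MeasurableSet S) :
    P.measure (P.proj S x) = (P.measure x).restrict S := by
  ext S' hS'
  rw [P.measure_apply _ hS', P.proj_proj x hS' hS, Measure.restrict_apply hS',
    P.measure_apply x (hS'.inter hS)]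

theorem proj_add_proj_compl (x : E) {S : Set ℝ} (hS : MeasurableSet S) :
    P.proj S x + P.proj Sᶜ x = x := by
  have hsum := P.iUnion (fun n => if n = 0 then S else if n = 1 then Sᶜ else ∅)
    (fun n => by
      split_ifs
      exacts [hS, hS.compl, MeasurableSet.empty])
    (fun i j hij => by
      simp only [Function.onFun]
      split_ifs with h1 h2 h3 h4 h5
      all_goals first | omega | simp [disjoint_compl_right, disjoint_compl_left])
    x
  have hu : (⋃ n : ℕ, if n = 0 then S else if n = 1 then Sᶜ else ∅) = Set.univ := by
    refine Set.eq_univ_of_forall fun s => Set.mem_iUnion.2 ?_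
    by_cases hs : s ∈ S
    · exact ⟨0, by simpa using hs⟩
    · exact ⟨1, by simpa using hs⟩
  have h0 : ∀ n ∉ Finset.range 2,
      P.proj (if n = 0 then S else if n = 1 then Sᶜ else ∅) x = 0 := fun n hn => by
    rw [Finset.mem_range, not_lt] at hn
    rw [if_neg (by omega), if_neg (by omega), P.proj_empty]
  have h1 := hsum.unique (hasSum_sum_of_ne_finset_zero h0)
  rw [hu, P.univ] at h1
  simpa [Finset.sum_range_succ] using h1.symm

end SpectralResolution

namespace IsSpectralResolutionOf

variable {P : SpectralResolution E} {A : E →ₗ.[ℂ] E} (hPA : IsSpectralResolutionOf P A)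
include hPA

theorem proj_mem_domain {x : E} (hx : x ∈ A.domain) {S : Set ℝ} (hS : MeasurableSet S) :
    P.proj S x ∈ A.domain := by
  rw [hPA.mem_domain_iff] at hx ⊢
  rw [P.measure_proj x hS]
  exact hx.restrict

theorem integrable {x : E} (hx : x ∈ A.domain) : Integrable (fun s : ℝ => s) (P.measure x) := by
  have h := (hPA.mem_domain_iff x).1 hx
  refine Integrable.mono' (h.add (integrable_const (1 : ℝ))) (by fun_prop)
    (Filter.Eventually.of_forall fun s => ?_)
  rw [Real.norm_eq_abs, Pi.add_apply]
  nlinarith [sq_nonneg (|s| - 1), sq_abs s, abs_nonneg s]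

theorem inner_graph {x y : E} (h : (x, y) ∈ A.graph) :
    ⟪x, y⟫_ℂ = ((∫ s, s ∂(P.measure x) : ℝ) : ℂ) := by
  obtain ⟨z, hz1, hz2⟩ := (LinearPMap.mem_graph_iff _).1 h
  dsimp at hz1 hz2
  rw [← hz2, ← hz1]
  exact hPA.inner_apply z

/-- The spectral projections reduce the operator. -/
theorem proj_mem_graph (hd : Dense (A.domain : Set E)) {x y : E} (h : (x, y) ∈ A.graph)
    {S : Set ℝ} (hS : MeasurableSet S) : (P.proj S x, P.proj S y) ∈ A.graph := by
  have hex : ∀ u ∈ A.domain, ∃ v, (u, v) ∈ A.graph := fun u hu => ⟨A ⟨u, hu⟩, A.mem_graph ⟨u, hu⟩⟩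
  have hdom : ∀ {u v}, (u, v) ∈ A.graph → u ∈ A.domain := fun h => LinearPMap.mem_domain_of_mem_graph h
  -- The form x ↦ ⟪x, Ax⟫ is an integral against the spectral measure, hence additive over S and its
  -- complement, so the cross terms cancel. Replacing b by ib then makes each cross term vanish.
  have hquad : ∀ S : Set ℝ, MeasurableSet S → ∀ a a' b b', (a, a') ∈ A.graph → (b, b') ∈ A.graph →
      P.proj S a = a → P.proj S b = 0 → ⟪a, b'⟫_ℂ + ⟪b, a'⟫_ℂ = 0 := by
    intro S hS a a' b b' ha hb hSa hSb
    have hab := A.graph.add_mem ha hb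
    have h1 := hPA.inner_graph hab
    have h2 := hPA.inner_graph ha
    have h3 := hPA.inner_graph hb
    have hSab : P.proj S (a + b) = a := by rw [map_add, hSa, hSb, add_zero]
    have hSab' : P.proj Sᶜ (a + b) = b := by
      have := P.proj_add_proj_compl (a + b) hS
      rw [hSab] at this
      exact add_left_cancel this
    have h4 : ∫ s, s ∂(P.measure (a + b)) = ∫ s, s ∂(P.measure a) + ∫ s, s ∂(P.measure b) := by
      have h5 := P.measure_proj (a + b) hS
      have h6 := P.measure_proj (a + b) hS.compl
      rw [hSab] at h5
      rw [hSab'] at h6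
      rw [h5, h6]
      exact (integral_add_compl hS (hPA.integrable (hdom hab))).symm
    change ⟪a + b, a' + b'⟫_ℂ = _ at h1
    rw [h4, Complex.ofReal_add, ← h2, ← h3, inner_add_left, inner_add_right, inner_add_right] at h1
    linear_combination h1
  have hzero : ∀ S : Set ℝ, MeasurableSet S → ∀ a a' b b', (a, a') ∈ A.graph → (b, b') ∈ A.graph →
      P.proj S a = a → P.proj S b = 0 → ⟪a, b'⟫_ℂ = 0 := by
    intro S hS a a' b b' ha hb hSa hSb
    have h1 := hquad S hS a a' b b' ha hb hSa hSb
    have h2 := hquad S hS a a' _ _ ha (A.graph.smul_mem Complex.I hb) hSa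
      (by change P.proj S (Complex.I • b) = 0; rw [map_smul, hSb, smul_zero])
    change ⟪a, Complex.I • b'⟫_ℂ + ⟪Complex.I • b, a'⟫_ℂ = 0 at h2
    rw [inner_smul_right, inner_smul_left, Complex.conj_I] at h2
    linear_combination h1 / 2 - Complex.I / 2 * h2 + (⟪a, b'⟫_ℂ - ⟪b, a'⟫_ℂ) / 2 * Complex.I_sq
  -- A maps domain vectors orthogonal to the range of P(S) to vectors orthogonal to it, by density
  -- of the domain. Applied to S and its complement, this is reduction.
  have hkill : ∀ S : Set ℝ, MeasurableSet S → ∀ b b', (b, b') ∈ A.graph → P.proj S b = 0 →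
      P.proj S b' = 0 := by
    intro S hS b b' hb hSb
    refine hd.eq_zero_of_inner_right ℂ fun u hu => ?_
    obtain ⟨v, hv⟩ := hex _ (hPA.proj_mem_domain hu hS)
    rw [← P.inner_proj_left u b' hS]
    exact hzero S hS _ _ _ _ hv hb (by rw [P.proj_proj _ hS hS, Set.inter_self]) hSb
  obtain ⟨v, hv⟩ := hex _ (hPA.proj_mem_domain (hdom h) hS)
  have hv1 : P.proj Sᶜ v = 0 := hkill _ hS.compl _ _ hv (by
    rw [P.proj_proj _ hS.compl hS, Set.compl_inter_self, P.proj_empty])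
  have hsub := A.graph.sub_mem h hv
  have hv2 : P.proj S (y - v) = 0 := hkill _ hS _ _ hsub (by
    change P.proj S (x - P.proj S x) = 0
    rw [map_sub, P.proj_proj _ hS hS, Set.inter_self, sub_self])
  have hv3 := P.proj_add_proj_compl v hS
  rw [hv1, add_zero] at hv3
  rw [map_sub, hv3, sub_eq_zero] at hv2
  rwa [hv2]

/-- On the range of the projection for [−k, 0) the form is ∫ s dμ with s < 0, yet it is nonnegative,
so μ vanishes there; then k → ∞. -/
theorem measure_Iio_zero (hpos : ∀ x y, (x, y) ∈ A.graph → 0 ≤ ⟪x, y⟫_ℂ) (x : E) :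
    P.measure x (Set.Iio 0) = 0 := by
  have h1 : ∀ k : ℕ, P.measure x (Set.Ico (-(k : ℝ)) 0) = 0 := fun k => by
    have hS : MeasurableSet (Set.Ico (-(k : ℝ)) 0) := measurableSet_Ico
    rw [P.measure_eq_zero_iff _ hS, ← P.proj_proj_self x hS,
      ← P.measure_eq_zero_iff _ hS, P.measure_proj x hS, Measure.restrict_apply_self]
    set μ := (P.measure x).restrict (Set.Ico (-(k : ℝ)) 0) with hμ
    have hae : ∀ᵐ s ∂μ, s ∈ Set.Ico (-(k : ℝ)) 0 := ae_restrict_mem hS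
    have hdom : P.proj (Set.Ico (-(k : ℝ)) 0) x ∈ A.domain := by
      rw [hPA.mem_domain_iff, P.measure_proj x hS, ← hμ]
      refine Integrable.mono' (integrable_const ((k : ℝ) ^ 2)) (by fun_prop) ?_
      filter_upwards [hae] with s hs
      rw [Real.norm_eq_abs, abs_of_nonneg (sq_nonneg s)]
      nlinarith [hs.1, hs.2]
    have hint := hPA.integrable hdom
    have h2 := hpos _ _ (A.mem_graph ⟨_, hdom⟩)
    rw [hPA.inner_graph (A.mem_graph ⟨_, hdom⟩)] at h2
    have h3 : 0 ≤ ∫ s, s ∂μ := by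
      have := (Complex.nonneg_iff.1 h2).1
      rw [Complex.ofReal_re] at this
      rwa [hμ, ← P.measure_proj x hS]
    rw [P.measure_proj x hS, ← hμ] at hint
    have h4 : ∫ s, -s ∂μ = 0 := by
      refine le_antisymm ?_ (integral_nonneg_of_ae ?_)
      · rw [integral_neg]; linarith
      · filter_upwards [hae] with s hs
        simpa using hs.2.le
    have h5 := (integral_eq_zero_iff_of_nonneg_ae (by
      filter_upwards [hae] with s hs
      simpa using hs.2.le) hint.neg).1 h4
    have h6 : ∀ᵐ s ∂μ, False := by
      filter_upwards [hae, h5] with s hs hs'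
      have : s = 0 := by simpa using hs'
      exact absurd hs.2 (by rw [this]; exact lt_irrefl _)
    have h7 : μ Set.univ = 0 := by
      have := ae_iff.1 h6
      simpa using this
    rw [hμ, Measure.restrict_apply_univ] at h7
    exact h7
  have h2 : Set.Iio (0 : ℝ) ⊆ ⋃ k : ℕ, Set.Ico (-(k : ℝ)) 0 := fun s hs => by
    obtain ⟨k, hk⟩ := exists_nat_gt (-s)
    exact Set.mem_iUnion.2 ⟨k, by linarith, hs⟩
  exact measure_mono_null h2 (measure_iUnion_null h1)

theorem proj_Iic_mem_domain (hpos : ∀ x y, (x, y) ∈ A.graph → 0 ≤ ⟪x, y⟫_ℂ) (x : E) (r : ℝ) :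
    P.proj (Set.Iic r) x ∈ A.domain := by
  rw [hPA.mem_domain_iff, P.measure_proj x measurableSet_Iic]
  refine Integrable.mono' (integrable_const (r ^ 2)) (by fun_prop) ?_
  filter_upwards [ae_restrict_mem measurableSet_Iic,
    ae_restrict_of_ae (measure_eq_zero_iff_ae_notMem.1 (hPA.measure_Iio_zero hpos x))] with s hs hs'
  rw [Set.mem_Iio, not_lt] at hs'
  rw [Real.norm_eq_abs, abs_of_nonneg (sq_nonneg s)]
  have := Set.mem_Iic.1 hs
  nlinarith

theorem re_inner_le {x y : E} (h : (x, y) ∈ A.graph) {r : ℝ} (hx : P.proj (Set.Iic r) x = x) :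
    (⟪x, y⟫_ℂ).re ≤ r * ‖x‖ ^ 2 := by
  have hint := hPA.integrable (LinearPMap.mem_domain_of_mem_graph h)
  rw [hPA.inner_graph h, Complex.ofReal_re]
  have hm := P.measure_proj x (measurableSet_Iic (a := r))
  rw [hx] at hm
  have : ∫ s, s ∂(P.measure x) ≤ ∫ s, r ∂(P.measure x) := by
    refine integral_mono_ae hint (integrable_const _) ?_
    rw [hm]
    exact ae_restrict_mem measurableSet_Iic
  rw [integral_const, measureReal_def, P.measure_univ, ENNReal.toReal_ofReal (sq_nonneg _),
    smul_eq_mul] at this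
  linarith

theorem le_re_inner {x y : E} (h : (x, y) ∈ A.graph) {r : ℝ} (hx : P.proj (Set.Ioi r) x = x) :
    r * ‖x‖ ^ 2 ≤ (⟪x, y⟫_ℂ).re := by
  have hint := hPA.integrable (LinearPMap.mem_domain_of_mem_graph h)
  rw [hPA.inner_graph h, Complex.ofReal_re]
  have hm := P.measure_proj x (measurableSet_Ioi (a := r))
  rw [hx] at hm
  have : ∫ s, r ∂(P.measure x) ≤ ∫ s, s ∂(P.measure x) := by
    refine integral_mono_ae (integrable_const _) hint ?_
    rw [hm]
    filter_upwards [ae_restrict_mem measurableSet_Ioi] with s hs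
    exact (Set.mem_Ioi.1 hs).le
  rw [integral_const, measureReal_def, P.measure_univ, ENNReal.toReal_ofReal (sq_nonneg _),
    smul_eq_mul] at this
  linarith

/-- The spectral resolution controls only the form of A. The norm bound is the Cauchy–Schwarz
inequality for this positive form: it is nonnegative at x − tAx, and t = 1/r gives ‖Ax‖² ≤ r²‖x‖².
-/
theorem norm_le (hg : IsPosSelfAdjointGraph A.graph) (hd : Dense (A.domain : Set E)) {x y : E}
    (h : (x, y) ∈ A.graph) {r : ℝ} (hr : 0 ≤ r) (hx : P.proj (Set.Iic r) x = x) :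
    ‖y‖ ≤ r * ‖x‖ := by
  have hy : P.proj (Set.Iic r) y = y := by
    have := A.graph.sub_mem (hPA.proj_mem_graph hd h (measurableSet_Iic (a := r))) h
    rw [hx, Prod.mk_sub_mk, sub_self] at this
    exact sub_eq_zero.1 (hg.eq_zero _ this)
  have hyd := hPA.proj_Iic_mem_domain hg.nonneg y r
  rw [hy] at hyd
  obtain ⟨z, hz⟩ : ∃ z, (y, z) ∈ A.graph := ⟨_, A.mem_graph ⟨y, hyd⟩⟩
  have hqx := hPA.re_inner_le h hx
  have hqy := hPA.re_inner_le hz hy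
  have hxz : ⟪x, z⟫_ℂ = ⟪y, y⟫_ℂ := (hg.symm _ _ _ _ h hz).symm
  have key : ∀ t : ℝ, 0 ≤ r * ‖x‖ ^ 2 - 2 * t * ‖y‖ ^ 2 + t ^ 2 * (r * ‖y‖ ^ 2) := fun t => by
    have h1 := hg.nonneg _ _ (A.graph.sub_mem h (A.graph.smul_mem (t : ℂ) hz))
    have h2 := (Complex.nonneg_iff.1 h1).1
    change 0 ≤ (⟪x - (t : ℂ) • y, y - (t : ℂ) • z⟫_ℂ).re at h2
    have h3 : ⟪x - (t : ℂ) • y, y - (t : ℂ) • z⟫_ℂ =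
        ⟪x, y⟫_ℂ - (2 * t : ℝ) * ⟪y, y⟫_ℂ + (t ^ 2 : ℝ) * ⟪y, z⟫_ℂ := by
      simp only [inner_sub_left, inner_sub_right, inner_smul_left, inner_smul_right,
        Complex.conj_ofReal, hxz]
      push_cast
      ring
    rw [h3, Complex.add_re, Complex.sub_re, Complex.re_ofReal_mul, Complex.re_ofReal_mul] at h2
    have h4 : (⟪y, y⟫_ℂ).re = ‖y‖ ^ 2 := inner_self_eq_norm_sq (𝕜 := ℂ) y
    rw [h4] at h2
    nlinarith [sq_nonneg t]
  rcases hr.eq_or_lt with rfl | hr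
  · have := key 1
    have : ‖y‖ = 0 := by nlinarith [norm_nonneg y]
    rw [this, zero_mul]
  · have h1 := key (1 / r)
    have h2 : r * ‖x‖ ^ 2 - 2 * (1 / r) * ‖y‖ ^ 2 + (1 / r) ^ 2 * (r * ‖y‖ ^ 2) =
        (r ^ 2 * ‖x‖ ^ 2 - ‖y‖ ^ 2) / r := by
      field_simp
      ring
    rw [h2] at h1
    have h3 := (le_div_iff₀ hr).1 h1
    exact abs_le_of_sq_le_sq' (by nlinarith) (by positivity) |>.2

/-- A bounded self-adjoint operator that commutes with `A` commutes with its spectral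
projections. -/
theorem commute (hg : IsPosSelfAdjointGraph A.graph) (hd : Dense (A.domain : Set E)) {G : E →L[ℂ] E}
    (hG : ∀ x y, ⟪G x, y⟫_ℂ = ⟪x, G y⟫_ℂ)
    (hGA : ∀ x y, (x, y) ∈ A.graph → (G x, G y) ∈ A.graph) {S : Set ℝ} (hS : MeasurableSet S) :
    ∀ x, P.proj S (G x) = G (P.proj S x) := by
  have h1 : ∀ r a, 0 ≤ r → r < a → ∀ x, P.proj (Set.Ioi a) (G (P.proj (Set.Iic r) x)) = 0 := by
    intro r a hr hra x
    set X : E →L[ℂ] E := P.proj (Set.Ioi a) * G * P.proj (Set.Iic r) with hX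
    have hXx : ∀ x, X x = P.proj (Set.Ioi a) (G (P.proj (Set.Iic r) x)) := fun x => rfl
    have ha : 0 < a := hr.trans_lt hra
    -- For X = P(a,∞) G P(−∞,r], the form of A at Xz is at least a‖Xz‖² and at most ‖Xz‖ ‖X‖ r‖z‖.
    -- Hence ‖X‖ ≤ (r/a)‖X‖, and r < a forces X = 0.
    have h2 : ‖X‖ ≤ r / a * ‖X‖ := by
      refine ContinuousLinearMap.opNorm_le_bound _ (by positivity) fun z => ?_
      have hx'd := hPA.proj_Iic_mem_domain hg.nonneg z r
      set x' := P.proj (Set.Iic r) z with hx'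
      obtain ⟨y', hy'⟩ : ∃ y', (x', y') ∈ A.graph := ⟨_, A.mem_graph ⟨x', hx'd⟩⟩
      have hPx' : P.proj (Set.Iic r) x' = x' := P.proj_proj_self z measurableSet_Iic
      have hPy' : P.proj (Set.Iic r) y' = y' := by
        have := A.graph.sub_mem (hPA.proj_mem_graph hd hy' (measurableSet_Iic (a := r))) hy'
        rw [hPx', Prod.mk_sub_mk, sub_self] at this
        exact sub_eq_zero.1 (hg.eq_zero _ this)
      have hw := hPA.proj_mem_graph hd (hGA _ _ hy') (measurableSet_Ioi (a := a))
      have hw1 : P.proj (Set.Ioi a) (G x') = X z := rfl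
      have hw2 : P.proj (Set.Ioi a) (G y') = X y' := by rw [hXx, hPy']
      rw [hw1, hw2] at hw
      have h3 := hPA.le_re_inner hw (r := a) (by
        rw [hXx]; exact P.proj_proj_self _ measurableSet_Ioi)
      have h4 : (⟪X z, X y'⟫_ℂ).re ≤ ‖X z‖ * (‖X‖ * (r * ‖z‖)) := by
        refine (Complex.re_le_norm _).trans ((norm_inner_le_norm _ _).trans ?_)
        gcongr
        refine (X.le_opNorm _).trans ?_
        gcongr
        refine (hPA.norm_le hg hd hy' hr hPx').trans ?_
        gcongr
        rw [hx']
        exact P.norm_proj_le z measurableSet_Iic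
      have h5 := h3.trans h4
      rcases (norm_nonneg (X z)).eq_or_lt with h0 | h0
      · rw [← h0]; positivity
      · have h6 : a * ‖X z‖ ≤ ‖X‖ * (r * ‖z‖) := by
          have : ‖X z‖ * (a * ‖X z‖) ≤ ‖X z‖ * (‖X‖ * (r * ‖z‖)) := by nlinarith
          exact le_of_mul_le_mul_left this h0
        have h7 : r / a * ‖X‖ * ‖z‖ = (‖X‖ * (r * ‖z‖)) / a := by ring
        rw [h7, le_div_iff₀ ha]
        linarith
    have h3 : ‖X‖ = 0 := by
      have : r / a < 1 := (div_lt_one ha).2 hra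
      nlinarith [norm_nonneg X]
    rw [← hXx, norm_eq_zero.1 h3]; rfl
  have h2 : ∀ r, 0 ≤ r → ∀ x, P.proj (Set.Ioi r) (G (P.proj (Set.Iic r) x)) = 0 := by
    intro r hr x
    rw [← P.measure_eq_zero_iff _ measurableSet_Ioi]
    have h3 : Set.Ioi r ⊆ ⋃ n : ℕ, Set.Ioi (r + 1 / ((n : ℝ) + 1)) := fun s hs => by
      obtain ⟨n, hn⟩ := exists_nat_one_div_lt (sub_pos.2 (Set.mem_Ioi.1 hs))
      exact Set.mem_iUnion.2 ⟨n, Set.mem_Ioi.2 (by linarith)⟩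
    refine measure_mono_null h3 (measure_iUnion_null fun n => ?_)
    rw [P.measure_eq_zero_iff _ measurableSet_Ioi]
    exact h1 r _ hr (by linarith [show (0 : ℝ) < 1 / ((n : ℝ) + 1) by positivity]) x
  -- Letting a decrease to r, G preserves the range of P(−∞,r]. Being self-adjoint it commutes with
  -- this projection, and a π-λ argument extends this to all Borel sets.
  have h3 : ∀ r x, P.proj (Set.Iic r) (G (P.proj (Set.Iic r) x)) = G (P.proj (Set.Iic r) x) := by
    intro r x
    rcases le_or_gt 0 r with hr | hr
    · have h4 := P.proj_add_proj_compl (G (P.proj (Set.Iic r) x)) (measurableSet_Iic (a := r))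
      rw [Set.compl_Iic, h2 r hr, add_zero] at h4
      exact h4
    · have h4 : P.proj (Set.Iic r) x = 0 := by
        rw [← P.measure_eq_zero_iff _ measurableSet_Iic]
        exact measure_mono_null (Set.Iic_subset_Iio.2 hr) (hPA.measure_Iio_zero hg.nonneg x)
      rw [h4, map_zero, map_zero]
  induction S, hS using MeasurableSpace.induction_on_inter (borel_eq_generateFrom_Iic ℝ) isPiSystem_Iic with
  | empty => intro x; rw [P.proj_empty, P.proj_empty, map_zero]
  | basic t ht =>
    obtain ⟨r, rfl⟩ := ht
    intro x
    refine ext_inner_right ℂ fun y => ?_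
    have hm := measurableSet_Iic (a := r)
    rw [P.inner_proj_left _ _ hm, hG, ← h3 r y, ← P.inner_proj_left _ _ hm, ← hG,
      ← P.inner_proj_left _ _ hm, h3 r x]
  | compl t ht ih =>
    intro x
    have e1 := P.proj_add_proj_compl (G x) ht
    have e2 : G (P.proj t x) + G (P.proj tᶜ x) = G x := by
      rw [← map_add, P.proj_add_proj_compl x ht]
    rw [← ih x] at e2
    exact add_left_cancel (e1.trans e2.symm)
  | iUnion f hd hm ih =>
    intro x
    have e1 := P.iUnion f hm hd (G x)
    have e2 := (P.iUnion f hm hd x).mapL G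
    simp only [← ih] at e2
    exact e1.unique e2

end IsSpectralResolutionOf

end Unbounded

end VonNeumannAlgebra

end

/-! ### Commutation with W*(X) and subspaces invariant under it -/

noncomputable section

namespace VonNeumannAlgebra

section Unbounded

variable {E : Type*} [NormedAddCommGroup E] [InnerProductSpace ℂ E] [CompleteSpace E]

/-- A bounded self-adjoint operator that commutes with the operators in `𝒯` commutes with the von
Neumann algebra that they generate. -/
theorem commute_of_mem_generatedByUnbounded {𝒯 : Set (E →ₗ.[ℂ] E)} {G : E →L[ℂ] E}
    (hG : ∀ x y, ⟪G x, y⟫_ℂ = ⟪x, G y⟫_ℂ)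
    (hGT : ∀ T ∈ 𝒯, ∀ x y, (x, y) ∈ T.graph → (G x, G y) ∈ T.graph) {B : E →L[ℂ] E}
    (hB : B ∈ generatedByUnbounded 𝒯) : B * G = G * B := by
  have hGsa : star G = G := by
    rw [ContinuousLinearMap.star_eq_adjoint]
    refine ((ContinuousLinearMap.eq_adjoint_iff G G).2 hG).symm
  have hgen : ∀ C ∈ {B | ∃ T ∈ 𝒯, ∃ U A, IsPolarDecomposition T U A ∧
      (B = U ∨ ∃ P, IsSpectralResolutionOf P A ∧ ∃ S, MeasurableSet S ∧ B = P.proj S)},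
      C * G = G * C := by
    rintro C ⟨T, hT, U, A, hUA, hC⟩
    have hg := isPosSelfAdjointGraph hUA.selfAdjoint hUA.nonneg
    have hU : ∀ x y, (x, y) ∈ A.graph → ‖U y‖ = ‖y‖ := fun x y h => by
      obtain ⟨z, -, hz⟩ := (LinearPMap.mem_graph_iff _).1 h
      dsimp at hz
      rw [← hz]
      exact hUA.isometry z
    have hTA : ∀ x y, (x, y) ∈ A.graph → (x, U y) ∈ T.graph := fun x y h => by
      obtain ⟨z, hz1, hz⟩ := (LinearPMap.mem_graph_iff _).1 h
      dsimp at hz hz1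
      subst hz1 hz
      have hz' : (z : E) ∈ T.domain := by rw [hUA.domain_eq]; exact z.2
      rw [← hUA.apply_eq ⟨z, hz'⟩ z rfl]
      exact T.mem_graph ⟨z, hz'⟩
    have hGU : ∀ x y, (x, y) ∈ A.graph → ∃ y', (G x, y') ∈ A.graph ∧ U y' = G (U y) := by
      intro x y h
      have h1 := hGT T hT _ _ (hTA x y h)
      have h2 : G x ∈ A.domain := by
        rw [← hUA.domain_eq]; exact LinearPMap.mem_domain_of_mem_graph h1
      have h3 := A.mem_graph ⟨G x, h2⟩
      refine ⟨_, h3, ?_⟩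
      exact LinearPMap.mem_graph_snd_inj' _ (hTA _ _ h3) h1 rfl
    have hker : ∀ z, (∀ x y, (x, y) ∈ A.graph → ⟪y, z⟫_ℂ = 0) → U z = 0 := fun z hz =>
      hUA.ker z fun y => hz _ _ (A.mem_graph y)
    rcases hC with rfl | ⟨P, hPA, S, hS, rfl⟩
    · exact ContinuousLinearMap.ext fun z => hg.polar_commute hG hU hGU hker z
    · exact ContinuousLinearMap.ext
        (hPA.commute hg hUA.selfAdjoint.dense_domain hG (hg.map_mem hG hU hGU) hS)
  have hcent : G ∈ StarSubalgebra.centralizer ℂ {B | ∃ T ∈ 𝒯, ∃ U A, IsPolarDecomposition T U A ∧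
      (B = U ∨ ∃ P, IsSpectralResolutionOf P A ∧ ∃ S, MeasurableSet S ∧ B = P.proj S)} := by
    rw [StarSubalgebra.mem_centralizer_iff]
    refine fun C hC => ⟨hgen C hC, ?_⟩
    have := congrArg star (hgen C hC)
    rw [star_mul, star_mul, hGsa] at this
    exact this.symm
  have hB' : B ∈ StarSubalgebra.centralizer ℂ (StarSubalgebra.centralizer ℂ
    {B | ∃ T ∈ 𝒯, ∃ U A, IsPolarDecomposition T U A ∧ (B = U ∨ ∃ P, IsSpectralResolutionOf P A ∧
      ∃ S, MeasurableSet S ∧ B = P.proj S)} : Set (E →L[ℂ] E)) := hB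
  rw [StarSubalgebra.mem_centralizer_iff] at hB'
  exact (hB' G hcent).1.symm

end Unbounded

variable {H : Type*} [NormedAddCommGroup H] [InnerProductSpace ℂ H] [CompleteSpace H]

namespace Trace

variable {N M : VonNeumannAlgebra H} (τ : Trace N) {p : N}

theorem mem_graph_preLeftOp_iff (ξ u v : τ.L2Corner M p) :
    (u, v) ∈ (τ.preLeftOp ξ).graph ↔
      ∃ x ∈ corner M p, (u : τ.L2) = τ.hat x ∧ (v : τ.L2) = τ.rightMul x ξ := by
  rw [LinearPMap.mem_graph_iff]
  constructor
  · rintro ⟨⟨_, x, rfl⟩, h1, h2⟩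
    dsimp at h1 h2
    refine ⟨x, x.2, by rw [← h1]; rfl, ?_⟩
    rw [← h2]
    exact τ.preLeftOp_apply ξ x
  · rintro ⟨x, hx, h1, h2⟩
    refine ⟨⟨τ.cornerHat M p ⟨x, hx⟩, LinearMap.mem_range_self _ _⟩, Subtype.ext h1.symm,
      Subtype.ext ?_⟩
    exact (τ.preLeftOp_apply ξ ⟨x, hx⟩).trans h2.symm

theorem mem_closure_graph_iff (ξ u v : τ.L2Corner M p) :
    (u, v) ∈ (τ.preLeftOp ξ).graph.topologicalClosure ↔
      WithLp.toLp 2 ((u : τ.L2), (v : τ.L2)) ∈ τ.graphClosure M p ξ := by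
  let ι : τ.L2Corner M p × τ.L2Corner M p → WithLp 2 (τ.L2 × τ.L2) :=
    (WithLp.prodContinuousLinearEquiv 2 ℂ τ.L2 τ.L2).symm ∘ Prod.map Subtype.val Subtype.val
  have hι : Topology.IsInducing ι :=
    (WithLp.prodContinuousLinearEquiv 2 ℂ τ.L2 τ.L2).symm.toHomeomorph.isInducing.comp
      (Topology.IsInducing.subtypeVal.prodMap Topology.IsInducing.subtypeVal)
  have himg : ι '' ((τ.preLeftOp ξ).graph : Set _) =
      (LinearMap.range (τ.graphMap M p ξ) : Set (WithLp 2 (τ.L2 × τ.L2))) := by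
    ext w
    constructor
    · rintro ⟨⟨u, v⟩, h, rfl⟩
      obtain ⟨x, hx, h1, h2⟩ := (τ.mem_graph_preLeftOp_iff ξ u v).1 h
      exact ⟨⟨x, hx⟩, by
        change WithLp.toLp 2 (τ.hat x, τ.rightMul x ξ) = WithLp.toLp 2 ((u : τ.L2), (v : τ.L2))
        rw [h1, h2]⟩
    · rintro ⟨x, rfl⟩
      exact ⟨(⟨τ.hat x, τ.hat_mem_L2Corner x.2⟩, ⟨τ.rightMul x ξ, τ.rightMul_mem_L2Corner x.2 _ ξ.2⟩),
        (τ.mem_graph_preLeftOp_iff ξ _ _).2 ⟨x, x.2, rfl, rfl⟩, rfl⟩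
  have := hι.closure_eq_preimage_closure_image ((τ.preLeftOp ξ).graph : Set _)
  rw [himg] at this
  exact Set.ext_iff.1 this (u, v)

/-- `LinearPMap.closure` has the expected graph only for closable operators. Closability holds
because (0, v) in the closed graph makes v orthogonal to every b̂. -/
theorem mem_graph_leftOp_iff (ξ u v : τ.L2Corner M p) :
    (u, v) ∈ (τ.leftOp ξ).graph ↔
      WithLp.toLp 2 ((u : τ.L2), (v : τ.L2)) ∈ τ.graphClosure M p ξ := by
  rw [← mem_closure_graph_iff]
  have hcl : (τ.preLeftOp ξ).IsClosable := by
    refine ⟨(τ.preLeftOp ξ).graph.topologicalClosure.toLinearPMap,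
      (Submodule.toLinearPMap_graph_eq _ ?_).symm⟩
    rintro ⟨u, v⟩ h hu
    dsimp at hu
    subst hu
    have h1 := (τ.mem_closure_graph_iff ξ 0 v).1 h
    refine Subtype.ext (τ.denseRange_hat.eq_of_inner_left (𝕜 := ℂ) fun b => ?_)
    have h2 : ⟪(v : τ.L2), τ.hat b⟫_ℂ = ⟪(0 : τ.L2), τ.rightMul b (τ.conj ξ)⟫_ℂ :=
      τ.inner_snd_of_mem_graphClosure h1 b
    rw [h2, inner_zero_left]
    exact (inner_zero_left _).symm
  rw [hcl.graph_closure_eq_closure_graph]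
  rfl

/-- A bounded self-adjoint operator that weakly commutes with the operators `x ↦ ξ x`, `ξ ∈ X`,
commutes with `W*(X)`. -/
theorem commute_of_mem_affiliatedWStar (hMN : M ≤ N) (hp : IsStarProjection p)
    (hpM : (p : H →L[ℂ] H) ∈ M) {X : Set (τ.L2Corner M p)} {G : τ.L2 →L[ℂ] τ.L2}
    (hG : ∀ x y, ⟪G x, y⟫_ℂ = ⟪x, G y⟫_ℂ) (hGK : ∀ ξ ∈ τ.L2Corner M p, G ξ ∈ τ.L2Corner M p)
    (hGX : ∀ ξ ∈ X, ∀ a ∈ corner M p, ∀ b ∈ corner M p,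
      ⟪G (τ.rightMul a ξ), τ.hat b⟫_ℂ = ⟪G (τ.hat a), τ.rightMul b (τ.conj ξ)⟫_ℂ)
    {B : τ.L2Corner M p →L[ℂ] τ.L2Corner M p} (hB : B ∈ τ.affiliatedWStar X)
    (η : τ.L2Corner M p) : (B ⟨G η, hGK η η.2⟩ : τ.L2) = G (B η) := by
  have h := commute_of_mem_generatedByUnbounded (G := G.restrict hGK)
    (fun x y => hG x y) (by
      rintro _ ⟨ξ, hξ, rfl⟩ u v huv
      rw [mem_graph_leftOp_iff] at huv ⊢
      refine τ.graphClosure_induction (M := M) (p := p) (ξ := ξ)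
        (P := fun u v => WithLp.toLp 2 (G u, G v) ∈ τ.graphClosure M p ξ) ?_ (fun a ha => ?_) huv
      · refine (Submodule.isClosed_topologicalClosure _).preimage ?_
        exact (WithLp.prodContinuousLinearEquiv 2 ℂ τ.L2 τ.L2).symm.continuous.comp
          (f := fun v : τ.L2 × τ.L2 => (G v.1, G v.2)) (by fun_prop)
      · exact τ.mem_graphClosure_of_inner hMN hp hpM ξ.2 (hGK _ (τ.hat_mem_L2Corner ha))
          (hGK _ (τ.rightMul_mem_L2Corner ha _ ξ.2)) fun b hb => hGX ξ hξ a ha b hb) hB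
  exact congrArg Subtype.val (congrArg (fun C : τ.L2Corner M p →L[ℂ] τ.L2Corner M p => C η) h)

/-- `W*(X)` consists of left multiplications by elements of `pMp`. -/
theorem exists_leftRep_eq (hMN : M ≤ N) (hp : IsStarProjection p)
    (hpM : (p : H →L[ℂ] H) ∈ M) {X : Set (τ.L2Corner M p)}
    {B : τ.L2Corner M p →L[ℂ] τ.L2Corner M p} (hB : B ∈ τ.affiliatedWStar X) :
    ∃ x : corner M p, τ.leftRep M p x = B := by
  have hsa : ∀ y (hy : y ∈ corner M p), star y = y → ∀ η : τ.L2Corner M p,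
      (B ⟨τ.rightMul y η, τ.rightMul_mem_L2Corner hy η η.2⟩ : τ.L2) = τ.rightMul y (B η) := by
    intro y hy hys η
    refine τ.commute_of_mem_affiliatedWStar hMN hp hpM (G := τ.rightMul y)
      (fun u v => by rw [inner_rightMul_left, hys]) (τ.rightMul_mem_L2Corner hy) ?_ hB η
    intro ξ hξ a ha b hb
    rw [rightMul_rightMul, rightMul_hat, inner_rightMul_hat]
  have hall : ∀ y (hy : y ∈ corner M p), ∀ η : τ.L2Corner M p,
      (B ⟨τ.rightMul y η, τ.rightMul_mem_L2Corner hy η η.2⟩ : τ.L2) = τ.rightMul y (B η) := by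
    -- The commutation principle covers self-adjoint y; the general case uses the real and imaginary
    -- parts.
    intro y hy η
    have hy' := star_mem_corner hp hy
    let u : corner M p := ⟨y + star y, add_mem hy hy'⟩
    let v : corner M p := ⟨Complex.I • (y - star y), Submodule.smul_mem _ _ (sub_mem hy hy')⟩
    have h1 : B (τ.actOn η u) = τ.actOn (B η) u :=
      Subtype.ext (hsa _ u.2 (by rw [star_add, star_star, add_comm]) η)
    have h2 : B (τ.actOn η v) = τ.actOn (B η) v := Subtype.ext (hsa _ v.2 (by
      rw [star_smul, star_sub, star_star]
      simp [← smul_neg]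
      rfl) η)
    have hyd : (⟨y, hy⟩ : corner M p) = (1 / 2 : ℂ) • u - (Complex.I / 2) • v := by
      refine Subtype.ext ?_
      change y = (1 / 2 : ℂ) • (y + star y) - (Complex.I / 2) • (Complex.I • (y - star y))
      rw [smul_smul, show Complex.I / 2 * Complex.I = -(1 / 2) by
        linear_combination Complex.I_sq / 2, neg_smul, sub_neg_eq_add, ← smul_add]
      rw [add_add_sub_cancel, ← two_smul ℂ y, smul_smul]
      norm_num
    have h3 : B (τ.actOn η ⟨y, hy⟩) = τ.actOn (B η) ⟨y, hy⟩ := by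
      rw [hyd]
      simp only [map_sub, map_smul, h1, h2]
    exact congrArg Subtype.val h3
  obtain ⟨b, hb, -, h⟩ := τ.exists_leftMul_eq hMN hp hpM
    ((τ.L2Corner M p).subtypeL ∘L B ∘L (τ.L2Corner M p).orthogonalProjectionOnto)
    (fun ξ _ => Subtype.prop _) (fun y hy ξ hξ => by
      have h1 : (τ.L2Corner M p).orthogonalProjectionOnto ξ = ⟨ξ, hξ⟩ :=
        Submodule.orthogonalProjectionOnto_mem_subspace_eq_self ⟨ξ, hξ⟩
      have h2 : (τ.L2Corner M p).orthogonalProjectionOnto (τ.rightMul y ξ) =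
          ⟨τ.rightMul y ξ, τ.rightMul_mem_L2Corner hy ξ hξ⟩ :=
        Submodule.orthogonalProjectionOnto_mem_subspace_eq_self
          ⟨τ.rightMul y ξ, τ.rightMul_mem_L2Corner hy ξ hξ⟩
      change (B ((τ.L2Corner M p).orthogonalProjectionOnto (τ.rightMul y ξ)) : τ.L2) =
        τ.rightMul y (B ((τ.L2Corner M p).orthogonalProjectionOnto ξ))
      rw [h1, h2]
      exact hall y hy ⟨ξ, hξ⟩)
  refine ⟨⟨b, hb⟩, ContinuousLinearMap.ext fun ξ => Subtype.ext ?_⟩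
  have h1 := h ξ ξ.2
  change (B ((τ.L2Corner M p).orthogonalProjectionOnto ξ) : τ.L2) = _ at h1
  rw [Submodule.orthogonalProjectionOnto_mem_subspace_eq_self] at h1
  exact h1.symm

theorem starProjection_leftMul {V : Submodule ℂ τ.L2} [V.HasOrthogonalProjection] {a : N}
    (h1 : ∀ v ∈ V, τ.leftMul a v ∈ V) (h2 : ∀ v ∈ V, τ.leftMul (star a) v ∈ V) (v : τ.L2) :
    V.starProjection (τ.leftMul a v) = τ.leftMul a (V.starProjection v) := by
  refine Submodule.eq_starProjection_of_mem_of_inner_eq_zero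
    (h1 _ (Submodule.starProjection_apply_mem _ _)) fun w hw => ?_
  rw [← map_sub, inner_leftMul_left]
  exact Submodule.starProjection_inner_eq_zero _ _ (h2 w hw)

/-- A closed subspace of `L²(pMp)` that is invariant under the resolvents of the self-adjoint
vectors of `X` is invariant under `W*(X)`. -/
theorem mem_of_mem_affiliatedWStar (hMN : M ≤ N) (hp : IsStarProjection p)
    (hpM : (p : H →L[ℂ] H) ∈ M) {X : Set (τ.L2Corner M p)}
    (hX : ∀ ξ ∈ X, ∃ ξ₁ ∈ X, ∃ ξ₂ ∈ X, τ.conj ξ₁ = ξ₁ ∧ τ.conj ξ₂ = ξ₂ ∧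
      (ξ : τ.L2) = ξ₁ + Complex.I • (ξ₂ : τ.L2))
    {V : Submodule ℂ τ.L2} [CompleteSpace V] (hVK : V ≤ τ.L2Corner M p)
    (hV : ∀ ξ ∈ X, τ.conj ξ = ξ → ∃ R ∈ corner M p, τ.IsResolvent p ξ R ∧
      ∀ v ∈ V, τ.leftMul R v ∈ V ∧ τ.leftMul (star R) v ∈ V)
    {B : τ.L2Corner M p →L[ℂ] τ.L2Corner M p} (hB : B ∈ τ.affiliatedWStar X)
    (η : τ.L2Corner M p) (hη : (η : τ.L2) ∈ V) : (B η : τ.L2) ∈ V := by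
  -- The projection onto V commutes with R and R⋆. Substituting a = Rv with v = (ξ + i)a and moving
  -- R across transfers this to weak commutation with the unbounded ξ.
  have hsa : ∀ ξ ∈ X, τ.conj ξ = ξ → ∀ a ∈ corner M p, ∀ b ∈ corner M p,
      ⟪V.starProjection (τ.rightMul a ξ), τ.hat b⟫_ℂ =
        ⟪V.starProjection (τ.hat a), τ.rightMul b ξ⟫_ℂ := by
    intro ξ hξ hξsa a ha b hb
    obtain ⟨R, hR, hres, hinv⟩ := hV ξ hξ hξsa
    have hcomm := τ.starProjection_leftMul (fun v hv => (hinv v hv).1) (fun v hv => (hinv v hv).2)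
    obtain ⟨v, hv⟩ : ∃ v, v = τ.rightMul a ξ + Complex.I • τ.hat a := ⟨_, rfl⟩
    have hRv : τ.leftMul R v = τ.hat a := by
      have := congrArg (τ.rightMul a) hres.mul_left
      rw [map_add, map_smul, rightMul_leftMul, rightMul_hat, rightMul_hat, ha.2.1] at this
      rw [hv, map_add, map_smul, leftMul_hat, this]
    have h1 : τ.leftMul (star R) (τ.rightMul b ξ) = τ.hat b + Complex.I • τ.leftMul (star R) (τ.hat b) := by
      have := congrArg (τ.rightMul b) hres.star_mul_left
      rw [map_sub, map_smul, rightMul_leftMul, rightMul_hat, rightMul_hat, hb.2.1,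
        sub_eq_iff_eq_add] at this
      rw [this, leftMul_hat]
    have h2 : ⟪V.starProjection (τ.hat a), τ.rightMul b ξ⟫_ℂ =
        ⟪V.starProjection v, τ.hat b⟫_ℂ + Complex.I * ⟪V.starProjection (τ.hat a), τ.hat b⟫_ℂ := by
      have h4 : V.starProjection (τ.hat a) = τ.leftMul R (V.starProjection v) := by
        rw [← hRv, hcomm]
      have h5 : ⟪V.starProjection (τ.hat a), τ.hat b⟫_ℂ =
          ⟪V.starProjection v, τ.leftMul (star R) (τ.hat b)⟫_ℂ := by
        rw [h4, inner_leftMul_left]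
      rw [h5, h4, inner_leftMul_left, h1, inner_add_right, inner_smul_right]
    rw [h2, hv, map_add, map_smul, inner_add_left, inner_smul_left, Complex.conj_I]
    ring
  have h := τ.commute_of_mem_affiliatedWStar hMN hp hpM (G := V.starProjection)
    (fun x y => V.inner_starProjection_left_eq_right x y)
    (fun ξ _ => hVK (Submodule.starProjection_apply_mem _ _)) (fun ξ hξ a ha b hb => by
      obtain ⟨ξ₁, hξ₁, ξ₂, hξ₂, h1, h2, h3⟩ := hX ξ hξ
      have e1 := hsa ξ₁ hξ₁ h1 a ha b hb
      have e2 := hsa ξ₂ hξ₂ h2 a ha b hb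
      rw [h3]
      simp only [map_add, map_smul, ContinuousLinearMap.map_smulₛₗ, h1, h2, inner_add_left,
        inner_add_right, inner_smul_left, inner_smul_right, Complex.conj_I, e1, e2]) hB η
  have hη' : V.starProjection (η : τ.L2) = η := Submodule.starProjection_eq_self_iff.2 hη
  simp only [hη'] at h
  rw [← Submodule.starProjection_eq_self_iff, ← h]

end Trace

end VonNeumannAlgebra

end

/-! ### Singular vectors, relative commutants and intertwiners -/

noncomputable section

namespace VonNeumannAlgebra

variable {H : Type*} [NormedAddCommGroup H] [InnerProductSpace ℂ H] [CompleteSpace H]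

/-! ### Relative commutants and intertwiners -/

section Intertwiner

variable {N : VonNeumannAlgebra H} {p : N} {Q : NonUnitalStarSubalgebra ℂ N}

/-- `c ∈ pNp` commutes with `Q`. -/
structure IsRelComm (Q : NonUnitalStarSubalgebra ℂ N) (p c : N) : Prop where
  left : p * c = c
  right : c * p = c
  comm : ∀ q ∈ Q, c * q = q * c

/-- `x` intertwines the inclusion of `Q` and `φ`. -/
structure IsIntertwiner (Q : NonUnitalStarSubalgebra ℂ N) (p : N) (φ : N ≃⋆ₐ[ℂ] N) (x : N) :
    Prop where
  right : x * p = x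
  comm : ∀ q ∈ Q, φ q * x = x * q

theorem IsIntertwiner.star_mul_map {φ : N ≃⋆ₐ[ℂ] N} {x : N} (hx : IsIntertwiner Q p φ x) {q : N}
    (hq : q ∈ Q) : star x * φ q = q * star x := by
  have := congrArg star (hx.comm _ (star_mem hq))
  rwa [star_mul, star_mul, map_star, star_star, star_star] at this

theorem IsIntertwiner.mul_star_left {φ : N ≃⋆ₐ[ℂ] N} {x : N} (hp : IsStarProjection p)
    (hx : IsIntertwiner Q p φ x) : p * star x = star x := by
  have := congrArg star hx.right
  rwa [star_mul, hp.isSelfAdjoint.star_eq] at this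

theorem IsIntertwiner.isRelComm_star_mul {φ : N ≃⋆ₐ[ℂ] N} {x y : N} (hp : IsStarProjection p)
    (hx : IsIntertwiner Q p φ x) (hy : IsIntertwiner Q p φ y) : IsRelComm Q p (star x * y) where
  left := by rw [← mul_assoc, hx.mul_star_left hp]
  right := by rw [mul_assoc, hy.right]
  comm q hq := by rw [mul_assoc, ← hy.comm q hq, ← mul_assoc, hx.star_mul_map hq, mul_assoc]

/-- The product xx⋆ commutes with φ(Q); pulling back by φ gives an element commuting with Q. -/
theorem IsIntertwiner.isRelComm_symm {φ : N ≃⋆ₐ[ℂ] N} {x c : N} (hpQ : p ∈ Q)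
    (hx : IsIntertwiner Q p φ x) (hc : φ c = x * star x) : IsRelComm Q p c where
  left := EquivLike.injective φ (by rw [map_mul, hc, ← mul_assoc, hx.comm p hpQ, hx.right])
  right := EquivLike.injective φ (by
    rw [map_mul, hc, mul_assoc, hx.star_mul_map hpQ, ← mul_assoc, hx.right])
  comm q hq := EquivLike.injective φ (by
    rw [map_mul, map_mul, hc, mul_assoc, hx.star_mul_map hq, ← mul_assoc, ← hx.comm q hq,
      mul_assoc])

theorem IsRelComm.star {c : N} (hp : IsStarProjection p) (hc : IsRelComm Q p c) :
    IsRelComm Q p (star c) where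
  left := by have := congrArg Star.star hc.right; rwa [star_mul, hp.isSelfAdjoint.star_eq] at this
  right := by have := congrArg Star.star hc.left; rwa [star_mul, hp.isSelfAdjoint.star_eq] at this
  comm q hq := by
    have := congrArg Star.star (hc.comm _ (star_mem hq))
    rw [star_mul, star_mul, star_star] at this
    exact this.symm

theorem isRelComm_self {M : VonNeumannAlgebra H} (hp : IsStarProjection p)
    (hQ : ∀ q ∈ Q, q ∈ corner M p) : IsRelComm Q p p where
  left := hp.isIdempotentElem.eq
  right := hp.isIdempotentElem.eq
  comm q hq := by rw [(hQ q hq).2.1, (hQ q hq).2.2]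

theorem IsRelComm.mem_corner {c : N} (hc : IsRelComm Q p c) : c ∈ corner N p :=
  ⟨c.2, hc.left, hc.right⟩

end Intertwiner

namespace Trace

variable {N M : VonNeumannAlgebra H} (τ : Trace N) {p : N} {Q : NonUnitalStarSubalgebra ℂ N}

theorem L2Corner_mono : τ.L2Corner M p ≤ τ.L2Corner N p :=
  Submodule.topologicalClosure_mono (Submodule.map_mono fun _ hx => corner_mono hx)

theorem starProjection_leftMul_rightMul {V : Submodule ℂ τ.L2} [V.HasOrthogonalProjection] {a b : N}
    (h1 : ∀ v ∈ V, τ.leftMul a (τ.rightMul b v) ∈ V)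
    (h2 : ∀ v ∈ V, τ.leftMul (star a) (τ.rightMul (star b) v) ∈ V) (v : τ.L2) :
    V.starProjection (τ.leftMul a (τ.rightMul b v)) =
      τ.leftMul a (τ.rightMul b (V.starProjection v)) := by
  refine Submodule.eq_starProjection_of_mem_of_inner_eq_zero
    (h1 _ (Submodule.starProjection_apply_mem _ _)) fun w hw => ?_
  rw [← map_sub, ← map_sub, inner_leftMul_left, inner_rightMul_left, rightMul_leftMul]
  exact Submodule.starProjection_inner_eq_zero _ _ (h2 w hw)

/-- A bounded operator on `L²(N, τ)` whose restriction to `K` is `Q`-`Q` bimodular. -/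
def IsBimodularOn (Q : Set N) (K : Submodule ℂ τ.L2) (S : τ.L2 →L[ℂ] τ.L2) : Prop :=
  ∀ a ∈ Q, ∀ b ∈ Q, ∀ ξ ∈ K, S (τ.leftMul a (τ.rightMul b ξ)) = τ.leftMul a (τ.rightMul b (S ξ))

/-- Extending by the projection onto L²(pMp) lets singularity be tested on operators of the whole
L²(N, τ), which compose freely with the actions and J. -/
theorem mem_singularVectors_iff {M : VonNeumannAlgebra H} (hQ : ∀ q ∈ Q, q ∈ corner M p)
    {L : Submodule ℂ τ.L2} (ξ : τ.L2Corner M p) :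
    ξ ∈ τ.singularVectors Q (τ.L2Corner M p) L ↔
      ∀ S : τ.L2 →L[ℂ] τ.L2, (∀ η ∈ τ.L2Corner M p, S η ∈ L) →
        τ.IsBimodularOn Q (τ.L2Corner M p) S → S ξ = 0 := by
  constructor
  · intro h S hS hb
    have := h ((S ∘L (τ.L2Corner M p).subtypeL).codRestrict L fun η => hS η η.2)
      (fun a ha b hb' ζ ζ' hζ => by
        change S ζ' = τ.leftMul a (τ.rightMul b (S ζ))
        rw [hζ, hb a ha b hb' ζ ζ.2])
    exact congrArg Subtype.val this
  · intro h T hT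
    refine Subtype.ext ?_
    have hP : ∀ η (hη : η ∈ τ.L2Corner M p),
        (τ.L2Corner M p).orthogonalProjectionOnto η = ⟨η, hη⟩ := fun η hη =>
      Submodule.orthogonalProjectionOnto_mem_subspace_eq_self ⟨η, hη⟩
    have := h (L.subtypeL ∘L T ∘L (τ.L2Corner M p).orthogonalProjectionOnto)
      (fun η _ => Subtype.prop _) (fun a ha b hb η hη => by
        have hη' := τ.leftMul_mem_L2Corner (hQ a ha) _ (τ.rightMul_mem_L2Corner (hQ b hb) _ hη)
        change (T ((τ.L2Corner M p).orthogonalProjectionOnto _) : τ.L2) =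
          τ.leftMul a (τ.rightMul b (T ((τ.L2Corner M p).orthogonalProjectionOnto η)))
        rw [hP _ hη', hP _ hη]
        exact hT a ha b hb _ _ rfl)
    change (T ((τ.L2Corner M p).orthogonalProjectionOnto ξ) : τ.L2) = 0 at this
    rwa [hP ξ ξ.2] at this

/-- The subspace of singular vectors of `L²(pMp)`, as a subspace of `L²(N, τ)`. -/
def singularSubspace (M : VonNeumannAlgebra H) (p : N) (Q : Set N) : Submodule ℂ τ.L2 where
  carrier := {ξ | ξ ∈ τ.L2Corner M p ∧ ∀ S : τ.L2 →L[ℂ] τ.L2,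
    (∀ η ∈ τ.L2Corner M p, S η ∈ τ.L2Ortho M p) → τ.IsBimodularOn Q (τ.L2Corner M p) S → S ξ = 0}
  add_mem' := by
    rintro ξ η ⟨h1, h2⟩ ⟨h3, h4⟩
    exact ⟨add_mem h1 h3, fun S hS hb => by rw [map_add, h2 S hS hb, h4 S hS hb, add_zero]⟩
  zero_mem' := ⟨zero_mem _, fun S _ _ => map_zero S⟩
  smul_mem' := by
    rintro c ξ ⟨h1, h2⟩
    exact ⟨Submodule.smul_mem _ _ h1, fun S hS hb => by rw [map_smul, h2 S hS hb, smul_zero]⟩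

theorem mem_singularVectors_iff_mem_singularSubspace {M : VonNeumannAlgebra H}
    (hQ : ∀ q ∈ Q, q ∈ corner M p) (ξ : τ.L2Corner M p) :
    ξ ∈ τ.singularVectors Q (τ.L2Corner M p) (τ.L2Ortho M p) ↔
      (ξ : τ.L2) ∈ τ.singularSubspace M p Q :=
  (τ.mem_singularVectors_iff hQ ξ).trans ⟨fun h => ⟨ξ.2, h⟩, fun h => h.2⟩

variable {τ}

/-- Bounded bimodular maps from `L²(pMp)` to `L²(pNp)` preserve singular vectors. -/
theorem map_mem_singularSubspace (hQ : ∀ q ∈ Q, q ∈ corner M p)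
    {S : τ.L2 →L[ℂ] τ.L2} (hS : ∀ η ∈ τ.L2Corner M p, S η ∈ τ.L2Corner N p)
    (hb : τ.IsBimodularOn Q (τ.L2Corner M p) S) {ξ : τ.L2}
    (hξ : ξ ∈ τ.singularSubspace M p Q) : S ξ ∈ τ.singularSubspace M p Q := by
  set K := τ.L2Corner M p with hK
  have hmem : ∀ a ∈ Q, ∀ b ∈ Q, ∀ v ∈ K, τ.leftMul a (τ.rightMul b v) ∈ K := fun a ha b hb v hv =>
    τ.leftMul_mem_L2Corner (hQ a ha) _ (τ.rightMul_mem_L2Corner (hQ b hb) _ hv)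
  have hP : ∀ a ∈ Q, ∀ b ∈ Q, ∀ v, K.starProjection (τ.leftMul a (τ.rightMul b v)) =
      τ.leftMul a (τ.rightMul b (K.starProjection v)) := fun a ha b hb =>
    τ.starProjection_leftMul_rightMul (hmem a ha b hb) (hmem _ (star_mem ha) _ (star_mem hb))
  -- The part of S with values in the orthogonal complement of L²(pMp) is bimodular, so it kills ξ
  -- and Sξ lies in L²(pMp). Singularity of Sξ then follows by testing ξ against T P S, with P the
  -- projection onto L²(pMp).
  have h1 := hξ.2 (S - K.starProjection ∘L S) (fun η hη => by
      refine ⟨sub_mem (hS η hη) (τ.L2Corner_mono (Submodule.starProjection_apply_mem _ _)), ?_⟩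
      exact Submodule.sub_starProjection_mem_orthogonal _) (fun a ha b hb' η hη => by
      change S (τ.leftMul a (τ.rightMul b η)) - K.starProjection (S (τ.leftMul a (τ.rightMul b η))) =
        τ.leftMul a (τ.rightMul b (S η - K.starProjection (S η)))
      rw [hb a ha b hb' η hη, hP a ha b hb', map_sub, map_sub])
  have h2 : K.starProjection (S ξ) = S ξ := (sub_eq_zero.1 h1).symm
  refine ⟨Submodule.starProjection_eq_self_iff.1 h2, fun T hT hTb => ?_⟩
  have h3 := hξ.2 (T ∘L K.starProjection ∘L S)
    (fun η _ => hT _ (Submodule.starProjection_apply_mem _ _)) (fun a ha b hb' η hη => by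
      change T (K.starProjection (S (τ.leftMul a (τ.rightMul b η)))) =
        τ.leftMul a (τ.rightMul b (T (K.starProjection (S η))))
      rw [hb a ha b hb' η hη, hP a ha b hb',
        hTb a ha b hb' _ (Submodule.starProjection_apply_mem _ _)])
  change T (K.starProjection (S ξ)) = 0 at h3
  rwa [h2] at h3

/-- Multiplication by c is bimodular into L²(pNp). The point is that c need not lie in M, and still
cξ stays in L²(pMp). -/
theorem leftMul_mem_singularSubspace (hQ : ∀ q ∈ Q, q ∈ corner M p)
    {c : N} (hc : IsRelComm Q p c) {ξ : τ.L2} (hξ : ξ ∈ τ.singularSubspace M p Q) :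
    τ.leftMul c ξ ∈ τ.singularSubspace M p Q :=
  map_mem_singularSubspace hQ
    (fun η hη => τ.leftMul_mem_L2Corner hc.mem_corner _ (τ.L2Corner_mono hη))
    (fun a ha b _ η _ => by simp only [leftMul_leftMul, rightMul_leftMul, hc.comm a ha]) hξ

theorem rightMul_mem_singularSubspace (hQ : ∀ q ∈ Q, q ∈ corner M p)
    {c : N} (hc : IsRelComm Q p c) {ξ : τ.L2} (hξ : ξ ∈ τ.singularSubspace M p Q) :
    τ.rightMul c ξ ∈ τ.singularSubspace M p Q :=
  map_mem_singularSubspace hQ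
    (fun η hη => τ.rightMul_mem_L2Corner hc.mem_corner _ (τ.L2Corner_mono hη))
    (fun a _ b hb η _ => by simp only [rightMul_rightMul, rightMul_leftMul, hc.comm b hb]) hξ

/-- The intertwining relations make ξ ↦ x⋆φ(ξ)y bimodular over Q, with values in L²(pNp). -/
theorem intertwine_mem_singularSubspace (hp : IsStarProjection p) (hQ : ∀ q ∈ Q, q ∈ corner M p)
    {φ : N ≃⋆ₐ[ℂ] N} (hφ : ∀ x, τ.toPLM (φ x) = τ.toPLM x) {x y : N}
    (hx : IsIntertwiner Q p φ x) (hy : IsIntertwiner Q p φ y) {ξ : τ.L2}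
    (hξ : ξ ∈ τ.singularSubspace M p Q) :
    τ.leftMul (star x) (τ.rightMul y (τ.autL2 φ ξ)) ∈ τ.singularSubspace M p Q := by
  refine map_mem_singularSubspace (S := τ.leftMul (star x) ∘L τ.rightMul y ∘L τ.autL2 φ) hQ
    (fun η hη => ?_) (fun a ha b hb η _ => ?_) hξ
  · refine τ.L2Corner_induction (P := fun η => τ.leftMul (star x) (τ.rightMul y (τ.autL2 φ η)) ∈
      τ.L2Corner N p) ?_ (fun m _ => ?_) hη
    · exact (Submodule.isClosed_topologicalClosure _).preimage (by fun_prop)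
    · rw [autL2_hat τ hφ, rightMul_hat, leftMul_hat]
      refine τ.hat_mem_L2Corner ⟨Subtype.prop _, ?_, ?_⟩
      · rw [← mul_assoc, hx.mul_star_left hp]
      · rw [mul_assoc, mul_assoc, hy.right]
  · change τ.leftMul (star x) (τ.rightMul y (τ.autL2 φ (τ.leftMul a (τ.rightMul b η)))) =
      τ.leftMul a (τ.rightMul b (τ.leftMul (star x) (τ.rightMul y (τ.autL2 φ η))))
    simp only [autL2_leftMul τ hφ, autL2_rightMul τ hφ, leftMul_leftMul, rightMul_leftMul,
      rightMul_rightMul, hx.star_mul_map ha, hy.comm b hb]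

/-- Conjugating a test operator by J exchanges the left and right actions, so it stays bimodular,
and J preserves L²(pMp) and its complement. -/
theorem conj_mem_singularSubspace (hp : IsStarProjection p)
    {ξ : τ.L2} (hξ : ξ ∈ τ.singularSubspace M p Q) : τ.conj ξ ∈ τ.singularSubspace M p Q := by
  refine ⟨τ.conj_mem_L2Corner hp hξ.1, fun S hS hb => ?_⟩
  have h := hξ.2 (τ.conj.comp (S.comp τ.conj)) (fun η hη => ?_) (fun a ha b hb' η hη => ?_)
  · have := congrArg τ.conj h
    change τ.conj (τ.conj (S (τ.conj ξ))) = τ.conj 0 at this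
    rwa [conj_conj, map_zero] at this
  · have h1 := hS _ (τ.conj_mem_L2Corner hp hη)
    refine ⟨τ.conj_mem_L2Corner hp h1.1, fun k hk => ?_⟩
    change ⟪k, τ.conj (S (τ.conj η))⟫_ℂ = 0
    rw [← τ.conj_conj k, inner_conj_conj]
    exact Submodule.inner_left_of_mem_orthogonal (τ.conj_mem_L2Corner hp hk) h1.2
  · change τ.conj (S (τ.conj (τ.leftMul a (τ.rightMul b η)))) =
      τ.leftMul a (τ.rightMul b (τ.conj (S (τ.conj η))))
    rw [conj_leftMul, conj_rightMul, rightMul_leftMul,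
      hb _ (star_mem hb') _ (star_mem ha) _ (τ.conj_mem_L2Corner hp hη), conj_leftMul, conj_rightMul,
      star_star, star_star, rightMul_leftMul]

theorem exists_selfAdjoint_decomposition (hp : IsStarProjection p)
    {ξ : τ.L2} (hξ : ξ ∈ τ.singularSubspace M p Q) :
    ∃ ξ₁ ∈ τ.singularSubspace M p Q, ∃ ξ₂ ∈ τ.singularSubspace M p Q,
      τ.conj ξ₁ = ξ₁ ∧ τ.conj ξ₂ = ξ₂ ∧ ξ = ξ₁ + Complex.I • ξ₂ := by
  have hξ' := conj_mem_singularSubspace hp hξ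
  refine ⟨(1 / 2 : ℂ) • (ξ + τ.conj ξ), Submodule.smul_mem _ _ (add_mem hξ hξ'),
    (Complex.I / 2) • (τ.conj ξ - ξ), Submodule.smul_mem _ _ (sub_mem hξ' hξ), ?_, ?_, ?_⟩
  · rw [ContinuousLinearMap.map_smulₛₗ, map_add, conj_conj, add_comm]
    simp [Complex.conj_ofNat]
  · rw [ContinuousLinearMap.map_smulₛₗ, map_sub, conj_conj, ← neg_sub, smul_neg, ← neg_smul]
    simp [neg_div, Complex.conj_ofNat]
  · rw [smul_smul, show Complex.I * (Complex.I / 2) = -(1 / 2) by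
      linear_combination Complex.I_sq / 2]
    module

end Trace

end VonNeumannAlgebra

end

/-! ### Unitaries of Q and intertwiners of minimal norm -/

noncomputable section

namespace VonNeumannAlgebra

/-- A closed convex set in a Hilbert space has a unique element of minimal norm. -/
theorem exists_forall_norm_le_imp_eq {E : Type*} [NormedAddCommGroup E] [InnerProductSpace ℂ E]
    [CompleteSpace E] {C : Set E} (hne : C.Nonempty) (hcl : IsClosed C) (hC : Convex ℝ C) :
    ∃ v ∈ C, ∀ w ∈ C, ‖w‖ ≤ ‖v‖ → w = v := by
  let _ := InnerProductSpace.rclikeToReal ℂ E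
  obtain ⟨v, hv, hmin⟩ := exists_norm_eq_iInf_of_complete_convex hne hcl.isComplete hC 0
  refine ⟨v, hv, fun w hw hwv => ?_⟩
  have h1 := (norm_eq_iInf_iff_real_inner_le_zero hC hv).1 hmin w hw
  have h2 := norm_sub_sq_real w v
  rw [zero_sub, inner_neg_left, inner_sub_right, real_inner_self_eq_norm_sq] at h1
  rw [real_inner_comm] at h2
  have h3 : ‖w - v‖ ^ 2 ≤ 0 := by
    have := mul_self_le_mul_self (norm_nonneg w) hwv
    nlinarith
  have h4 : ‖w - v‖ = 0 := by
    have := norm_nonneg (w - v)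
    nlinarith
  exact sub_eq_zero.1 (norm_eq_zero.1 h4)

variable {H : Type*} [NormedAddCommGroup H] [InnerProductSpace ℂ H] [CompleteSpace H]

variable {N M : VonNeumannAlgebra H} {p : N} {Q : NonUnitalStarSubalgebra ℂ N}

/-- The inclusion of a von Neumann algebra in `B(H)` as a star homomorphism. -/
def subtypeHom (N : VonNeumannAlgebra H) : N →⋆ₐ[ℂ] (H →L[ℂ] H) := N.toStarSubalgebra.subtype

theorem coe_cfc {x : N} (hx : IsSelfAdjoint x) {f : ℝ → ℝ} (hf : Continuous f) :
    ((cfc f x : N) : H →L[ℂ] H) = cfc f (x : H →L[ℂ] H) :=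
  StarAlgHomClass.map_cfc (S := ℂ) (subtypeHom N) f x hf.continuousOn continuous_subtype_val hx
    (congrArg (fun y : N => (y : H →L[ℂ] H)) hx.star_eq)

/-- A self-adjoint contraction `a` of `Q` is the real part of a unitary of `Q`. -/
theorem IsCornerSubalgebra.exists_unitary_of_selfAdjoint (hp : IsStarProjection p)
    (hQ : IsCornerSubalgebra M p Q) {a : N} (ha : a ∈ Q) (hsa : IsSelfAdjoint a) (h1 : ‖a‖ ≤ 1) :
    ∃ u ∈ Q, star u * u = p ∧ u * star u = p ∧ a = (1 / 2 : ℂ) • (u + star u) := by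
  have hac := hQ.le_corner a ha
  -- The unitary is u = a + i√(1 − a²)p; the factor p is needed because the unit of Q is p. The
  -- bicommutant condition puts the square root back in Q.
  obtain ⟨f, hf⟩ : ∃ f : ℝ → ℝ, f = fun s => √(1 - s ^ 2) := ⟨_, rfl⟩
  have hfc : Continuous f := by rw [hf]; fun_prop
  obtain ⟨g, hg⟩ : ∃ g : N, g = cfc f a := ⟨_, rfl⟩
  have hgsa : star g = g := by rw [hg]; exact (cfc_predicate f a).star_eq
  have hap : Commute a p := hac.2.2.trans hac.2.1.symm
  have hgp : g * p = p * g := by rw [hg]; exact hsa.commute_cfc hap f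
  have hga : g * a = a * g := by rw [hg]; exact hsa.commute_cfc (Commute.refl a) f
  have hgg : g * g = 1 - a * a := by
    have e1 : cfc (fun s : ℝ => s) a = a := cfc_id' ℝ a
    have e2 : a * a = cfc (fun s : ℝ => s * s) a := by
      rw [cfc_mul (fun s : ℝ => s) (fun s => s) a continuousOn_id continuousOn_id, e1]
    have e3 : (1 : N) = cfc (fun _ : ℝ => (1 : ℝ)) a := (cfc_const_one ℝ a).symm
    rw [hg, ← cfc_mul f f a hfc.continuousOn hfc.continuousOn, e2, e3,
      ← cfc_sub (fun _ => (1 : ℝ)) (fun s => s * s) a continuousOn_const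
        (continuous_id.mul continuous_id).continuousOn]
    refine cfc_congr fun s hs => ?_
    have h2 : ‖s‖ ≤ ‖cfc (fun s : ℝ => s) a‖ := norm_apply_le_norm_cfc (fun s : ℝ => s) a hs
    rw [e1, Real.norm_eq_abs] at h2
    have h3 := abs_le.1 (h2.trans h1)
    rw [hf]
    dsimp only
    rw [Real.mul_self_sqrt (by nlinarith)]
    ring
  have hpp : p * p = p := hp.isIdempotentElem.eq
  have hps : star p = p := hp.isSelfAdjoint.star_eq
  obtain ⟨d, hd⟩ : ∃ d : N, d = g * p := ⟨_, rfl⟩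
  have hds : star d = d := by rw [hd, star_mul, hgsa, hps, hgp]
  have hda : d * a = a * d := by rw [hd, mul_assoc, hac.2.1, hga, ← mul_assoc, ← hga, mul_assoc,
    hac.2.2]
  have hdd : a * a + d * d = p := by
    have e1 : d * d = g * g * p := by
      rw [hd]
      nth_rewrite 2 [hgp]
      rw [mul_assoc, ← mul_assoc p p g, hpp, ← hgp, mul_assoc]
    rw [e1, hgg, sub_mul, one_mul, mul_assoc, hac.2.2]
    abel
  have hdc : d ∈ corner N p := ⟨d.2, by rw [hd, ← mul_assoc, ← hgp, mul_assoc, hpp],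
    by rw [hd, mul_assoc, hpp]⟩
  have hdQ : d ∈ Q := by
    refine hQ.bicommutant d hdc fun y hy => ?_
    have h2 : (a : H →L[ℂ] H) * y = y * a := hy _ ⟨a, ha, rfl⟩
    have h3 : (p : H →L[ℂ] H) * y = y * p := hy _ ⟨p, hQ.unit_mem, rfl⟩
    have hsa' : IsSelfAdjoint (a : H →L[ℂ] H) := congrArg (fun y : N => (y : H →L[ℂ] H)) hsa.star_eq
    have h4 : (g : H →L[ℂ] H) * y = y * g := by
      rw [hg, coe_cfc hsa hfc]
      exact hsa'.commute_cfc h2 f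
    have h5 : (d : H →L[ℂ] H) = g * p := by rw [hd]; rfl
    rw [h5, mul_assoc, h3, ← mul_assoc, ← mul_assoc, h4]
  have hstar : star (a + Complex.I • d) = a - Complex.I • d := by
    rw [star_add, star_smul, hsa.star_eq, hds, Complex.star_def, Complex.conj_I, neg_smul,
      sub_eq_add_neg]
  refine ⟨a + Complex.I • d, add_mem ha (SMulMemClass.smul_mem _ hdQ), ?_, ?_, ?_⟩
  · rw [hstar, sub_mul, mul_add, mul_add, smul_mul_smul_comm, Complex.I_mul_I, mul_smul_comm,
      smul_mul_assoc, hda, ← hdd, neg_one_smul]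
    abel
  · rw [hstar, mul_sub, add_mul, add_mul, smul_mul_smul_comm, Complex.I_mul_I, mul_smul_comm,
      smul_mul_assoc, hda, ← hdd, neg_one_smul]
    abel
  · rw [hstar]
    module

/-- The unitaries of `Q` span `Q`. -/
theorem IsCornerSubalgebra.unitary_induction (hp : IsStarProjection p)
    (hQ : IsCornerSubalgebra M p Q) {S : Submodule ℂ N}
    (hS : ∀ u ∈ Q, star u * u = p → u * star u = p → u ∈ S) {q : N} (hq : q ∈ Q) : q ∈ S := by
  have hsa : ∀ a ∈ Q, IsSelfAdjoint a → a ∈ S := by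
    intro a ha hsa
    obtain ⟨r, hr⟩ : ∃ r : ℝ, r = ‖a‖ + 1 := ⟨_, rfl⟩
    have hr0 : 0 < r := by rw [hr]; positivity
    obtain ⟨u, hu, hu1, hu2, hau⟩ := hQ.exists_unitary_of_selfAdjoint hp
      (a := ((r⁻¹ : ℝ) : ℂ) • a) (SMulMemClass.smul_mem _ ha)
      (by rw [IsSelfAdjoint, star_smul, hsa.star_eq, Complex.star_def, Complex.conj_ofReal])
      (by
        rw [norm_smul, Complex.norm_real, Real.norm_of_nonneg (by positivity), inv_mul_le_one₀ hr0]
        linarith)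
    have hmem : ((r⁻¹ : ℝ) : ℂ) • a ∈ S := by
      rw [hau]
      exact S.smul_mem _ (add_mem (hS u hu hu1 hu2) (hS _ (star_mem hu) (by rwa [star_star])
        (by rwa [star_star])))
    have := S.smul_mem (r : ℂ) hmem
    rwa [smul_smul, ← Complex.ofReal_mul, mul_inv_cancel₀ hr0.ne', Complex.ofReal_one,
      one_smul] at this
  have hq' := star_mem hq
  have h1 := hsa (q + star q) (add_mem hq hq') (by rw [IsSelfAdjoint, star_add, star_star, add_comm])
  have h2 := hsa (Complex.I • (star q - q)) (SMulMemClass.smul_mem _ (sub_mem hq' hq)) (by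
    rw [IsSelfAdjoint, star_smul, star_sub, star_star, Complex.star_def, Complex.conj_I, neg_smul,
      ← smul_neg, neg_sub])
  have h3 : q = (1 / 2 : ℂ) • (q + star q) + (Complex.I / 2) • (Complex.I • (star q - q)) := by
    rw [smul_smul, show Complex.I / 2 * Complex.I = -(1 / 2) by
      linear_combination Complex.I_sq / 2]
    module
  rw [h3]
  exact add_mem (S.smul_mem _ h1) (S.smul_mem _ h2)

theorem norm_le_one_of_star_mul_self_eq (hp : IsStarProjection p) {u : N} (hu : star u * u = p) :
    ‖u‖ ≤ 1 := by
  have h1 : ‖p‖ * ‖p‖ = ‖p‖ := by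
    rw [← CStarRing.norm_star_mul_self, hp.isSelfAdjoint.star_eq, hp.isIdempotentElem.eq]
  have h2 : ‖u‖ * ‖u‖ = ‖p‖ := by rw [← CStarRing.norm_star_mul_self, hu]
  have h3 : ‖p‖ ≤ 1 := by nlinarith [norm_nonneg p]
  nlinarith [norm_nonneg u]

/-- If `φ` is uniformly close to the identity on the unit ball of `Q`, there is an intertwiner
close to the unit of `Q`. -/
theorem IsCornerSubalgebra.exists_isIntertwiner (hp : IsStarProjection p)
    (hQ : IsCornerSubalgebra M p Q) (τ : Trace N) (φ : N ≃⋆ₐ[ℂ] N) {δ : ℝ}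
    (hδ : ∀ q ∈ Q, ‖q‖ ≤ 1 → τ.norm2 (φ q - q) ≤ δ) :
    ∃ x, IsIntertwiner Q p φ x ∧ ‖x‖ ≤ 1 ∧ τ.norm2 (x - p) ≤ δ := by
  have hps : star p = p := hp.isSelfAdjoint.star_eq
  have hpp : p * p = p := hp.isIdempotentElem.eq
  obtain ⟨S, hS⟩ : ∃ S : Set τ.L2, S = {ζ | ∃ u ∈ Q, star u * u = p ∧ u * star u = p ∧
    ζ = τ.hat (φ u * star u)} := ⟨_, rfl⟩
  have hnorm : ∀ u : N, star u * u = p → ‖φ u‖ ≤ 1 := fun u hu =>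
    (NonUnitalStarAlgHom.norm_apply_le φ u).trans (norm_le_one_of_star_mul_self_eq hp hu)
  have hpS : τ.hat (φ p * star p) ∈ S := by
    rw [hS]; exact ⟨p, hQ.unit_mem, by rw [hps, hpp], by rw [hps, hpp], rfl⟩
  -- The vector of minimal norm in the closed convex hull of the φ(u)u⋆. The hull lies in the image
  -- of the unit ball of N and in the δ-ball about p.
  obtain ⟨v, hv, hmin⟩ := exists_forall_norm_le_imp_eq (C := closure (convexHull ℝ S))
    ⟨_, subset_closure (subset_convexHull ℝ S hpS)⟩ isClosed_closure
    (convex_convexHull ℝ S).closure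
  have hsub : ∀ C : Set τ.L2, IsClosed C → Convex ℝ C → S ⊆ C → closure (convexHull ℝ S) ⊆ C :=
    fun C h1 h2 h3 => h1.closure_subset_iff.2 (convexHull_min h3 h2)
  obtain ⟨x, -, hx1, rfl⟩ := hsub _ (τ.isClosed_hat_ball (M := N) 1 1) (τ.convex_hat_ball 1 1) (by
    rw [hS]
    rintro _ ⟨u, hu, hu1, hu2, rfl⟩
    refine ⟨_, ⟨Subtype.prop _, one_mul _, mul_one _⟩, (norm_mul_le _ _).trans ?_, rfl⟩
    rw [norm_star]
    exact mul_le_one₀ (hnorm u hu1) (norm_nonneg _) (norm_le_one_of_star_mul_self_eq hp hu1)) hv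
  have hx2 := hsub _ (Metric.isClosed_closedBall (x := τ.hat p) (ε := δ))
    (convex_closedBall (τ.hat p) δ) (by
    rw [hS]
    rintro _ ⟨u, hu, hu1, hu2, rfl⟩
    have hu' := norm_le_one_of_star_mul_self_eq hp hu1
    rw [Metric.mem_closedBall, dist_eq_norm, ← map_sub, τ.norm_hat, ← hu2, ← sub_mul]
    refine (τ.norm2_mul_le _ _).trans ?_
    rw [norm_star]
    calc ‖u‖ * τ.norm2 (φ u - u) ≤ 1 * τ.norm2 (φ u - u) := by
          gcongr
          exact Real.sqrt_nonneg _
      _ ≤ δ := by rw [one_mul]; exact hδ u hu hu') hv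
  -- The map ζ ↦ φ(u)ζu⋆ preserves the hull and does not increase norms, so uniqueness of the
  -- minimizer gives invariance.
  have hinv : ∀ u ∈ Q, star u * u = p → u * star u = p → φ u * x * star u = x := by
    intro u hu hu1 hu2
    have hu' := norm_le_one_of_star_mul_self_eq hp hu1
    refine τ.hat_injective (hmin _ ?_ ?_)
    · have h1 : closure (convexHull ℝ S) ⊆
          (τ.leftMul (φ u) ∘L τ.rightMul (star u)) ⁻¹' closure (convexHull ℝ S) := by
        refine hsub _ (isClosed_closure.preimage (by fun_prop)) ?_ ?_
        · exact (convex_convexHull ℝ S).closure.is_linear_preimage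
            ((τ.leftMul (φ u) ∘L τ.rightMul (star u)).restrictScalars ℝ).toLinearMap.isLinear
        · intro ζ hζ
          rw [hS] at hζ
          obtain ⟨w, hw, hw1, hw2, rfl⟩ := hζ
          refine subset_closure (subset_convexHull ℝ S ?_)
          rw [hS]
          refine ⟨u * w, mul_mem hu hw, ?_, ?_, ?_⟩
          · rw [star_mul, mul_assoc, ← mul_assoc (star u), hu1, ← mul_assoc, ← hw1, mul_assoc,
              ← mul_assoc (star w), hw1, mul_assoc]
            rw [(hQ.le_corner w hw).2.1, hw1]
          · rw [star_mul, mul_assoc, ← mul_assoc w, hw2, ← mul_assoc,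
              (hQ.le_corner u hu).2.2, hu2]
          · change τ.leftMul (φ u) (τ.rightMul (star u) (τ.hat (φ w * star w))) = _
            rw [τ.rightMul_hat, τ.leftMul_hat, map_mul φ, star_mul]
            simp only [mul_assoc]
      have := h1 hv
      change τ.leftMul (φ u) (τ.rightMul (star u) (τ.hat x)) ∈ closure (convexHull ℝ S) at this
      rwa [τ.rightMul_hat, τ.leftMul_hat, ← mul_assoc] at this
    · rw [mul_assoc, ← τ.leftMul_hat, ← τ.rightMul_hat]
      refine (τ.norm_leftMul_le _ _).trans ?_
      refine (mul_le_of_le_one_left (norm_nonneg _) (hnorm u hu1)).trans ?_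
      refine (τ.norm_rightMul_le _ _).trans (mul_le_of_le_one_left (norm_nonneg _) ?_)
      rwa [norm_star]
  have hxp : x * p = x := by
    rw [← hinv p hQ.unit_mem (by rw [hps, hpp]) (by rw [hps, hpp]), hps, mul_assoc, hpp]
  refine ⟨x, ⟨hxp, fun q hq => ?_⟩, hx1, ?_⟩
  · let L : Submodule ℂ N :=
      { carrier := {q | φ q * x = x * q}
        add_mem' := fun {a b} ha hb => by
          change φ (a + b) * x = x * (a + b)
          rw [map_add, add_mul, mul_add, ha, hb]
        zero_mem' := by
          change φ 0 * x = x * 0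
          rw [map_zero, zero_mul, mul_zero]
        smul_mem' := fun c a ha => by
          change φ (c • a) * x = x * (c • a)
          rw [map_smul, smul_mul_assoc, mul_smul_comm, ha] }
    refine hQ.unitary_induction hp (S := L) (fun u hu hu1 hu2 => ?_) hq
    change φ u * x = x * u
    nth_rewrite 2 [← hinv u hu hu1 hu2]
    rw [mul_assoc _ (star u), hu1, mul_assoc, hxp]
  · rwa [Metric.mem_closedBall, dist_eq_norm, ← map_sub, τ.norm_hat] at hx2

end VonNeumannAlgebra

end

/-! ### Implementing the deformation on cut-down singular vectors -/

noncomputable section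

namespace VonNeumannAlgebra

variable {H : Type*} [NormedAddCommGroup H] [InnerProductSpace ℂ H] [CompleteSpace H]

variable {N M : VonNeumannAlgebra H} {p : N} {Q : NonUnitalStarSubalgebra ℂ N}

/-- A continuous spectral cutoff `h` of a positive contraction `c`, close to `1` where `c` is, such
that `c` is invertible, with inverse `k²`, where `h` does not vanish. -/
theorem exists_cutoff {c : N} (hc0 : 0 ≤ c) (hc1 : ‖c‖ ≤ 1) :
    ∃ h k m n : N, star h = h ∧ star k = k ∧ ‖h‖ ≤ 1 ∧ ‖m‖ ≤ 2 ∧ h = c * n ∧ (1 - c) * m = 1 - h ∧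
      k * c * k * h = h ∧ ∀ y, Commute c y → Commute h y ∧ Commute k y ∧ Commute n y := by
  have hsa : IsSelfAdjoint c := IsSelfAdjoint.of_nonneg hc0
  have hid : cfc (fun s : ℝ => s) c = c := cfc_id' ℝ c
  have hspec : ∀ s ∈ spectrum ℝ c, 0 ≤ s ∧ s ≤ 1 := fun s hs => by
    refine ⟨spectrum_nonneg_of_nonneg hc0 hs, ?_⟩
    have h2 : ‖s‖ ≤ ‖cfc (fun s : ℝ => s) c‖ := norm_apply_le_norm_cfc (fun s : ℝ => s) c hs
    rw [hid, Real.norm_eq_abs] at h2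
    exact (le_abs_self s).trans (h2.trans hc1)
  have hpos : ∀ s : ℝ, 0 < max s (1 / 2) := fun s => lt_max_of_lt_right (by norm_num)
  -- On [0, 1] the cutoff is h(s) = max(2s − 1, 0) = s n(s). It vanishes below 1/2, so k need only
  -- be s^{-1/2} above 1/2, and m = (1 − h)/(1 − s) is bounded by 2.
  let fn : ℝ → ℝ := fun s => 2 - (max s (1 / 2))⁻¹
  let fk : ℝ → ℝ := fun s => (√(max s (1 / 2)))⁻¹
  let fm : ℝ → ℝ := fun s => (max (1 - s) (1 / 2))⁻¹
  let fh : ℝ → ℝ := fun s => s * fn s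
  have hfn : Continuous fn := continuous_const.sub
    ((continuous_id.max continuous_const).inv₀ fun s => (hpos s).ne')
  have hfk : Continuous fk := (Real.continuous_sqrt.comp (continuous_id.max continuous_const)).inv₀
    fun s => (Real.sqrt_pos.2 (hpos s)).ne'
  have hfm : Continuous fm := ((continuous_const.sub continuous_id).max continuous_const).inv₀
    fun s => (hpos _).ne'
  have hfh : Continuous fh := continuous_id.mul hfn
  have hval : ∀ s : ℝ, (s ≤ 1 / 2 ∧ fh s = 0 ∧ fm s = (1 - s)⁻¹) ∨
      (1 / 2 ≤ s ∧ fh s = 2 * s - 1 ∧ fm s = 2 ∧ fk s = (√s)⁻¹) := fun s => by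
    rcases le_total s (1 / 2) with h | h
    · refine Or.inl ⟨h, ?_, ?_⟩
      · simp only [fh, fn, max_eq_right h]; norm_num
      · simp only [fm]; rw [max_eq_left (by linarith)]
    · refine Or.inr ⟨h, ?_, ?_, ?_⟩
      · simp only [fh, fn, max_eq_left h]
        have : s ≠ 0 := by linarith
        field_simp
      · simp only [fm]; rw [max_eq_right (by linarith)]; norm_num
      · simp only [fk, max_eq_left h]
  refine ⟨cfc fh c, cfc fk c, cfc fm c, cfc fn c, (cfc_predicate fh c).star_eq,
    (cfc_predicate fk c).star_eq, ?_, ?_, ?_, ?_, ?_, fun y hy =>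
      ⟨hsa.commute_cfc hy _, hsa.commute_cfc hy _, hsa.commute_cfc hy _⟩⟩
  · refine norm_cfc_le zero_le_one fun s hs => ?_
    obtain ⟨h0, h1⟩ := hspec s hs
    rw [Real.norm_eq_abs, abs_le]
    rcases hval s with ⟨h, e, -⟩ | ⟨h, e, -⟩ <;> rw [e] <;> constructor <;> linarith
  · refine norm_cfc_le zero_le_two fun s hs => ?_
    have h1 : (1 : ℝ) / 2 ≤ max (1 - s) (1 / 2) := le_max_right _ _
    rw [Real.norm_eq_abs, abs_of_nonneg (inv_nonneg.2 (hpos _).le)]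
    exact (inv_anti₀ (by norm_num) h1).trans (by norm_num)
  · rw [cfc_mul (fun s => s) fn c continuousOn_id hfn.continuousOn, hid]
  · have h1 : (1 : N) = cfc (fun _ : ℝ => (1 : ℝ)) c := (cfc_const_one ℝ c).symm
    nth_rewrite 2 [h1]
    nth_rewrite 1 [h1]
    nth_rewrite 2 [← hid]
    rw [← cfc_sub (fun _ => (1 : ℝ)) (fun s => s) c continuousOn_const continuousOn_id,
      ← cfc_sub (fun _ => (1 : ℝ)) fh c continuousOn_const hfh.continuousOn,
      ← cfc_mul (fun s : ℝ => 1 - s) fm c (continuous_const.sub continuous_id).continuousOn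
        hfm.continuousOn]
    refine cfc_congr fun s hs => ?_
    obtain ⟨h0, h1⟩ := hspec s hs
    rcases hval s with ⟨h, e, e'⟩ | ⟨h, e, e', -⟩
    · rw [e, e', mul_inv_cancel₀ (by linarith), sub_zero]
    · rw [e, e']; ring
  · nth_rewrite 2 [← hid]
    rw [← cfc_mul fk (fun s => s) c hfk.continuousOn continuousOn_id,
      ← cfc_mul (fun s => fk s * s) fk c (hfk.mul continuous_id).continuousOn hfk.continuousOn,
      ← cfc_mul (fun s => fk s * s * fk s) fh c ((hfk.mul continuous_id).mul hfk).continuousOn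
        hfh.continuousOn]
    refine cfc_congr fun s hs => ?_
    rcases hval s with ⟨h, e, -⟩ | ⟨h, -, -, e⟩
    · rw [e, mul_zero]
    · have h0 : 0 < s := by linarith
      have : fk s * s * fk s = 1 := by
        rw [e]
        have := Real.mul_self_sqrt h0.le
        have := (Real.sqrt_pos.2 h0).ne'
        field_simp
        nlinarith
      rw [this, one_mul]

theorem IsIntertwiner.comp {φ ψ θ : N ≃⋆ₐ[ℂ] N} (hθ : ∀ x, θ x = ψ (φ x)) {w W : N}
    (hw : IsIntertwiner Q p φ w) (hW : IsIntertwiner Q p ψ W) :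
    IsIntertwiner Q p θ (ψ w * W) where
  right := by rw [mul_assoc, hW.right]
  comm q hq := by
    rw [hθ, ← mul_assoc, ← map_mul, hw.comm q hq, map_mul, mul_assoc, hW.comm q hq, mul_assoc]

namespace Trace

variable (τ : Trace N)

/-- `W` implements `φ` on the vector `ξ`: `φ(ξ) W = W ξ`, with `ξ` supported on the initial and
`φ(ξ)` on the final space of `W`. -/
structure Transports (φ : N ≃⋆ₐ[ℂ] N) (W : N) (ξ : τ.L2) : Prop where
  mul_right : τ.rightMul W (τ.autL2 φ ξ) = τ.leftMul W ξ
  star_mul_left : τ.leftMul (star W) (τ.autL2 φ ξ) = τ.rightMul (star W) ξ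
  source : τ.leftMul (star W * W) ξ = ξ
  range : τ.leftMul (W * star W) (τ.autL2 φ ξ) = τ.autL2 φ ξ

theorem autL2_comp {φ ψ θ : N ≃⋆ₐ[ℂ] N} (hφ : ∀ x, τ.toPLM (φ x) = τ.toPLM x)
    (hψ : ∀ x, τ.toPLM (ψ x) = τ.toPLM x) (hθ : ∀ x, θ x = ψ (φ x)) (ξ : τ.L2) :
    τ.autL2 θ ξ = τ.autL2 ψ (τ.autL2 φ ξ) := by
  refine τ.hat_induction (isClosed_eq (by fun_prop) (by fun_prop)) (fun x => ?_) ξ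
  rw [τ.autL2_hat hφ, τ.autL2_hat hψ, τ.autL2_hat (fun x => by rw [hθ, hψ, hφ]), hθ]

variable {τ}

/-- Implementations multiply as cocycles. The support conditions in `Transports` ensure that
composing loses nothing, so ξ needs no further cutting. -/
theorem Transports.comp {φ ψ θ : N ≃⋆ₐ[ℂ] N} (hφ : ∀ x, τ.toPLM (φ x) = τ.toPLM x)
    (hψ : ∀ x, τ.toPLM (ψ x) = τ.toPLM x) (hθ : ∀ x, θ x = ψ (φ x)) {w W : N} {ξ : τ.L2}
    (hw : τ.Transports φ w ξ) (hW : τ.Transports ψ W ξ) : τ.Transports θ (ψ w * W) ξ := by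
  have e1 := congrArg (τ.autL2 ψ) hw.mul_right
  have e2 := congrArg (τ.autL2 ψ) hw.star_mul_left
  have e3 := congrArg (τ.autL2 ψ) hw.source
  have e4 := congrArg (τ.autL2 ψ) hw.range
  simp only [τ.autL2_leftMul hψ, τ.autL2_rightMul hψ, map_mul, map_star] at e1 e2 e3 e4
  constructor
  · rw [τ.autL2_comp hφ hψ hθ, ← rightMul_rightMul, e1, rightMul_leftMul, hW.mul_right,
      leftMul_leftMul]
  · rw [τ.autL2_comp hφ hψ hθ, star_mul, ← leftMul_leftMul, e2, ← rightMul_leftMul,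
      hW.star_mul_left, rightMul_rightMul]
  · have h1 : star (ψ w * W) * (ψ w * W) = star W * (star (ψ w) * ψ w) * W := by
      simp only [star_mul, mul_assoc]
    rw [h1, ← leftMul_leftMul, ← hW.mul_right, ← leftMul_leftMul, ← rightMul_leftMul, e3,
      hW.mul_right, leftMul_leftMul, hW.source]
  · have h1 : ψ w * W * star (ψ w * W) = ψ w * (W * star W) * star (ψ w) := by
      simp only [star_mul, mul_assoc]
    rw [τ.autL2_comp hφ hψ hθ, h1, ← leftMul_leftMul, e2, ← leftMul_leftMul, ← rightMul_leftMul,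
      hW.range, ← e2, leftMul_leftMul, e4]

end Trace

namespace SMalleableDeformation

open Trace

variable {τ : Trace N} (D : SMalleableDeformation τ M)

theorem α_zero (x : N) : D.α 0 x = x := by
  have h := D.α_add 0 0 x
  rw [add_zero] at h
  exact (EquivLike.injective (D.α 0) h).symm

theorem α_α_neg (t : ℝ) (x : N) : D.α t (D.α (-t) x) = x := by
  rw [← D.α_add, add_neg_cancel, D.α_zero]

theorem autL2_β_of_mem {ξ : τ.L2} (hξ : ξ ∈ τ.L2Corner M p) : τ.autL2 D.β ξ = ξ :=
  τ.L2Corner_induction (P := fun ξ => τ.autL2 D.β ξ = ξ) (isClosed_eq (by fun_prop) (by fun_prop))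
    (fun x hx => by rw [τ.autL2_hat D.β_trace, D.β_eq_self x hx.1]) hξ

/-- The reflection `β` turns a partial isometry that intertwines `id` and `α_s` into one that
intertwines `id` and `α_{2s}`. -/
theorem transports_double {s : ℝ} {v : N} {ξ : τ.L2} (hξ : ξ ∈ τ.L2Corner M p)
    (hη : τ.leftMul (star v) (τ.rightMul v (τ.autL2 (D.α s) ξ)) ∈ τ.L2Corner M p)
    (h1 : τ.leftMul (v * star v) (τ.autL2 (D.α s) ξ) = τ.autL2 (D.α s) ξ)
    (h2 : τ.rightMul (v * star v) (τ.autL2 (D.α s) ξ) = τ.autL2 (D.α s) ξ) :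
    τ.Transports (D.α (2 * s)) (D.α s (v * star (D.β v))) ξ := by
  have hB : τ.autL2 D.β (τ.autL2 (D.α s) ξ) = τ.autL2 (D.α (-s)) ξ := by
    rw [← τ.autL2_comp (θ := (D.α s).trans D.β) (D.α_trace s) D.β_trace fun _ => rfl]
    nth_rewrite 2 [← D.autL2_β_of_mem hξ]
    refine τ.autL2_comp D.β_trace (D.α_trace _) (fun x => D.β_α s x) ξ
  obtain ⟨ζ, hζ⟩ : ∃ ζ, ζ = τ.autL2 (D.α s) ξ := ⟨_, rfl⟩
  obtain ⟨ζ', hζ'⟩ : ∃ ζ', ζ' = τ.autL2 (D.α (-s)) ξ := ⟨_, rfl⟩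
  obtain ⟨y, hy⟩ : ∃ y, y = D.β v := ⟨_, rfl⟩
  rw [← hζ] at hη h1 h2 hB
  rw [← hζ'] at hB
  rw [← hy]
  -- η = v⋆α_s(ξ)v lies in L²(pMp), so β fixes it. It is thus conjugate to α_s(ξ) by v and to
  -- α_{-s}(ξ) by β(v).
  obtain ⟨η, hη'⟩ : ∃ η, η = τ.leftMul (star v) (τ.rightMul v ζ) := ⟨_, rfl⟩
  rw [← hη'] at hη
  have hr : τ.leftMul v η = τ.rightMul v ζ := by
    rw [hη', leftMul_leftMul, ← rightMul_leftMul, h1]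
  have hl : τ.rightMul (star v) η = τ.leftMul (star v) ζ := by
    rw [hη', rightMul_leftMul, rightMul_rightMul, h2]
  have he1 : τ.leftMul (star v * v) η = η := by
    rw [← leftMul_leftMul, hr, hη']
  have hη2 : τ.autL2 D.β η = η := D.autL2_β_of_mem hη
  have hrβ : τ.leftMul y η = τ.rightMul y ζ' := by
    have := congrArg (τ.autL2 D.β) hr
    rwa [τ.autL2_leftMul D.β_trace, τ.autL2_rightMul D.β_trace, hη2, hB, ← hy] at this
  have hlβ : τ.rightMul (star y) η = τ.leftMul (star y) ζ' := by
    have := congrArg (τ.autL2 D.β) hl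
    rwa [τ.autL2_leftMul D.β_trace, τ.autL2_rightMul D.β_trace, hη2, hB, map_star, ← hy] at this
  have he1β : τ.leftMul (star y * y) η = η := by
    have := congrArg (τ.autL2 D.β) he1
    rwa [τ.autL2_leftMul D.β_trace, hη2, map_mul, map_star, ← hy] at this
  have h1β : τ.leftMul (y * star y) ζ' = ζ' := by
    have := congrArg (τ.autL2 D.β) h1
    rwa [τ.autL2_leftMul D.β_trace, hB, map_mul, map_star, ← hy] at this
  have hu1 : τ.rightMul (v * star y) ζ = τ.leftMul (v * star y) ζ' := by
    rw [← rightMul_rightMul, ← hr, rightMul_leftMul, hlβ, leftMul_leftMul]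
  have hu2 : τ.leftMul (star (v * star y)) ζ = τ.rightMul (star (v * star y)) ζ' := by
    rw [star_mul, star_star, ← leftMul_leftMul, ← hl, ← rightMul_leftMul, hrβ, rightMul_rightMul]
  have hu3 : τ.leftMul (star (v * star y) * (v * star y)) ζ' = ζ' := by
    rw [star_mul, star_star, show y * star v * (v * star y) = y * (star v * v) * star y by
      simp only [mul_assoc], ← leftMul_leftMul, ← hlβ, ← leftMul_leftMul, ← rightMul_leftMul,
      he1, hlβ, leftMul_leftMul, h1β]
  have hu4 : τ.leftMul (v * star y * star (v * star y)) ζ = ζ := by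
    rw [star_mul, star_star, show v * star y * (y * star v) = v * (star y * y) * star v by
      simp only [mul_assoc], ← leftMul_leftMul, ← hl, ← leftMul_leftMul, ← rightMul_leftMul,
      he1β, hl, leftMul_leftMul, h1]
  have hα : ∀ t, ∀ x, τ.toPLM (D.α t x) = τ.toPLM x := D.α_trace
  have hα1 : τ.autL2 (D.α s) ζ = τ.autL2 (D.α (2 * s)) ξ := by
    rw [hζ]
    refine (τ.autL2_comp (hα s) (hα s) (fun x => ?_) ξ).symm
    rw [two_mul, D.α_add]
  have hα2 : τ.autL2 (D.α s) ζ' = ξ := by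
    rw [hζ', ← τ.autL2_comp (θ := StarAlgEquiv.refl ℂ N) (hα (-s)) (hα s)
      (fun x => (D.α_α_neg s x).symm)]
    refine τ.hat_induction (isClosed_eq (by fun_prop) (by fun_prop)) (fun x => ?_) ξ
    exact τ.autL2_hat (fun _ => rfl) x
  -- u = vβ(v)⋆ carries α_{-s}(ξ) to α_s(ξ); applying α_s moves the pair to ξ and α_{2s}(ξ).
  obtain ⟨u, hu⟩ : ∃ u, u = v * star y := ⟨_, rfl⟩
  rw [← hu] at hu1 hu2 hu3 hu4 ⊢
  have e1 := congrArg (τ.autL2 (D.α s)) hu1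
  have e2 := congrArg (τ.autL2 (D.α s)) hu2
  have e3 := congrArg (τ.autL2 (D.α s)) hu3
  have e4 := congrArg (τ.autL2 (D.α s)) hu4
  simp only [τ.autL2_leftMul (hα s), τ.autL2_rightMul (hα s), map_mul, map_star, hα1, hα2]
    at e1 e2 e3 e4
  exact ⟨e1, e2, e3, e4⟩

theorem autL2_α_zero (ξ : τ.L2) : τ.autL2 (D.α 0) ξ = ξ := by
  refine τ.hat_induction (isClosed_eq (by fun_prop) (by fun_prop)) (fun x => ?_) ξ
  rw [τ.autL2_hat (D.α_trace 0), D.α_zero]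

theorem isIntertwiner_double (hQ : IsCornerSubalgebra M p Q) {s : ℝ} {v : N}
    (hv : IsIntertwiner Q p (D.α s) v) :
    IsIntertwiner Q p (D.α (2 * s)) (D.α s (v * star (D.β v))) := by
  have hβ : ∀ q ∈ Q, star (D.β v) * D.α (-s) q = q * star (D.β v) := fun q hq => by
    have h1 := congrArg D.β (hv.star_mul_map hq)
    rwa [map_mul, map_mul, map_star, D.β_α, D.β_eq_self q (hQ.le_corner q hq).1] at h1
  have hβ' : ∀ q ∈ Q, D.α s (v * star (D.β v)) * q = D.α s (v * q * star (D.β v)) := fun q hq => by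
    rw [mul_assoc v, ← hβ q hq, ← mul_assoc, map_mul _ (v * _), D.α_α_neg]
  constructor
  · rw [hβ' p hQ.unit_mem, hv.right]
  · intro q hq
    rw [hβ' q hq, two_mul, D.α_add, ← map_mul, ← mul_assoc, hv.comm q hq]

theorem norm2_neg (x : N) : τ.norm2 (-x) = τ.norm2 x := by
  rw [← τ.norm_hat, map_neg, norm_neg, τ.norm_hat]

theorem norm2_add_le (x y : N) : τ.norm2 (x + y) ≤ τ.norm2 x + τ.norm2 y := by
  rw [← τ.norm_hat, ← τ.norm_hat, ← τ.norm_hat, map_add]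
  exact norm_add_le _ _

theorem norm2_mul_le_left (a x : N) : τ.norm2 (a * x) ≤ ‖a‖ * τ.norm2 x := by
  rw [← τ.norm2_star, star_mul, ← norm_star a, ← τ.norm2_star x]
  exact τ.norm2_mul_le _ _

/-- If `α_s` is uniformly close to the identity on the unit ball of `Q`, then `α_{2s}` is
implemented on the singular vectors, up to a cutoff. -/
theorem exists_transports_double (hp : IsStarProjection p) (hQ : IsCornerSubalgebra M p Q)
    {s δ : ℝ} (hδ : ∀ q ∈ Q, ‖q‖ ≤ 1 → τ.norm2 (D.α s q - q) ≤ δ) :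
    ∃ h w, IsRelComm Q p h ∧ star h = h ∧ ‖h‖ ≤ 1 ∧ τ.norm2 (h - p) ≤ 6 * δ ∧
      IsIntertwiner Q p (D.α (2 * s)) w ∧ ∀ ξ ∈ τ.singularSubspace M p Q,
        τ.Transports (D.α (2 * s)) w (τ.leftMul h (τ.rightMul h ξ)) := by
  have hps : star p = p := hp.isSelfAdjoint.star_eq
  have hpp : p * p = p := hp.isIdempotentElem.eq
  obtain ⟨x, hx, hx1, hxp⟩ := hQ.exists_isIntertwiner hp τ (D.α s) hδ
  obtain ⟨c, hc⟩ : ∃ c, c = D.α (-s) (x * star x) := ⟨_, rfl⟩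
  have hαc : D.α s c = x * star x := by rw [hc, D.α_α_neg]
  have hcQ : IsRelComm Q p c := hx.isRelComm_symm hQ.unit_mem hαc
  have hc0 : 0 ≤ c := by
    rw [hc, map_mul, map_star]
    exact mul_star_self_nonneg _
  have hc1 : ‖c‖ ≤ 1 := by
    rw [hc]
    refine (NonUnitalStarAlgHom.norm_apply_le (D.α (-s)) _).trans ((norm_mul_le _ _).trans ?_)
    rw [norm_star]
    exact mul_le_one₀ hx1 (norm_nonneg _) hx1
  obtain ⟨h, k, m, n, hsa, ksa, hh1, hm2, hcn, hcm, hkck, hcomm⟩ := exists_cutoff hc0 hc1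
  have hpc : Commute c p := hcQ.right.trans hcQ.left.symm
  have hQh : IsRelComm Q p h :=
    ⟨by rw [hcn, ← mul_assoc, hcQ.left], by
      rw [(hcomm p hpc).1.eq, hcn, ← mul_assoc, hcQ.left],
      fun q hq => (hcomm q (hcQ.comm q hq)).1⟩
  have hQc : ∀ q ∈ Q, q ∈ corner M p := hQ.le_corner
  -- The sum α_s(p − c) = (α_s(p) − p) + (p − x) + x(p − x)⋆ has three terms, each of 2-norm at most
  -- δ.
  have hcp : τ.norm2 (p - c) ≤ 3 * δ := by
    have e1 : D.α s (p - c) = (D.α s p - p) + (-(x - p) + x * -star (x - p)) := by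
      rw [map_sub, hαc, star_sub, hps, neg_sub, neg_sub, mul_sub, hx.right]
      abel
    rw [← τ.norm2_map (D.α_trace s), e1]
    have h1 := hδ p hQ.unit_mem (norm_le_one_of_star_mul_self_eq hp (by rw [hps, hpp]))
    have h2 := norm2_add_le (τ := τ) (D.α s p - p) (-(x - p) + x * -star (x - p))
    have h3 := norm2_add_le (τ := τ) (-(x - p)) (x * -star (x - p))
    have h4 := norm2_mul_le_left (τ := τ) x (-star (x - p))
    rw [norm2_neg, τ.norm2_star] at h4
    rw [norm2_neg] at h3
    have h5 : ‖x‖ * τ.norm2 (x - p) ≤ 1 * τ.norm2 (x - p) :=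
      mul_le_mul_of_nonneg_right hx1 (Real.sqrt_nonneg _)
    linarith
  -- The factor k normalizes x: vv⋆ = α_s(kck), and kck is a unit for h.
  obtain ⟨v, hv⟩ : ∃ v, v = D.α s k * x := ⟨_, rfl⟩
  have hvI : IsIntertwiner Q p (D.α s) v := by
    refine ⟨by rw [hv, mul_assoc, hx.right], fun q hq => ?_⟩
    have := (hcomm q (hcQ.comm q hq)).2.1
    rw [hv, ← mul_assoc, ← map_mul, ← this.eq, map_mul, mul_assoc, hx.comm q hq, mul_assoc]
  have hvv : v * star v = D.α s (k * c * k) := by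
    rw [hv, star_mul, ← map_star, ksa, map_mul, map_mul, hαc]
    simp only [mul_assoc]
  have hkck' : h * (k * c * k) = h := by
    have := congrArg star hkck
    rw [star_mul, star_mul, star_mul, hsa, ksa, (IsSelfAdjoint.of_nonneg hc0).star_eq] at this
    rwa [← mul_assoc k] at this
  refine ⟨h, D.α s (v * star (D.β v)), hQh, hsa, hh1, ?_, D.isIntertwiner_double hQ hvI,
    fun ξ hξ => ?_⟩
  -- h − p = −(p − c)m with ‖m‖ ≤ 2, which doubles 3δ to 6δ.
  · have e1 : h - p = -((p - c) * m) := by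
      have : (p - c) * m = p * ((1 - c) * m) := by
        rw [← mul_assoc, mul_sub, mul_one, hcQ.left]
      rw [this, hcm, mul_sub, mul_one, hQh.left, neg_sub]
    rw [e1, norm2_neg]
    refine (τ.norm2_mul_le _ _).trans ?_
    calc ‖m‖ * τ.norm2 (p - c) ≤ 2 * (3 * δ) :=
          mul_le_mul hm2 hcp (Real.sqrt_nonneg _) zero_le_two
      _ = 6 * δ := by ring
  · have hξ' := leftMul_mem_singularSubspace hQc hQh (rightMul_mem_singularSubspace hQc hQh hξ)
    refine D.transports_double (v := v) hξ'.1
      (intertwine_mem_singularSubspace hp hQc (D.α_trace s) hvI hvI hξ').1 ?_ ?_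
    · rw [τ.autL2_leftMul (D.α_trace s), leftMul_leftMul, hvv, ← map_mul, hkck]
    · rw [τ.autL2_leftMul (D.α_trace s), τ.autL2_rightMul (D.α_trace s), rightMul_leftMul,
        rightMul_rightMul, hvv, ← map_mul, hkck']

/-- One cutoff h, chosen for the step s, serves every multiple n. The error 6δ therefore depends on
the step alone, not on the total time 2ns. -/
theorem exists_transports (hp : IsStarProjection p) (hQ : IsCornerSubalgebra M p Q)
    {s δ : ℝ} (hδ : ∀ q ∈ Q, ‖q‖ ≤ 1 → τ.norm2 (D.α s q - q) ≤ δ) (n : ℕ) :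
    ∃ h W, IsRelComm Q p h ∧ star h = h ∧ ‖h‖ ≤ 1 ∧ τ.norm2 (h - p) ≤ 6 * δ ∧
      IsIntertwiner Q p (D.α (n * (2 * s))) W ∧ ∀ ξ ∈ τ.singularSubspace M p Q,
        τ.Transports (D.α (n * (2 * s))) W (τ.leftMul h (τ.rightMul h ξ)) := by
  have hps : star p = p := hp.isSelfAdjoint.star_eq
  have hpp : p * p = p := hp.isIdempotentElem.eq
  obtain ⟨h, w, hh, hsa, h1, hδ', hw, hξ⟩ := D.exists_transports_double hp hQ hδ
  suffices ∃ W, IsIntertwiner Q p (D.α (n * (2 * s))) W ∧ ∀ ξ ∈ τ.singularSubspace M p Q,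
      τ.Transports (D.α (n * (2 * s))) W (τ.leftMul h (τ.rightMul h ξ)) by
    obtain ⟨W, hW⟩ := this
    exact ⟨h, W, hh, hsa, h1, hδ', hW⟩
  have hQc : ∀ q ∈ Q, q ∈ corner M p := hQ.le_corner
  induction n with
  | zero =>
    refine ⟨p, ⟨hpp, fun q hq => ?_⟩, fun ξ hξ => ?_⟩
    · rw [Nat.cast_zero, zero_mul, D.α_zero, (hQc q hq).2.1, (hQc q hq).2.2]
    · have hK := (leftMul_mem_singularSubspace hQc hh (rightMul_mem_singularSubspace hQc hh hξ)).1
      have e1 := τ.leftMul_of_mem_L2Corner hK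
      have e2 := τ.rightMul_of_mem_L2Corner hK
      rw [Nat.cast_zero, zero_mul]
      constructor
      · rw [D.autL2_α_zero, e1, e2]
      · rw [D.autL2_α_zero, hps, e1, e2]
      · rw [hps, hpp, e1]
      · rw [D.autL2_α_zero, hps, hpp, e1]
  | succ n ih =>
    obtain ⟨W, hW, hWξ⟩ := ih
    have hθ : ∀ x, D.α ((n + 1 : ℕ) * (2 * s)) x = D.α (n * (2 * s)) (D.α (2 * s) x) := fun x => by
      rw [← D.α_add]
      congr 2
      push_cast
      ring
    exact ⟨_, hw.comp hθ hW, fun ξ h => (hξ ξ h).comp (D.α_trace _) (D.α_trace _) hθ (hWξ ξ h)⟩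

end SMalleableDeformation

end VonNeumannAlgebra

end

/-! ### Bounded elements transported by intertwiners -/

noncomputable section

namespace VonNeumannAlgebra

variable {H : Type*} [NormedAddCommGroup H] [InnerProductSpace ℂ H] [CompleteSpace H]

variable {N M : VonNeumannAlgebra H} {p : N} {Q : NonUnitalStarSubalgebra ℂ N}

/-- `b ∈ pMp` is supported on the initial space of `W`, which implements `θ` on it, and `c b c'`
lies in `pMp` for all `c`, `c'` in the relative commutant of `Q`. -/
structure IsTransported (M : VonNeumannAlgebra H) (p : N) (Q : NonUnitalStarSubalgebra ℂ N)
    (θ : N ≃⋆ₐ[ℂ] N) (W b : N) : Prop where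
  mem : b ∈ corner M p
  map_eq : θ b = W * b * star W
  source_left : star W * W * b = b
  source_right : b * (star W * W) = b
  relComm : ∀ c c', IsRelComm Q p c → IsRelComm Q p c' → c * b * c' ∈ corner M p

namespace IsTransported

variable {θ : N ≃⋆ₐ[ℂ] N} {W b b' : N}

theorem zero : IsTransported M p Q θ W 0 where
  mem := zero_mem _
  map_eq := by rw [map_zero, mul_zero, zero_mul]
  source_left := mul_zero _
  source_right := zero_mul _
  relComm c c' _ _ := by rw [mul_zero, zero_mul]; exact zero_mem _

theorem add (hb : IsTransported M p Q θ W b) (hb' : IsTransported M p Q θ W b') :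
    IsTransported M p Q θ W (b + b') where
  mem := add_mem hb.mem hb'.mem
  map_eq := by rw [map_add, mul_add, add_mul, hb.map_eq, hb'.map_eq]
  source_left := by rw [mul_add, hb.source_left, hb'.source_left]
  source_right := by rw [add_mul, hb.source_right, hb'.source_right]
  relComm c c' hc hc' := by
    rw [mul_add, add_mul]
    exact add_mem (hb.relComm c c' hc hc') (hb'.relComm c c' hc hc')

theorem smul (z : ℂ) (hb : IsTransported M p Q θ W b) : IsTransported M p Q θ W (z • b) where
  mem := Submodule.smul_mem _ _ hb.mem
  map_eq := by rw [map_smul, mul_smul_comm, smul_mul_assoc, hb.map_eq]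
  source_left := by rw [mul_smul_comm, hb.source_left]
  source_right := by rw [smul_mul_assoc, hb.source_right]
  relComm c c' hc hc' := by
    rw [mul_smul_comm, smul_mul_assoc]
    exact Submodule.smul_mem _ _ (hb.relComm c c' hc hc')

/-- The last property is multiplicative because c(bb′)c′ = (cbp)(pb′c′) and p itself belongs to the
relative commutant. -/
theorem mul (hp : IsStarProjection p) (hQ : ∀ q ∈ Q, q ∈ corner M p)
    (hb : IsTransported M p Q θ W b) (hb' : IsTransported M p Q θ W b') :
    IsTransported M p Q θ W (b * b') where
  mem := mul_mem_corner hb.mem hb'.mem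
  map_eq := by
    rw [map_mul, hb.map_eq, hb'.map_eq]
    calc W * b * star W * (W * b' * star W) = W * (b * (star W * W)) * b' * star W := by
          simp only [mul_assoc]
      _ = W * (b * b') * star W := by rw [hb.source_right, mul_assoc W b b']
  source_left := by rw [← mul_assoc, hb.source_left]
  source_right := by rw [mul_assoc, hb'.source_right]
  relComm c c' hc hc' := by
    have h1 := hb.relComm c p hc (isRelComm_self hp hQ)
    have h2 := hb'.relComm p c' (isRelComm_self hp hQ) hc'
    have h3 : c * (b * b') * c' = c * b * p * (p * b' * c') := by
      calc c * (b * b') * c' = c * b * (b' * c') := by simp only [mul_assoc]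
        _ = c * (b * p) * (p * b' * c') := by rw [hb.mem.2.2, hb'.mem.2.1]
        _ = _ := by simp only [mul_assoc]
    rw [h3]
    exact mul_mem_corner h1 h2

theorem star (hp : IsStarProjection p) (hb : IsTransported M p Q θ W b) :
    IsTransported M p Q θ W (star b) where
  mem := star_mem_corner hp hb.mem
  map_eq := by rw [map_star, hb.map_eq]; simp only [star_mul, star_star, mul_assoc]
  source_left := by
    have := congrArg Star.star hb.source_right
    rwa [star_mul, star_mul, star_star] at this
  source_right := by
    have := congrArg Star.star hb.source_left
    rwa [star_mul, star_mul, star_star] at this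
  relComm c c' hc hc' := by
    have := star_mem_corner hp (hb.relComm _ _ (hc'.star hp) (hc.star hp))
    rwa [star_mul, star_mul, star_star, star_star, ← mul_assoc] at this

/-- Substituting θ(b) = WbW⋆ leaves b between x⋆W and W⋆x, both in the relative commutant of Q. -/
theorem star_mul_map_mul (hp : IsStarProjection p) (hW : IsIntertwiner Q p θ W)
    (hb : IsTransported M p Q θ W b) {x : N} (hx : IsIntertwiner Q p θ x) :
    Star.star x * θ b * x ∈ corner M p := by
  have h1 : Star.star x * θ b * x = Star.star x * W * b * (Star.star W * x) := by
    rw [hb.map_eq]; simp only [mul_assoc]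
  rw [h1]
  exact hb.relComm _ _ (hx.isRelComm_star_mul hp hW) (hW.isRelComm_star_mul hp hx)

end IsTransported

namespace Trace

variable {τ : Trace N}

set_option maxHeartbeats 1000000 in
/-- The resolvents of a transported self-adjoint vector are transported. -/
theorem Transports.isTransported_resolvent (hMN : M ≤ N) (hp : IsStarProjection p)
    (hpM : (p : H →L[ℂ] H) ∈ M) (hQ : IsCornerSubalgebra M p Q) {θ : N ≃⋆ₐ[ℂ] N}
    (hθ : ∀ x, τ.toPLM (θ x) = τ.toPLM x) {W : N} {ξ : τ.L2} (hW : τ.Transports θ W ξ)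
    (hWI : IsIntertwiner Q p θ W) (hξ : ξ ∈ τ.singularSubspace M p Q) (hsa : τ.conj ξ = ξ) {R : N}
    (hR : R ∈ corner M p) (hres : τ.IsResolvent p ξ R) :
    IsTransported M p Q θ W (p - Complex.I • R) := by
  have hQc : ∀ q ∈ Q, q ∈ corner M p := hQ.le_corner
  obtain ⟨F, hF⟩ : ∃ F, F = p - Complex.I • R := ⟨_, rfl⟩
  have hFc : F ∈ corner M p := by
    rw [hF]; exact sub_mem (self_mem_corner hp hpM) (Submodule.smul_mem _ _ hR)
  have hFr : τ.hat F = τ.rightMul R ξ := by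
    rw [hF, map_sub, map_smul, sub_eq_iff_eq_add]; exact hres.mul_right.symm
  have hFl : τ.hat F = τ.leftMul R ξ := by
    rw [hF, map_sub, map_smul, sub_eq_iff_eq_add]; exact hres.mul_left.symm
  have hsource : τ.rightMul (star W * W) ξ = ξ := by
    have := congrArg τ.conj hW.source
    rwa [conj_leftMul, hsa, star_mul, star_star] at this
  -- `θ(R) W = W R`
  have hRW : θ R * W = W * R := by
    refine τ.hat_injective ?_
    have e1 := congrArg (τ.rightMul W) (congrArg (τ.autL2 θ) hres.mul_left)
    rw [map_add, map_smul, τ.autL2_leftMul hθ, τ.autL2_hat hθ, τ.autL2_hat hθ, map_add, map_smul,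
      rightMul_leftMul, hW.mul_right, rightMul_hat, rightMul_hat, hWI.comm p hQ.unit_mem,
      hWI.right, leftMul_leftMul] at e1
    have e2 := congrArg (τ.rightMul R) e1
    have e3 := congrArg (τ.leftMul (θ R * W)) hres.mul_right
    rw [map_add, map_smul, rightMul_leftMul, rightMul_hat, rightMul_hat] at e2
    rw [map_add, map_smul, leftMul_hat, leftMul_hat, mul_assoc _ W p, hWI.right, e2] at e3
    exact e3.symm
  rw [← hF]
  refine ⟨hFc, ?_, ?_, ?_, fun c c' hc hc' => ?_⟩
  · refine τ.hat_injective ?_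
    have e1 : τ.hat (W * F * star W) = τ.leftMul W (τ.rightMul (star W) (τ.hat F)) := by
      rw [rightMul_hat, leftMul_hat, mul_assoc]
    rw [← τ.autL2_hat hθ, e1, hFl, τ.autL2_leftMul hθ, rightMul_leftMul, leftMul_leftMul, ← hRW,
      ← hW.star_mul_left, leftMul_leftMul, mul_assoc, ← leftMul_leftMul, hW.range]
  · refine τ.hat_injective ?_
    rw [← leftMul_hat, hFr, ← rightMul_leftMul, hW.source]
  · refine τ.hat_injective ?_
    rw [← rightMul_hat, hFl, rightMul_leftMul, hsource]
  -- One side at a time: cF = (cξ)R with cξ singular puts cF in pMp. Then F = i(Fξ − ξ) gives cFc′ =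
  -- i((cF)(ξc′) − cξc′), where ξc′ and cξc′ are singular.
  · have hcF : c * F ∈ corner M p := by
      refine τ.mem_corner_of_hat_mem hMN hp hpM ?_
      rw [← leftMul_hat, hFr, ← rightMul_leftMul]
      exact τ.rightMul_mem_L2Corner hR _ (leftMul_mem_singularSubspace hQc hc hξ).1
    refine τ.mem_corner_of_hat_mem hMN hp hpM ?_
    have e1 : τ.hat F = Complex.I • (τ.leftMul F ξ - ξ) := by
      have : τ.leftMul F ξ = ξ - Complex.I • τ.hat F := by
        nth_rewrite 1 [hF]
        rw [leftMul_sub, leftMul_smul, τ.leftMul_of_mem_L2Corner hξ.1, hFl]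
      rw [this, sub_sub_cancel_left, smul_neg, smul_smul, Complex.I_mul_I, neg_one_smul, neg_neg]
    have e2 : τ.hat (c * F * c') = Complex.I • (τ.leftMul (c * F) (τ.rightMul c' ξ) -
        τ.leftMul c (τ.rightMul c' ξ)) := by
      rw [← rightMul_hat, ← leftMul_hat, e1, map_smul, map_smul, map_sub, map_sub, leftMul_leftMul,
        rightMul_leftMul, rightMul_leftMul]
    have hξc := rightMul_mem_singularSubspace hQc hc' hξ
    rw [e2]
    exact Submodule.smul_mem _ _ (sub_mem (τ.leftMul_mem_L2Corner hcF _ hξc.1)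
      (leftMul_mem_singularSubspace hQc hc hξc).1)

variable (τ)

/-- The `⋆`-algebra of the bounded `2`-norm limits of sequences of elements transported by `W n`. -/
def IsApproxTransported (M : VonNeumannAlgebra H) (p : N) (Q : NonUnitalStarSubalgebra ℂ N)
    (θ : N ≃⋆ₐ[ℂ] N) (W : ℕ → N) (b : N) : Prop :=
  b ∈ corner M p ∧ ∃ (C : ℝ) (b' : ℕ → N), (∀ n, ‖b' n‖ ≤ C) ∧
    (∀ n, IsTransported M p Q θ (W n) (b' n)) ∧
    Filter.Tendsto (fun n => τ.hat (b' n)) Filter.atTop (𝓝 (τ.hat b))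

variable {τ}

namespace IsApproxTransported

variable {θ : N ≃⋆ₐ[ℂ] N} {W : ℕ → N} {b b' : N}

theorem zero : τ.IsApproxTransported M p Q θ W 0 :=
  ⟨zero_mem _, 0, fun _ => 0, fun _ => norm_zero.le, fun _ => .zero, tendsto_const_nhds⟩

theorem add (hb : τ.IsApproxTransported M p Q θ W b) (hb' : τ.IsApproxTransported M p Q θ W b') :
    τ.IsApproxTransported M p Q θ W (b + b') := by
  obtain ⟨h, C, x, hC, hx, hlim⟩ := hb
  obtain ⟨h', C', x', hC', hx', hlim'⟩ := hb'
  exact ⟨add_mem h h', C + C', fun n => x n + x' n,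
    fun n => (norm_add_le _ _).trans (add_le_add (hC n) (hC' n)), fun n => (hx n).add (hx' n), by
      simpa only [map_add] using hlim.add hlim'⟩

theorem smul (z : ℂ) (hb : τ.IsApproxTransported M p Q θ W b) :
    τ.IsApproxTransported M p Q θ W (z • b) := by
  obtain ⟨h, C, x, hC, hx, hlim⟩ := hb
  exact ⟨Submodule.smul_mem _ _ h, ‖z‖ * C, fun n => z • x n,
    fun n => by rw [norm_smul]; gcongr; exact hC n, fun n => (hx n).smul z, by
      simpa only [map_smul] using hlim.const_smul z⟩

theorem mul (hp : IsStarProjection p) (hQ : ∀ q ∈ Q, q ∈ corner M p)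
    (hb : τ.IsApproxTransported M p Q θ W b) (hb' : τ.IsApproxTransported M p Q θ W b') :
    τ.IsApproxTransported M p Q θ W (b * b') := by
  obtain ⟨h, C, x, hC, hx, hlim⟩ := hb
  obtain ⟨h', C', x', hC', hx', hlim'⟩ := hb'
  have hC0 : 0 ≤ C := (norm_nonneg _).trans (hC 0)
  refine ⟨mul_mem_corner h h', C * C', fun n => x n * x' n,
    fun n => (norm_mul_le _ _).trans (mul_le_mul (hC n) (hC' n) (norm_nonneg _) hC0),
    fun n => (hx n).mul hp hQ (hx' n), ?_⟩
  have h1 : Filter.Tendsto (fun n => τ.leftMul (x n) (τ.hat (x' n) - τ.hat b')) Filter.atTop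
      (𝓝 0) := by
    refine squeeze_zero_norm (a := fun n => C * ‖τ.hat (x' n) - τ.hat b'‖) (fun n => ?_) ?_
    · refine (τ.norm_leftMul_le _ _).trans ?_
      gcongr
      exact hC n
    · simpa using ((tendsto_iff_norm_sub_tendsto_zero.1 hlim').const_mul C)
  have h2 := h1.add (τ.tendsto_leftMul hC hlim (τ.hat b'))
  rw [zero_add, leftMul_hat] at h2
  refine h2.congr fun n => ?_
  rw [map_sub, sub_add_cancel, leftMul_hat]

theorem star (hp : IsStarProjection p) (hb : τ.IsApproxTransported M p Q θ W b) :
    τ.IsApproxTransported M p Q θ W (star b) := by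
  obtain ⟨h, C, x, hC, hx, hlim⟩ := hb
  refine ⟨star_mem_corner hp h, C, fun n => Star.star (x n),
    fun n => by rw [norm_star]; exact hC n, fun n => (hx n).star hp, ?_⟩
  simpa only [Function.comp_def, conj_hat] using (τ.conj.continuous.tendsto _).comp hlim

end IsApproxTransported

/-- The closed subspace of `L²(pMp)` spanned by the approximately transported elements. -/
def approxTransportedSubspace (τ : Trace N) (M : VonNeumannAlgebra H) (p : N)
    (Q : NonUnitalStarSubalgebra ℂ N) (θ : N ≃⋆ₐ[ℂ] N) (W : ℕ → N) : Submodule ℂ τ.L2 :=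
  (Submodule.map τ.hat
    { carrier := {b | τ.IsApproxTransported M p Q θ W b}
      add_mem' := fun ha hb => ha.add hb
      zero_mem' := .zero
      smul_mem' := fun c _ hb => hb.smul c }).topologicalClosure

instance (θ : N ≃⋆ₐ[ℂ] N) (W : ℕ → N) :
    CompleteSpace (τ.approxTransportedSubspace M p Q θ W) :=
  (Submodule.isClosed_topologicalClosure _).completeSpace_coe

section

variable {θ : N ≃⋆ₐ[ℂ] N} {W : ℕ → N} {b : N}

theorem IsApproxTransported.hat_mem (hb : τ.IsApproxTransported M p Q θ W b) :
    τ.hat b ∈ τ.approxTransportedSubspace M p Q θ W :=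
  Submodule.le_topologicalClosure _ ⟨b, hb, rfl⟩

theorem approxTransportedSubspace_induction {P : τ.L2 → Prop} (hP : IsClosed {ξ | P ξ})
    (h : ∀ b, τ.IsApproxTransported M p Q θ W b → P (τ.hat b)) {ξ : τ.L2}
    (hξ : ξ ∈ τ.approxTransportedSubspace M p Q θ W) : P ξ :=
  hP.closure_subset_iff.2 (by rintro _ ⟨x, hx, rfl⟩; exact h x hx) hξ

theorem approxTransportedSubspace_le :
    τ.approxTransportedSubspace M p Q θ W ≤ τ.L2Corner M p := fun _ hξ =>
  approxTransportedSubspace_induction (P := fun ξ => ξ ∈ τ.L2Corner M p)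
    (Submodule.isClosed_topologicalClosure _) (fun _ hb => τ.hat_mem_L2Corner hb.1) hξ

theorem IsApproxTransported.leftMul_mem (hp : IsStarProjection p) (hQ : ∀ q ∈ Q, q ∈ corner M p)
    (hb : τ.IsApproxTransported M p Q θ W b) {ξ : τ.L2}
    (hξ : ξ ∈ τ.approxTransportedSubspace M p Q θ W) :
    τ.leftMul b ξ ∈ τ.approxTransportedSubspace M p Q θ W :=
  approxTransportedSubspace_induction
    (P := fun ξ => τ.leftMul b ξ ∈ τ.approxTransportedSubspace M p Q θ W)
    ((Submodule.isClosed_topologicalClosure _).preimage (τ.leftMul b).continuous)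
    (fun b' hb' => by rw [leftMul_hat]; exact (hb.mul hp hQ hb').hat_mem) hξ

/-- Each approximant satisfies this with its own W n, but the conclusion does not mention W, so it
survives the 2-norm limit. -/
theorem star_mul_map_mul_mem_L2Corner (hp : IsStarProjection p)
    (hθ : ∀ x, τ.toPLM (θ x) = τ.toPLM x) (hW : ∀ n, IsIntertwiner Q p θ (W n)) {x : N}
    (hx : IsIntertwiner Q p θ x) {ξ : τ.L2} (hξ : ξ ∈ τ.approxTransportedSubspace M p Q θ W) :
    τ.leftMul (star x) (τ.rightMul x (τ.autL2 θ ξ)) ∈ τ.L2Corner M p := by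
  have hcl : IsClosed (τ.L2Corner M p : Set τ.L2) := Submodule.isClosed_topologicalClosure _
  refine approxTransportedSubspace_induction
    (P := fun ξ => τ.leftMul (star x) (τ.rightMul x (τ.autL2 θ ξ)) ∈ τ.L2Corner M p)
    (hcl.preimage (by fun_prop)) (fun b hb => ?_) hξ
  obtain ⟨-, C, b', -, hb', hlim⟩ := hb
  have hcont : Continuous fun ξ : τ.L2 => τ.leftMul (star x) (τ.rightMul x (τ.autL2 θ ξ)) := by
    fun_prop
  refine hcl.mem_of_tendsto ((hcont.tendsto _).comp hlim) (Filter.Eventually.of_forall fun n => ?_)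
  change τ.leftMul (star x) (τ.rightMul x (τ.autL2 θ (τ.hat (b' n)))) ∈ τ.L2Corner M p
  rw [τ.autL2_hat hθ, rightMul_hat, leftMul_hat, ← mul_assoc]
  exact τ.hat_mem_L2Corner ((hb' n).star_mul_map_mul hp (hW n) hx)

end

/-- If the cutoffs `h n` tend to the unit, the resolvents of the self-adjoint singular vectors are
approximately transported. -/
theorem isApproxTransported_resolvent (hMN : M ≤ N) (hp : IsStarProjection p)
    (hpM : (p : H →L[ℂ] H) ∈ M) (hQ : IsCornerSubalgebra M p Q) {θ : N ≃⋆ₐ[ℂ] N}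
    (hθ : ∀ x, τ.toPLM (θ x) = τ.toPLM x) {h W : ℕ → N} (hh : ∀ n, IsRelComm Q p (h n))
    (hsa : ∀ n, star (h n) = h n) (h1 : ∀ n, ‖h n‖ ≤ 1)
    (hlim : Filter.Tendsto (fun n => τ.hat (h n)) Filter.atTop (𝓝 (τ.hat p)))
    (hWI : ∀ n, IsIntertwiner Q p θ (W n))
    (hW : ∀ n, ∀ ξ ∈ τ.singularSubspace M p Q,
      τ.Transports θ (W n) (τ.leftMul (h n) (τ.rightMul (h n) ξ)))
    {ξ : τ.L2} (hξ : ξ ∈ τ.singularSubspace M p Q) (hξsa : τ.conj ξ = ξ) {R : N}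
    (hR : R ∈ corner M p) (hres : τ.IsResolvent p ξ R) :
    τ.IsApproxTransported M p Q θ W (p - Complex.I • R) := by
  have hQc : ∀ q ∈ Q, q ∈ corner M p := hQ.le_corner
  obtain ⟨ζ, hζ⟩ : ∃ ζ : ℕ → τ.L2, ζ = fun n => τ.leftMul (h n) (τ.rightMul (h n) ξ) := ⟨_, rfl⟩
  have hζs : ∀ n, ζ n ∈ τ.singularSubspace M p Q := fun n => by
    rw [hζ]
    exact leftMul_mem_singularSubspace hQc (hh n) (rightMul_mem_singularSubspace hQc (hh n) hξ)
  have hζsa : ∀ n, τ.conj (ζ n) = ζ n := fun n => by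
    rw [hζ]
    dsimp only
    rw [conj_leftMul, conj_rightMul, hξsa, hsa, rightMul_leftMul]
  have hζlim : Filter.Tendsto ζ Filter.atTop (𝓝 ξ) := by
    have e1 := τ.tendsto_leftMul h1 hlim ξ
    have e2 := τ.tendsto_rightMul h1 hlim ξ
    rw [τ.leftMul_of_mem_L2Corner hξ.1] at e1
    rw [τ.rightMul_of_mem_L2Corner hξ.1] at e2
    have e3 : Filter.Tendsto (fun n => τ.leftMul (h n) (τ.rightMul (h n) ξ - ξ)) Filter.atTop
        (𝓝 0) := by
      refine squeeze_zero_norm (fun n => ?_) (tendsto_iff_norm_sub_tendsto_zero.1 e2)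
      exact (τ.norm_leftMul_le _ _).trans (mul_le_of_le_one_left (norm_nonneg _) (h1 n))
    have e4 := e3.add e1
    rw [zero_add] at e4
    refine e4.congr fun n => ?_
    rw [hζ, map_sub, sub_add_cancel]
  choose S hS hSres using fun n => τ.exists_isResolvent hMN hp hpM (hζs n).1 (hζsa n)
  -- The resolvent identity Sₙ − R = Sₙ(ξ − ζₙ)R makes the resolvents converge in 2-norm when the
  -- vectors do.
  have hdiff : ∀ n, τ.hat (S n) - τ.hat R = τ.leftMul (S n) (τ.rightMul R (ξ - ζ n)) := fun n => by
    have e1 := congrArg (τ.leftMul (S n)) hres.mul_right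
    have e2 := congrArg (τ.rightMul R) (hSres n).mul_left
    rw [map_add, map_smul, leftMul_hat, leftMul_hat, (hS n).2.2] at e1
    rw [map_add, map_smul, rightMul_leftMul, rightMul_hat, rightMul_hat, hR.2.1] at e2
    rw [← e1, ← e2, map_sub, map_sub, add_sub_add_right_eq_sub]
  have hSlim : Filter.Tendsto (fun n => τ.hat (S n)) Filter.atTop (𝓝 (τ.hat R)) := by
    rw [tendsto_iff_norm_sub_tendsto_zero]
    have e1 : Filter.Tendsto (fun n => 2 * (2 * ‖ξ - ζ n‖)) Filter.atTop (𝓝 0) := by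
      have := (tendsto_iff_norm_sub_tendsto_zero.1 hζlim)
      simp only [norm_sub_rev _ ξ] at this
      simpa using (this.const_mul 2).const_mul 2
    refine squeeze_zero (fun n => norm_nonneg _) (fun n => ?_) e1
    rw [hdiff]
    refine (τ.norm_leftMul_le _ _).trans (mul_le_mul (hSres n).norm_le ?_ (norm_nonneg _) zero_le_two)
    exact (τ.norm_rightMul_le _ _).trans (mul_le_mul_of_nonneg_right hres.norm_le (norm_nonneg _))
  refine ⟨sub_mem (self_mem_corner hp hpM) (Submodule.smul_mem _ _ hR), ‖p‖ + 2,
    fun n => p - Complex.I • S n, fun n => ?_, fun n => ?_, ?_⟩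
  · refine (norm_sub_le _ _).trans (add_le_add le_rfl ?_)
    rw [norm_smul, Complex.norm_I, one_mul]
    exact (hSres n).norm_le
  · refine Transports.isTransported_resolvent hMN hp hpM hQ hθ ?_ (hWI n) (hζs n) (hζsa n) (hS n)
      (hSres n)
    rw [hζ]
    exact hW n ξ hξ
  · simp only [map_sub, map_smul]
    exact tendsto_const_nhds.sub (hSlim.const_smul _)

end Trace

end VonNeumannAlgebra

end

/-! ### W*(X) inside V + ℂp and the final estimate -/

noncomputable section

namespace VonNeumannAlgebra

variable {H : Type*} [NormedAddCommGroup H] [InnerProductSpace ℂ H] [CompleteSpace H]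

variable {N M : VonNeumannAlgebra H} {p : N} {Q : NonUnitalStarSubalgebra ℂ N}

namespace Trace

variable {τ : Trace N}

/-- R = i(F − p) with F = p − iR, so subspaces of L²(pMp) invariant under F are invariant under R.
-/
theorem leftMul_eq_of_mem (R : N) {v : τ.L2} (hv : v ∈ τ.L2Corner M p) :
    τ.leftMul R v = Complex.I • (τ.leftMul (p - Complex.I • R) v - v) := by
  rw [leftMul_sub, leftMul_smul, τ.leftMul_of_mem_L2Corner hv, sub_sub_cancel_left, smul_neg,
    smul_smul, Complex.I_mul_I, neg_one_smul, neg_neg]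

theorem leftMul_star_eq_of_mem (hp : IsStarProjection p) (R : N) {v : τ.L2}
    (hv : v ∈ τ.L2Corner M p) : τ.leftMul (star R) v =
      -(Complex.I • (τ.leftMul (star (p - Complex.I • R)) v - v)) := by
  rw [star_sub, star_smul, hp.isSelfAdjoint.star_eq, leftMul_sub, leftMul_smul,
    τ.leftMul_of_mem_L2Corner hv, sub_sub_cancel_left, smul_neg, smul_smul, Complex.star_def,
    Complex.conj_I, mul_neg, Complex.I_mul_I, neg_neg, neg_neg, one_smul]

set_option maxHeartbeats 1000000 in
/-- If a closed subspace `V` of `L²(pMp)` contains `F = p - i(ξ + i)⁻¹` and `F⋆` and is invariant under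
them, for all self-adjoint `ξ ∈ X`, then `W*(X)` is contained in `V + ℂ p`. -/
theorem exists_sub_smul_mem (hMN : M ≤ N) (hp : IsStarProjection p)
    (hpM : (p : H →L[ℂ] H) ∈ M) {X : Set (τ.L2Corner M p)}
    (hX : ∀ ξ ∈ X, ∃ ξ₁ ∈ X, ∃ ξ₂ ∈ X, τ.conj ξ₁ = ξ₁ ∧ τ.conj ξ₂ = ξ₂ ∧
      (ξ : τ.L2) = ξ₁ + Complex.I • (ξ₂ : τ.L2))
    {V : Submodule ℂ τ.L2} [CompleteSpace V] (hVK : V ≤ τ.L2Corner M p)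
    (hV : ∀ ξ ∈ X, τ.conj ξ = ξ → ∃ R ∈ corner M p, τ.IsResolvent p ξ R ∧
      τ.hat (p - Complex.I • R) ∈ V ∧ τ.hat (star (p - Complex.I • R)) ∈ V ∧ ∀ v ∈ V, τ.leftMul (p - Complex.I • R) v ∈ V ∧
        τ.leftMul (star (p - Complex.I • R)) v ∈ V)
    {b : N} (hb : b ∈ τ.WStar X) :
    ∃ z : ℂ, ‖z‖ ≤ ‖b‖ ∧ τ.hat (b - z • p) ∈ V := by
  obtain ⟨hbc, hbW⟩ := hb
  have hps : star p = p := hp.isSelfAdjoint.star_eq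
  have hpK : τ.hat p ∈ τ.L2Corner M p := τ.hat_mem_L2Corner (self_mem_corner hp hpM)
  -- V need not contain p. Its component e in V stays in V under W*(X), while the remainder ω is
  -- killed by all F and F⋆. Hence ℂω is invariant under the resolvents and b acts on ω as a scalar
  -- z.
  obtain ⟨e, he⟩ : ∃ e, e = V.starProjection (τ.hat p) := ⟨_, rfl⟩
  obtain ⟨ω, hω⟩ : ∃ ω, ω = τ.hat p - e := ⟨_, rfl⟩
  have heV : e ∈ V := by rw [he]; exact Submodule.starProjection_apply_mem _ _
  have hωK : ω ∈ τ.L2Corner M p := by rw [hω]; exact sub_mem hpK (hVK heV)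
  have hbe : τ.leftMul b e ∈ V :=
    τ.mem_of_mem_affiliatedWStar hMN hp hpM hX hVK (fun ξ hξ hsa => by
      obtain ⟨R, hR, hres, -, -, hinv⟩ := hV ξ hξ hsa
      refine ⟨R, hR, hres, fun v hv => ⟨?_, ?_⟩⟩
      · rw [leftMul_eq_of_mem R (hVK hv)]
        exact V.smul_mem _ (sub_mem (hinv v hv).1 hv)
      · rw [leftMul_star_eq_of_mem hp R (hVK hv)]
        exact neg_mem (V.smul_mem _ (sub_mem (hinv v hv).2 hv))) hbW ⟨e, hVK heV⟩ heV
  have : CompleteSpace (ℂ ∙ ω) := FiniteDimensional.complete ℂ _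
  have hωle : (ℂ ∙ ω) ≤ τ.L2Corner M p := by
    rw [Submodule.span_singleton_le_iff_mem]; exact hωK
  have hFω : ∀ F : N, F * p = F → τ.hat F ∈ V → (∀ v ∈ V, τ.leftMul F v ∈ V) →
      (∀ v ∈ V, τ.leftMul (star F) v ∈ V) → τ.leftMul F ω = 0 := fun F hFp hF h1 h2 => by
    rw [hω, map_sub, he, ← τ.starProjection_leftMul h1 h2, leftMul_hat, hFp,
      Submodule.starProjection_eq_self_iff.2 hF, sub_self]
  have hbω : τ.leftMul b ω ∈ ℂ ∙ ω :=
    τ.mem_of_mem_affiliatedWStar hMN hp hpM hX hωle (fun ξ hξ hsa => by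
      obtain ⟨R, hR, hres, hF, hF', hinv⟩ := hV ξ hξ hsa
      obtain ⟨F, hFR⟩ : ∃ F, F = p - Complex.I • R := ⟨_, rfl⟩
      have hFc : F ∈ corner M p := by
        rw [hFR]; exact sub_mem (self_mem_corner hp hpM) (Submodule.smul_mem _ _ hR)
      rw [← hFR] at hF hF' hinv
      have hω1 : τ.leftMul F ω = 0 :=
        hFω F hFc.2.2 hF (fun v hv => (hinv v hv).1) (fun v hv => (hinv v hv).2)
      have hω2 : τ.leftMul (star F) ω = 0 :=
        hFω _ (star_mem_corner hp hFc).2.2 hF' (fun v hv => (hinv v hv).2)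
          (fun v hv => by rw [star_star]; exact (hinv v hv).1)
      refine ⟨R, hR, hres, fun v hv => ?_⟩
      obtain ⟨c, rfl⟩ := Submodule.mem_span_singleton.1 hv
      rw [leftMul_eq_of_mem R (hωle hv), leftMul_star_eq_of_mem hp R (hωle hv), ← hFR, map_smul, map_smul, hω1, hω2, smul_zero,
        zero_sub]
      have := Submodule.smul_mem (ℂ ∙ ω) Complex.I (neg_mem hv)
      exact ⟨this, neg_mem this⟩) hbW ⟨ω, hωK⟩ (Submodule.mem_span_singleton_self ω)
  obtain ⟨z₀, hz₀⟩ := Submodule.mem_span_singleton.1 hbω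
  obtain ⟨z, hz, hzb⟩ : ∃ z : ℂ, z • ω = τ.leftMul b ω ∧ ‖z‖ ≤ ‖b‖ := by
    -- If ω = 0 the scalar is undetermined, and z = 0 keeps the bound ‖z‖ ≤ ‖b‖.
    by_cases h0 : ω = 0
    · exact ⟨0, by rw [h0, smul_zero, map_zero], by rw [norm_zero]; exact norm_nonneg _⟩
    · refine ⟨z₀, hz₀, ?_⟩
      have := τ.norm_leftMul_le b ω
      rw [← hz₀, norm_smul] at this
      exact le_of_mul_le_mul_right this (norm_pos_iff.2 h0)
  refine ⟨z, hzb, ?_⟩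
  have h1 : τ.hat (b - z • p) = τ.leftMul b e - z • e := by
    have h2 : τ.hat b = τ.leftMul b e + z • (τ.hat p - e) := by
      rw [← hω, hz, ← map_add, hω, add_sub_cancel, leftMul_hat, hbc.2.2]
    rw [map_sub, map_smul, h2, smul_sub]
    abel
  rw [h1]
  exact sub_mem hbe (V.smul_mem _ heV)

end Trace

namespace SMalleableDeformation

open Trace

variable {τ : Trace N} (D : SMalleableDeformation τ M)

theorem ε_ne_top (t : ℝ) (S : Set N) : D.ε t S ≠ ∞ := by
  have h : D.ε t S ≤ ENNReal.ofReal (2 * τ.norm2 1) := by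
    refine iSup₂_le fun x hx => ENNReal.ofReal_le_ofReal ?_
    have h1 : τ.norm2 x ≤ τ.norm2 1 := by
      have := norm2_mul_le_left (τ := τ) x 1
      rw [mul_one] at this
      exact this.trans (mul_le_of_le_one_left (Real.sqrt_nonneg _) hx.2)
    have h2 := norm2_add_le (τ := τ) (D.α t x) (-x)
    rw [← sub_eq_add_neg, norm2_neg, τ.norm2_map (D.α_trace t)] at h2
    linarith
  exact (h.trans_lt ENNReal.ofReal_lt_top).ne

theorem norm2_le_toReal_ε (t : ℝ) {S : Set N} {x : N} (hx : x ∈ S) (hx1 : ‖x‖ ≤ 1) :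
    τ.norm2 (D.α t x - x) ≤ (D.ε t S).toReal := by
  rw [← ENNReal.ofReal_le_iff_le_toReal (D.ε_ne_top t S)]
  exact le_iSup₂_of_le (f := fun x (_ : x ∈ {x ∈ S | ‖x‖ ≤ 1}) =>
    ENNReal.ofReal (τ.norm2 (D.α t x - x))) x ⟨hx, hx1⟩ le_rfl

/-- A transversality argument: x⋆α_t(y)x is fixed by β and close to α_t(y), so α_t(y) is close to
βα_t(y) = α_{-t}(y). -/
theorem norm2_α_two_mul_sub_le {t δ : ℝ} {x y : N} (hy : y ∈ corner M p) (hy2 : ‖y‖ ≤ 2)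
    (hx1 : ‖x‖ ≤ 1) (hxp : τ.norm2 (x - p) ≤ δ) (hδ : τ.norm2 (D.α t p - p) ≤ δ)
    (hmem : τ.leftMul (star x) (τ.rightMul x (τ.autL2 (D.α t) (τ.hat y))) ∈ τ.L2Corner M p)
    (hp : IsStarProjection p) : τ.norm2 (D.α (2 * t) y - y) ≤ 16 * δ := by
  obtain ⟨Y, hY⟩ : ∃ Y, Y = D.α t y := ⟨_, rfl⟩
  obtain ⟨P, hP⟩ : ∃ P, P = D.α t p := ⟨_, rfl⟩
  rw [← hP] at hδ
  have hPs : star P = P := by rw [hP, ← map_star, hp.isSelfAdjoint.star_eq]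
  have hPY : P * Y = Y := by rw [hP, hY, ← map_mul, hy.2.1]
  have hYP : Y * P = Y := by rw [hP, hY, ← map_mul, hy.2.2]
  have hY2 : ‖Y‖ ≤ 2 := by
    rw [hY]; exact (NonUnitalStarAlgHom.norm_apply_le (D.α t) y).trans hy2
  rw [τ.autL2_hat (D.α_trace t), rightMul_hat, leftMul_hat, ← hY] at hmem
  have hβ : D.β (star x * (Y * x)) = star x * (Y * x) := by
    have := D.autL2_β_of_mem hmem
    rw [τ.autL2_hat D.β_trace] at this
    exact τ.hat_injective this
  have hxP : τ.norm2 (x - P) ≤ 2 * δ := by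
    have := norm2_add_le (τ := τ) (x - p) (-(P - p))
    rw [norm2_neg, ← sub_eq_add_neg, sub_sub_sub_cancel_right] at this
    linarith
  have hδ0 : 0 ≤ δ := (Real.sqrt_nonneg _).trans hδ
  -- With P = α_t(p), ‖x − P‖₂ ≤ 2δ. Replacing x and x⋆ by P one at a time, next to a factor of norm
  -- at most 2, costs 4δ each.
  have h8 : τ.norm2 (star x * (Y * x) - Y) ≤ 8 * δ := by
    have e1 : star x * (Y * x) - Y = star x * Y * (x - P) + star (x - P) * Y := by
      rw [star_sub, hPs, mul_sub, sub_mul, hPY, mul_assoc _ Y P, hYP, mul_assoc]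
      abel
    rw [e1]
    refine (norm2_add_le _ _).trans ?_
    have e2 := norm2_mul_le_left (τ := τ) (star x * Y) (x - P)
    have e3 := τ.norm2_mul_le (star (x - P)) Y
    rw [τ.norm2_star] at e3
    have e4 : ‖star x * Y‖ ≤ 2 := by
      refine (norm_mul_le _ _).trans ?_
      rw [norm_star]
      exact (mul_le_of_le_one_left (norm_nonneg _) hx1).trans hY2
    have e5 := mul_le_mul e4 hxP (Real.sqrt_nonneg _) zero_le_two
    have e6 := mul_le_mul hY2 hxP (Real.sqrt_nonneg _) zero_le_two
    linarith
  have e1 : D.α (2 * t) y - y = D.α t (Y - D.β Y) := by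
    rw [hY, D.β_α, D.β_eq_self y hy.1, map_sub, D.α_α_neg, two_mul, D.α_add]
  have e2 : Y - D.β Y = -(star x * (Y * x) - Y) + D.β (star x * (Y * x) - Y) := by
    rw [map_sub, hβ]
    abel
  rw [e1, τ.norm2_map (D.α_trace t), e2]
  refine (norm2_add_le _ _).trans ?_
  rw [norm2_neg, τ.norm2_map D.β_trace]
  linarith

/-- The deformation is uniformly small on the unit ball of `W*(X)`, where `X` is the set of singular
vectors. -/
theorem norm2_α_two_mul_sub_le_of_mem_WStar (hMN : M ≤ N) (hp : IsStarProjection p)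
    (hpM : (p : H →L[ℂ] H) ∈ M) (hQ : IsCornerSubalgebra M p Q) (hrig : D.IsRigid Q) (t : ℝ) {b : N}
    (hb : b ∈ τ.WStar (τ.singularVectors Q (τ.L2Corner M p) (τ.L2Ortho M p))) (hb1 : ‖b‖ ≤ 1) :
    τ.norm2 (D.α (2 * t) b - b) ≤ 18 * (D.ε t Q).toReal := by
  have hQc : ∀ q ∈ Q, q ∈ corner M p := hQ.le_corner
  have hmemX : ∀ ξ : τ.L2Corner M p, ξ ∈ τ.singularVectors Q (τ.L2Corner M p) (τ.L2Ortho M p) ↔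
    (ξ : τ.L2) ∈ τ.singularSubspace M p Q := τ.mem_singularVectors_iff_mem_singularSubspace hQc
  have hp1 : ‖p‖ ≤ 1 := norm_le_one_of_star_mul_self_eq hp
    (by rw [hp.isSelfAdjoint.star_eq, hp.isIdempotentElem.eq])
  -- The step 2sₙ = t/(n + 1), taken n + 1 times, reaches exactly t, and rigidity makes the cutoff
  -- error at sₙ tend to zero.
  obtain ⟨s, hs⟩ : ∃ s : ℕ → ℝ, s = fun n : ℕ => t / 2 * (1 / ((n : ℝ) + 1)) := ⟨_, rfl⟩
  have hst : ∀ n : ℕ, ((n + 1 : ℕ) : ℝ) * (2 * s n) = t := fun n => by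
    rw [hs]
    push_cast
    field_simp
  have hs0 : Filter.Tendsto s Filter.atTop (𝓝 0) := by
    rw [hs]
    simpa using (tendsto_one_div_add_atTop_nhds_zero_nat (𝕜 := ℝ)).const_mul (t / 2)
  choose h W hh hsa h1 hhp hWI hWξ using fun n : ℕ => D.exists_transports hp hQ (s := s n)
    (fun q hq hq1 => D.norm2_le_toReal_ε (s n) hq hq1) (n + 1)
  simp only [hst] at hWI hWξ
  have hlim : Filter.Tendsto (fun n => τ.hat (h n)) Filter.atTop (𝓝 (τ.hat p)) := by
    rw [tendsto_iff_norm_sub_tendsto_zero]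
    have e1 : Filter.Tendsto (fun n => 6 * (D.ε (s n) Q).toReal) Filter.atTop (𝓝 0) := by
      have := (ENNReal.tendsto_toReal ENNReal.zero_ne_top).comp (hrig.comp hs0)
      simpa using this.const_mul 6
    refine squeeze_zero (fun n => norm_nonneg _) (fun n => ?_) e1
    rw [← map_sub, τ.norm_hat]
    exact hhp n
  obtain ⟨x, hx, hx1, hxp⟩ := hQ.exists_isIntertwiner hp τ (D.α t)
    (fun q hq hq1 => D.norm2_le_toReal_ε t hq hq1)
  obtain ⟨z, hz, hzV⟩ := exists_sub_smul_mem hMN hp hpM (fun ξ hξ => by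
      obtain ⟨ξ₁, h1, ξ₂, h2, h3, h4, h5⟩ := exists_selfAdjoint_decomposition hp ((hmemX ξ).1 hξ)
      exact ⟨⟨ξ₁, h1.1⟩, (hmemX _).2 h1, ⟨ξ₂, h2.1⟩, (hmemX _).2 h2, h3, h4, h5⟩)
    (V := τ.approxTransportedSubspace M p Q (D.α t) W) approxTransportedSubspace_le
    (fun ξ hξ hξsa => by
      obtain ⟨R, hR, hres⟩ := τ.exists_isResolvent hMN hp hpM ξ.2 hξsa
      have hF := isApproxTransported_resolvent hMN hp hpM hQ (D.α_trace t) hh hsa h1 hlim hWI hWξ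
        ((hmemX ξ).1 hξ) hξsa hR hres
      exact ⟨R, hR, hres, hF.hat_mem, (hF.star hp).hat_mem, fun v hv =>
        ⟨hF.leftMul_mem hp hQc hv, (hF.star hp).leftMul_mem hp hQc hv⟩⟩) hb
  have hmem := star_mul_map_mul_mem_L2Corner hp (D.α_trace t) hWI hx hzV
  have hpε := D.norm2_le_toReal_ε t hQ.unit_mem hp1
  have hyc : b - z • p ∈ corner M p :=
    sub_mem hb.choose (Submodule.smul_mem _ _ (self_mem_corner hp hpM))
  have hzp : ‖z • p‖ ≤ 1 := by
    rw [norm_smul]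
    exact mul_le_one₀ (hz.trans hb1) (norm_nonneg _) hp1
  -- y = b − zp has norm at most 2 because ‖z‖ ≤ ‖b‖ ≤ 1. Together with the 2ε for zp this gives
  -- 18ε.
  have h16 := D.norm2_α_two_mul_sub_le hyc (by linarith [norm_sub_le b (z • p)]) hx1 hxp hpε hmem hp
  have h2 : τ.norm2 (D.α (2 * t) p - p) ≤ 2 * (D.ε t Q).toReal := by
    have e1 : D.α (2 * t) p - p = D.α t (D.α t p - p) + (D.α t p - p) := by
      rw [two_mul, D.α_add, map_sub]
      abel
    rw [e1]
    refine (norm2_add_le _ _).trans ?_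
    rw [τ.norm2_map (D.α_trace t)]
    linarith
  have e1 : D.α (2 * t) b - b =
      (D.α (2 * t) (b - z • p) - (b - z • p)) + z • (D.α (2 * t) p - p) := by
    rw [map_sub, map_smul, smul_sub]
    abel
  have e2 : τ.norm2 (z • (D.α (2 * t) p - p)) ≤ 2 * (D.ε t Q).toReal := by
    rw [← τ.norm_hat, map_smul, norm_smul, τ.norm_hat]
    exact (mul_le_of_le_one_left (Real.sqrt_nonneg _) (hz.trans hb1)).trans h2
  rw [e1]
  exact (norm2_add_le _ _).trans (by linarith)

theorem ε_two_mul_WStar_le (hMN : M ≤ N) (hp : IsStarProjection p)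
    (hpM : (p : H →L[ℂ] H) ∈ M) (hQ : IsCornerSubalgebra M p Q) (hrig : D.IsRigid Q) (t : ℝ) :
    D.ε (2 * t) (τ.WStar (τ.singularVectors Q (τ.L2Corner M p) (τ.L2Ortho M p))) ≤
      24 * D.ε t Q := by
  refine iSup₂_le fun b hb => ?_
  have h1 := D.norm2_α_two_mul_sub_le_of_mem_WStar hMN hp hpM hQ hrig t hb.1 hb.2
  have h0 : 0 ≤ (D.ε t Q).toReal := ENNReal.toReal_nonneg
  calc ENNReal.ofReal (τ.norm2 (D.α (2 * t) b - b)) ≤ ENNReal.ofReal (24 * (D.ε t Q).toReal) :=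
        ENNReal.ofReal_le_ofReal (by linarith)
    _ = 24 * D.ε t Q := by
        rw [ENNReal.ofReal_mul (by norm_num), ENNReal.ofReal_toReal (D.ε_ne_top t Q)]
        norm_num

end SMalleableDeformation
end VonNeumannAlgebra
end

theorem theoremT {H : Type*} [NormedAddCommGroup H] [InnerProductSpace ℂ H] [CompleteSpace H]
    (N M : VonNeumannAlgebra H) (hMN : M ≤ N) (τ : N.Trace)
    (D : VonNeumannAlgebra.SMalleableDeformation τ M)
    (p : N) (hp : IsStarProjection p) (hpM : (p : H →L[ℂ] H) ∈ M)
    (Q : NonUnitalStarSubalgebra ℂ N) (hQ : VonNeumannAlgebra.IsCornerSubalgebra M p Q)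
    (hrig : D.IsRigid Q)
    (X : Set (τ.L2Corner M p))
    (hX : X = τ.singularVectors Q (τ.L2Corner M p) (τ.L2Ortho M p)) :
    (∀ B ∈ τ.affiliatedWStar X, ∃ x : VonNeumannAlgebra.corner M p, τ.leftRep M p x = B) ∧
      D.IsRigid (τ.WStar X) ∧
      ∀ t : ℝ, D.ε (2 * t) (τ.WStar X) ≤ 24 * D.ε t Q := by
  subst hX
  have h := D.ε_two_mul_WStar_le hMN hp hpM hQ hrig
  refine ⟨fun B hB => τ.exists_leftRep_eq hMN hp hpM hB, ?_, h⟩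
  -- The bound at time t/2 controls the time t, so rigidity of W*(X) follows from that of Q.
  have h1 : Filter.Tendsto (fun t : ℝ => 24 * D.ε (t / 2) Q) (𝓝 0) (𝓝 0) := by
    have h2 : Filter.Tendsto (fun t : ℝ => t / 2) (𝓝 0) (𝓝 0) := by
      simpa using (continuous_id.div_const (2 : ℝ)).tendsto 0
    simpa using ENNReal.Tendsto.const_mul (hrig.comp h2) (Or.inr (by norm_num))
  refine tendsto_of_tendsto_of_tendsto_of_le_of_le tendsto_const_nhds h1 (fun _ => zero_le)
    fun t => ?_
  have := h (t / 2)
  rwa [mul_div_cancel₀ t (two_ne_zero' ℝ)] at this
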